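/- **Setting.** Put $\epsilon=1/100$ and let $\eta>40$. Let $H$ be holomorphic and even on the strip $|\mathrm{Re}\,\mu|<2\eta$ with $H(\mu)\ll e^{-2\pi|\mu|}$ there. Let $\alpha_1,\alpha_2,\alpha_3\in\mathbb C$ be distinct with $\alpha_1+\alpha_2+\alpha_3=0$ and $|\mathrm{Re}\,\alpha_1|,|\mathrm{Re}\,\alpha_2|<\epsilon/1000$. Write $s=\sigma+it$; $\int_{(c)}$ is the integral over the upward line of real part $c$. Let $W_\mu(y)=2\sqrt y\,K_\mu(2\pi y)$ with $K_\mu$ the modified Bessel function of the second kind, $$h(y)=H^\flat(y)=\frac1{4\pi i}\int_{(0)}H(\mu)W_\mu(y)\frac{d\mu}{|\Gamma(\mu)|^2},\qquad \widetilde h(w)=\int_0^\infty h(y)y^{w}\frac{dy}{y}.$$ For the Weyl elements $w_2,w_4,w_\ell$ let $\alpha^{w}=(\alpha_1^w,\alpha_2^w,\alpha_3^w)$ be $(\alpha_2,\alpha_1,\alpha_3)$, $(\alpha_3,\alpha_1,\alpha_2)$, $(\alpha_3,\alpha_2,\alpha_1)$ respectively. Define $$(J_\alpha h)(s;w)=\int_0^\infty\!\!\int_0^\infty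 h(y_1)\,y_1^{s-\frac{\alpha_3^w}2}y_0^{2s-\alpha_3^w}(1+y_0^2)^{-\frac34(1-\alpha_3^w)}\,W_{(\alpha_1^w-\alpha_2^w)/2}\!\left(y_1\sqrt{1+y_0^2}\right)\frac{dy_0\,dy_1}{y_0y_1^2},$$ $$(\mathcal F_\alpha H)(s_0,s)=\sqrt\pi\int_{(\eta-\frac12)}\widetilde h\!\left(s-s_1-\tfrac12\right)\pi^{-s_1}\frac{\prod_{i=1}^3\Gamma\left(\frac{s_1-\alpha_i}2\right)}{\Gamma\left(\frac{1+s_1}2-s_0\right)}\int_{(\epsilon)}\frac{\Gamma\left(\frac u2\right)\Gamma\left(\frac{s_1-(s_0-u)}2+\frac12-s\right)\prod_{i=1}^3\Gamma\left(\frac{s_0-u+\alpha_i}2\right)\Gamma\left(s-\frac{s_0+u}2\right)}{\Gamma\left(\frac{1-u}2\right)\Gamma\left(\frac{s_0-u+s_1}2\right)}\frac{du}{2\pi i}\frac{ds_1}{2\pi i}.$$ **Theorem.** (1) Let $w\in\{w_2,w_4,w_\ell\}$. For $0<\sigma<1$ with $\sigma>-\mathrm{Re}\,\alpha_1^w$,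 $\sigma>-\mathrm{Re}\,\alpha_2^w$ and $\sigma<1-\mathrm{Re}\,\alpha_3^w$, the integral $(J_\alpha h)(s;w)$ converges absolutely and $$(J_\alpha h)(s;w)=\frac{\pi^{-(s-\alpha_3^w/2)}}8\,\Gamma\!\left(\tfrac{1+\alpha_2^w-\alpha_3^w}2\right)^{-1}\Gamma\!\left(\tfrac{1+\alpha_1^w-\alpha_3^w}2\right)^{-1}\int_{(0)}\frac{H(\mu)}{|\Gamma(\mu)|^2}\prod_\pm\Gamma\!\left(\tfrac{s\pm\mu+\alpha_1^w}2\right)\Gamma\!\left(\tfrac{s\pm\mu+\alpha_2^w}2\right)\Gamma\!\left(\tfrac{1-s\pm\mu-\alpha_3^w}2\right)\frac{d\mu}{2\pi i}.$$ (2) Let $i\in\{1,2,3\}$. The double integral defining $(\mathcal F_\alpha H)(1-\alpha_i,s)$ converges absolutely for $\frac12+\epsilon<\sigma<4$, and as a function of $s$ it continues to $\max(0,\mathrm{Re}\,\alpha_i)<\sigma<4$, holomorphically except for at most a simple pole at $s=(1-\alpha_i)/2$. For $0<\sigma<1$ with $\sigma>\mathrm{Re}\,\alpha_i$, $\sigma<1+\mathrm{Re}\,\alpha_j$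 for $j\ne i$, and $s\neq(1-\alpha_i)/2$, the continuation satisfies $$(\mathcal F_\alpha H)(1-\alpha_i,s)=\pi^{\frac12-s}\,\frac{\Gamma\left(s-\frac12+\frac{\alpha_i}2\right)}{\Gamma\left(1-s-\frac{\alpha_i}2\right)}\int_{(0)}\frac{H(\mu)}{|\Gamma(\mu)|^2}\prod_\pm\Gamma\!\left(\tfrac{s\pm\mu-\alpha_i}2\right)\prod_{j\ne i}\Gamma\!\left(\tfrac{1-s\pm\mu+\alpha_j}2\right)\frac{d\mu}{2\pi i}.$$ (3) The double integral defining $(\mathcal F_\alpha H)(2s-1,s)$ converges absolutely for $\frac12+\epsilon<\sigma<4$, and as a function of $s$ it continues to $0<\sigma<4$, holomorphically except for at most simple poles at $s=(1-\alpha_i)/2$, $i=1,2,3$. For $0<\sigma<1$ with $\sigma<1+\mathrm{Re}\,\alpha_i$ and $s\ne(1-\alpha_i)/2$ for all $i$, the continuation satisfies $$(\mathcal F_\alpha H)(2s-1,s)=\pi^{\frac12-s}\prod_{i=1}^3\frac{\Gamma\left(s-\frac12+\frac{\alpha_i}2\right)}{\Gamma\left(1-s-\frac{\alpha_i}2\right)}\int_{(0)}\frac{H(\mu)}{|\Gamma(\mu)|^2}\prod_{i=1}^3\prod_\pm\Gamma\!\left(\tfrac{1-s\pm\mu+\alpha_i}2\right)\frac{d\mu}{2\pi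 i}.$$ In each case the $\mu$-integral converges absolutely. If the $\alpha_i$ are purely imaginary, the conditions on $\sigma$ in (1), (2), (3) reduce to $0<\sigma<1$. -/

import Mathlib

open Complex MeasureTheory Set

noncomputable section

namespace MellinBarnesSwap

/-- The six elements of the Weyl group of `GL₃`. -/
inductive Weyl : Type
  | I | w2 | w3 | w4 | w5 | wl

/-- The action of the Weyl group on triples of Langlands parameters;
`α 0, α 1, α 2` are the parameters usually called `α₁, α₂, α₃`. -/
def Weyl.act : Weyl → (Fin 3 → ℂ) → (Fin 3 → ℂ)
  | .I, α => ![α 0, α 1, α 2]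
  | .w2, α => ![α 1, α 0, α 2]
  | .w3, α => ![α 0, α 2, α 1]
  | .w4, α => ![α 2, α 0, α 1]
  | .w5, α => ![α 1, α 2, α 0]
  | .wl, α => ![α 2, α 1, α 0]

/-- The fixed constant `ε = 1/100`. -/
def eps : ℝ := 1 / 100

/-- The class `𝒞_η` of test functions: `H` is holomorphic and even on the strip `|Re μ| < 2η`
and satisfies `H(μ) ≪ exp(-2π|μ|)` there. -/
structure TestClass (η : ℝ) (H : ℂ → ℂ) : Prop where
  holo : DifferentiableOn ℂ H {μ : ℂ | |μ.re| < 2 * η}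
  even : ∀ μ : ℂ, |μ.re| < 2 * η → H (-μ) = H μ
  decay : ∃ C : ℝ, ∀ μ : ℂ, |μ.re| < 2 * η → ‖H μ‖ ≤ C * Real.exp (-2 * Real.pi * ‖μ‖)

/-- The integral `∫_{(c)} f(z) dz / (2πi)` over the upward vertical line `Re z = c`. -/
def vint (c : ℝ) (f : ℂ → ℂ) : ℂ :=
  (1 / (2 * Real.pi) : ℂ) * ∫ v : ℝ, f ((c : ℂ) + (v : ℂ) * Complex.I)

/-- The modified Bessel function of the second kind,
`K_μ(x) = ∫_0^∞ exp(-x cosh t) cosh(μ t) dt` for `x > 0` and `μ ∈ ℂ`. -/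
def besselK (μ : ℂ) (x : ℝ) : ℂ :=
  ∫ t in Ioi (0 : ℝ), (Real.exp (-x * Real.cosh t) : ℂ) * Complex.cosh (μ * (t : ℂ))

/-- The Whittaker function of `GL₂(ℝ)`: `W_μ(y) = 2 √y K_μ(2πy)` for `y > 0`. -/
def whittaker (μ : ℂ) (y : ℝ) : ℂ :=
  2 * (Real.sqrt y : ℂ) * besselK μ (2 * Real.pi * y)

/-- The inverse Kontorovich-Lebedev transform
`H^♭(y) = (1/(4πi)) ∫_{(0)} H(μ) W_μ(y) dμ / |Γ(μ)|²`. -/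
def flat (H : ℂ → ℂ) (y : ℝ) : ℂ :=
  (1 / 2 : ℂ) * vint 0 (fun μ => H μ * whittaker μ y / ((‖Gamma μ‖ ^ 2 : ℝ) : ℂ))

/-- The integrand of `(J_α h)(s; w)` (as a function of `(y₀, y₁)`), where `β = α^w`. -/
def swapIntegrand (β : Fin 3 → ℂ) (h : ℝ → ℂ) (s : ℂ) (y₀ y₁ : ℝ) : ℂ :=
  h y₁ * (y₁ : ℂ) ^ (s - β 2 / 2) * (y₀ : ℂ) ^ (2 * s - β 2)
    * ((1 + y₀ ^ 2 : ℝ) : ℂ) ^ (-(3 / 4 : ℂ) * (1 - β 2))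
    * whittaker ((β 0 - β 1) / 2) (y₁ * Real.sqrt (1 + y₀ ^ 2))
    / ((y₀ : ℂ) * (y₁ : ℂ) ^ 2)

/-- The `1`-swap integral `(J_α h)(s; w)`. -/
def swapJ (α : Fin 3 → ℂ) (h : ℝ → ℂ) (s : ℂ) (w : Weyl) : ℂ :=
  ∫ y₁ in Ioi (0 : ℝ), ∫ y₀ in Ioi (0 : ℝ), swapIntegrand (w.act α) h s y₀ y₁

/-- The integrand (without the factor `√π`) of the Mellin-Barnes integral defining
`(ℱ_α H)(s₀, s)`, as a function of `(s₁, u)`. The Mellin transform of `h = H^♭` is Mathlib's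
`mellin h w = ∫_0^∞ h(y) y^{w-1} dy`. -/
def dualIntegrand (α : Fin 3 → ℂ) (H : ℂ → ℂ) (s₀ s s₁ u : ℂ) : ℂ :=
  mellin (flat H) (s - s₁ - 1 / 2) * (Real.pi : ℂ) ^ (-s₁)
    * ((∏ i, Gamma ((s₁ - α i) / 2)) / Gamma ((1 + s₁) / 2 - s₀))
    * ((Gamma (u / 2) * Gamma ((s₁ - (s₀ - u)) / 2 + 1 / 2 - s)
          * (∏ i, Gamma ((s₀ - u + α i) / 2)) * Gamma (s - (s₀ + u) / 2))
        / (Gamma ((1 - u) / 2) * Gamma ((s₀ - u + s₁) / 2)))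

/-- The dual transform `(ℱ_α H)(s₀, s)` for `H ∈ 𝒞_η`, as an iterated integral over the lines
`Re s₁ = η - 1/2` and `Re u = ε`. -/
def dualTransform (η : ℝ) (α : Fin 3 → ℂ) (H : ℂ → ℂ) (s₀ s : ℂ) : ℂ :=
  (Real.sqrt Real.pi : ℂ) *
    vint (η - 1 / 2) (fun s₁ => vint eps (fun u => dualIntegrand α H s₀ s s₁ u))

/-- Absolute convergence of the double integral defining `(ℱ_α H)(s₀, s)`. -/
def DualConverges (η : ℝ) (α : Fin 3 → ℂ) (H : ℂ → ℂ) (s₀ s : ℂ) : Prop :=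
  Integrable (fun p : ℝ × ℝ =>
    dualIntegrand α H s₀ s (((η - 1 / 2 : ℝ) : ℂ) + (p.1 : ℂ) * Complex.I)
      ((eps : ℂ) + (p.2 : ℂ) * Complex.I))

/-- `F` continues the function `f`, given on `U ⊆ V`, to the domain `V`; it is holomorphic on `V`
except for the points of `P`, at which it has at most simple poles. -/
structure IsContinuation (f F : ℂ → ℂ) (U V P : Set ℂ) : Prop where
  subset : U ⊆ V
  eqOn : EqOn F f U
  holo : DifferentiableOn ℂ F (V \ P)
  pole : ∀ p ∈ P, MeromorphicAt F p ∧ (-1 : WithTop ℤ) ≤ meromorphicOrderAt F p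

/-- The vertical strip `a < Re s < b`. -/
def strip (a b : ℝ) : Set ℂ := {s : ℂ | a < s.re ∧ s.re < b}

/-- The product `∏_± Γ((a ± μ)/2)`. -/
def gammaPM (a μ : ℂ) : ℂ := Gamma ((a + μ) / 2) * Gamma ((a - μ) / 2)

/-- The integrand of the `1`-swap Mellin-Barnes integral, where `β = α^w`. -/
def oneSwap (β : Fin 3 → ℂ) (H : ℂ → ℂ) (s μ : ℂ) : ℂ :=
  H μ / ((‖Gamma μ‖ ^ 2 : ℝ) : ℂ)
    * (gammaPM (s + β 0) μ * gammaPM (s + β 1) μ * gammaPM (1 - s - β 2) μ)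

/-- The integrand of the `2`-swap Mellin-Barnes integral. -/
def twoSwap (α : Fin 3 → ℂ) (i : Fin 3) (H : ℂ → ℂ) (s μ : ℂ) : ℂ :=
  H μ / ((‖Gamma μ‖ ^ 2 : ℝ) : ℂ)
    * (gammaPM (s - α i) μ * ∏ j ∈ Finset.univ.erase i, gammaPM (1 - s + α j) μ)

/-- The integrand of the `3`-swap Mellin-Barnes integral. -/
def threeSwap (α : Fin 3 → ℂ) (H : ℂ → ℂ) (s μ : ℂ) : ℂ :=
  H μ / ((‖Gamma μ‖ ^ 2 : ℝ) : ℂ) * ∏ i, gammaPM (1 - s + α i) μ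

end MellinBarnesSwap

end

/-! All three identities are instances of one formula. For parameters a₁, a₂, a₃ consider the
integral over a vertical p-line of h̃(s − p − 1/2) π^(−p) Γ(a₁ + p/2) Γ(a₂ + p/2) Γ(a₃ + p/2) / Γ(s
+ a₁ + a₂ + a₃ + p/2). For Re w > −1/2, h̃(w) is an integral over imaginary μ of H(μ)/|Γ(μ)|²
against Γ((w + 1/2 ± μ)/2). At w = s − p − 1/2 these factors are Γ((s − p ± μ)/2), and the
denominator above is exactly the one required by Barnes' second lemma. After interchanging the
integrals, the p-integral collapses to the six values Γ(aᵢ + (s ± μ)/2) divided by the three values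
Γ(s + aᵢ + aⱼ). This is `vint_mellin_flat_mul_gammaQuot`.

For the 1-swap, the Mellin-Barnes integral of the Whittaker function separates the variables: the
y₀-integral is a beta integral, the y₁-integral is h̃, and the master integral appears
(`swap_identity`). For the dual transform, at s₀ = 1 − αᵢ and at s₀ = 2s − 1 one Gamma factor
cancels Γ((1 − u)/2). The u-integral is then a Barnes integral of the second kind, because the αᵢ
sum to zero. What remains is the master integral times Gamma factors in s, and these factors carry
all the poles (`dualTransform_eq`).

The outer line Re s₁ = η − 1/2 is not always left of Re s, as the formula for h̃ requires. So h̃ has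
to be continued far to the left, that is, H^♭ has to vanish to high order at 0. On the imaginary
axis 1/|Γ(μ)|² = −μ sin(πμ)/π, so the spectral weight extends holomorphically and vanishes at every
integer. With Φ its Fourier transform, H^♭(y) = ½ √y ∫ exp(−2πy cosh t) Φ(t) dt. Shifting the
contour to Re μ = −n and inverting gives ∫ Φ(t) e^(nt) dt = 0 for integers |n| < 2η. Hence Φ is
orthogonal to low powers of cosh t, the Taylor terms of the exponential drop out, and H^♭(y) =
O(y^(N + 1/2)) for every natural N < 2η (`norm_flat_le_rpow`). The contour can then be moved without
crossing poles (`vint_mellin_flat_shift`).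

Barnes' first lemma is Mellin-Parseval for two beta kernels; the second follows by applying the
first three times to a double integral. -/

namespace MellinBarnesSwap

/-! ### Bounds for the Gamma function and its quotients -/

theorem norm_Gamma_le {z : ℂ} (hz : 0 < z.re) : ‖Gamma z‖ ≤ Real.Gamma z.re := by
  rw [Gamma_eq_integral hz, Real.Gamma_eq_integral hz, GammaIntegral]
  refine (norm_integral_le_integral_norm _).trans (le_of_eq ?_)
  refine setIntegral_congr_fun measurableSet_Ioi fun x hx => ?_
  have hx : 0 < x := hx
  simp [norm_cpow_eq_rpow_re_of_pos hx, Complex.norm_exp]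

/-- Inside the Euler integral, t^(x−1) is at most t^(a−1) for t ≤ 1 and at most t^(b−1) for t ≥ 1.
-/
theorem Gamma_le_add {x a b : ℝ} (ha : 0 < a) (hax : a ≤ x) (hxb : x ≤ b) :
    Real.Gamma x ≤ Real.Gamma a + Real.Gamma b := by
  rw [Real.Gamma_eq_integral (ha.trans_le hax), Real.Gamma_eq_integral ha,
    Real.Gamma_eq_integral (ha.trans_le (hax.trans hxb)),
    ← integral_add (Real.GammaIntegral_convergent ha)
      (Real.GammaIntegral_convergent (ha.trans_le (hax.trans hxb)))]
  refine setIntegral_mono_on (Real.GammaIntegral_convergent (ha.trans_le hax))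
    ((Real.GammaIntegral_convergent ha).add
      (Real.GammaIntegral_convergent (ha.trans_le (hax.trans hxb)))) measurableSet_Ioi ?_
  intro t ht
  have ht : 0 < t := ht
  rw [← mul_add]
  refine mul_le_mul_of_nonneg_left ?_ (Real.exp_pos _).le
  have h1 := Real.rpow_nonneg ht.le (a - 1)
  have h2 := Real.rpow_nonneg ht.le (b - 1)
  rcases le_total t 1 with h | h
  · linarith [Real.rpow_le_rpow_of_exponent_ge ht h (by linarith : a - 1 ≤ x - 1)]
  · linarith [Real.rpow_le_rpow_of_exponent_le h (by linarith : x - 1 ≤ b - 1)]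

theorem norm_Gamma_le_add {z : ℂ} {a b : ℝ} (ha : 0 < a) (haz : a ≤ z.re) (hzb : z.re ≤ b) :
    ‖Gamma z‖ ≤ Real.Gamma a + Real.Gamma b :=
  (norm_Gamma_le (ha.trans_le haz)).trans (Gamma_le_add ha haz hzb)

/-- Rapid decay of the Gamma function in vertical strips. -/
theorem exists_Gamma_decay (n : ℕ) {a b : ℝ} (ha : 0 < a) :
    ∃ C : ℝ, 0 ≤ C ∧ ∀ z : ℂ, a ≤ z.re → z.re ≤ b → ‖Gamma z‖ * (1 + ‖z‖) ^ n ≤ C := by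
  induction n generalizing b with
  | zero =>
    refine ⟨max 0 (Real.Gamma a + Real.Gamma b), le_max_left _ _, fun z h1 h2 => ?_⟩
    rw [pow_zero, mul_one]
    exact (norm_Gamma_le_add ha h1 h2).trans (le_max_right _ _)
  | succ n ih =>
    -- Γ(z + 1) = z Γ(z) buys one power of |z| at the cost of widening the strip by one to the
    -- right.
    obtain ⟨C, hC, h⟩ := ih (b := b + 1)
    refine ⟨C * (1 + 1 / a), by positivity, fun z h1 h2 => ?_⟩
    have hz : a ≤ ‖z‖ := h1.trans (re_le_norm z)
    have hz0 : z ≠ 0 := norm_pos_iff.mp (ha.trans_le hz)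
    have h3 := h (z + 1) (by simp; linarith) (by simp; linarith)
    rw [Gamma_add_one _ hz0, norm_mul] at h3
    have hn : ‖z‖ ≤ ‖z + 1‖ := by
      rw [← abs_norm z, ← abs_norm (z + 1), ← sq_le_sq, Complex.sq_norm, Complex.sq_norm]
      simp only [normSq_apply, add_re, one_re, add_im, one_im]
      nlinarith
    have h4 : 1 + ‖z‖ ≤ (1 + 1 / a) * ‖z‖ := by
      have : 1 ≤ 1 / a * ‖z‖ := by rw [one_div, ← div_eq_inv_mul, one_le_div ha]; exact hz
      linarith
    calc ‖Gamma z‖ * (1 + ‖z‖) ^ (n + 1) = ‖Gamma z‖ * (1 + ‖z‖) ^ n * (1 + ‖z‖) := by ring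
      _ ≤ ‖Gamma z‖ * (1 + ‖z + 1‖) ^ n * ((1 + 1 / a) * ‖z‖) := by gcongr
      _ = (‖z‖ * ‖Gamma z‖ * (1 + ‖z + 1‖) ^ n) * (1 + 1 / a) := by ring
      _ ≤ C * (1 + 1 / a) := by gcongr

theorem norm_betaIntegral_le {u v : ℂ} {δ : ℝ} (hδ : 0 < δ) (hu : δ ≤ u.re) (hv : δ ≤ v.re) :
    ‖betaIntegral u v‖ ≤ ∫ x : ℝ in (0:ℝ)..1, ‖(x : ℂ) ^ ((δ:ℂ) - 1) * (1 - (x : ℂ)) ^ ((δ:ℂ) - 1)‖ := by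
  rw [betaIntegral]
  refine (intervalIntegral.norm_integral_le_integral_norm zero_le_one).trans ?_
  refine intervalIntegral.integral_mono_on_of_le_Ioo zero_le_one
    (betaIntegral_convergent (hδ.trans_le hu) (hδ.trans_le hv)).norm
    (betaIntegral_convergent (u := δ) (v := δ) (by simpa) (by simpa)).norm fun x hx => ?_
  have h1 : (1 - (x : ℂ)) = ((1 - x : ℝ) : ℂ) := by push_cast; ring
  have h2 : 0 < 1 - x := by linarith [hx.2]
  rw [h1, norm_mul, norm_mul, norm_cpow_eq_rpow_re_of_pos hx.1, norm_cpow_eq_rpow_re_of_pos h2,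
    norm_cpow_eq_rpow_re_of_pos hx.1, norm_cpow_eq_rpow_re_of_pos h2]
  simp only [sub_re, one_re, ofReal_re]
  exact mul_le_mul (Real.rpow_le_rpow_of_exponent_ge hx.1 hx.2.le (by linarith))
    (Real.rpow_le_rpow_of_exponent_ge h2 (by linarith [hx.1]) (by linarith))
    (Real.rpow_nonneg h2.le _) (Real.rpow_nonneg hx.1.le _)

/-- A polynomial bound for quotients of Gamma values. -/
theorem exists_Gamma_div_le (k : ℕ) {δ : ℝ} (hδ : 0 < δ) (M : ℝ) :
    ∃ C : ℝ, 0 ≤ C ∧ ∀ X Y : ℂ, k + δ ≤ X.re → δ ≤ (Y - X).re + k → ‖Y - X‖ ≤ M →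
      ‖Gamma X / Gamma Y‖ ≤ C * (1 + ‖X‖) ^ k := by
  induction k generalizing M with
  | zero =>
    -- Base case: Γ(X)/Γ(Y) = B(X, Y − X)/Γ(Y − X). The beta integral is bounded by real parts
    -- alone, and 1/Γ is entire, so it is bounded on the ball containing Y − X.
    obtain ⟨K, hK⟩ := (isCompact_closedBall (0 : ℂ) M).exists_bound_of_continuousOn
      (differentiable_one_div_Gamma.continuous.continuousOn)
    set B := ∫ x : ℝ in (0:ℝ)..1, ‖(x : ℂ) ^ ((δ:ℂ) - 1) * (1 - (x : ℂ)) ^ ((δ:ℂ) - 1)‖ with hB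
    have hB0 : 0 ≤ B := intervalIntegral.integral_nonneg zero_le_one fun _ _ => norm_nonneg _
    refine ⟨B * |K|, by positivity, fun X Y h1 h2 h3 => ?_⟩
    simp only [Nat.cast_zero, zero_add, add_zero] at h1 h2
    have hX := hδ.trans_le h1
    have hYX := hδ.trans_le h2
    have e := betaIntegral_eq_Gamma_mul_div X (Y - X) hX hYX
    rw [add_sub_cancel] at e
    have h4 : Gamma X / Gamma Y = betaIntegral X (Y - X) * (Gamma (Y - X))⁻¹ := by
      rw [e]; field_simp [Gamma_ne_zero_of_re_pos hYX]
    rw [h4, norm_mul, pow_zero, mul_one]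
    gcongr
    · exact norm_betaIntegral_le hδ h1 h2
    · exact (hK (Y - X) (by simpa using h3)).trans (le_abs_self _)
  | succ k ih =>
    obtain ⟨C, hC, h⟩ := ih (M + 1)
    -- Replacing X by X − 1 raises Re(Y − X) by one and costs the factor X − 1. Thus k is the number
    -- of shifts needed to make Re(Y − X) positive.
    refine ⟨C * 2 ^ k, by positivity, fun X Y h1 h2 h3 => ?_⟩
    push_cast at h1 h2
    have hX0 : X - 1 ≠ 0 := by
      intro h0
      have := congrArg re h0
      simp only [sub_re, one_re, zero_re] at this
      have : (0 : ℝ) ≤ k := by positivity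
      linarith
    have h5 := h (X - 1) Y (by simp; linarith) (by simp at h2 ⊢; linarith)
      (by
        have : Y - (X - 1) = (Y - X) + 1 := by ring
        rw [this]
        exact (norm_add_le _ _).trans (by simpa using h3))
    have h6 : Gamma X = (X - 1) * Gamma (X - 1) := by
      rw [← Gamma_add_one _ hX0]; simp
    have h7 : ‖X - 1‖ ≤ 1 + ‖X‖ := by
      have := norm_sub_le X 1
      simp only [norm_one] at this; linarith
    rw [h6, mul_div_assoc, norm_mul]
    calc ‖X - 1‖ * ‖Gamma (X - 1) / Gamma Y‖ ≤ (1 + ‖X‖) * (C * (1 + ‖X - 1‖) ^ k) := by gcongr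
      _ ≤ (1 + ‖X‖) * (C * (2 * (1 + ‖X‖)) ^ k) := by gcongr; linarith [norm_nonneg X]
      _ = C * 2 ^ k * (1 + ‖X‖) ^ (k + 1) := by rw [mul_pow]; ring

/-! ### Beta integrals, contour shifts, holomorphic parameters and Mellin-Parseval -/

theorem cpow_eq_exp_log {r : ℝ} (hr : 0 < r) (a : ℂ) : (r : ℂ) ^ a = cexp ((Real.log r : ℂ) * a) := by
  rw [cpow_def_of_ne_zero (by exact_mod_cast hr.ne'), ← ofReal_log hr.le]

/-- The Mellin transform of `(1 + x)^(-p)`. -/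
theorem hasMellin_one_add_cpow {p w : ℂ} (hw : 0 < w.re) (hp : w.re < p.re) :
    HasMellin (fun x : ℝ => ((1 + x : ℝ) : ℂ) ^ (-p)) w (Gamma w * Gamma (p - w) / Gamma p) := by
  have hpw : 0 < (p - w).re := by simpa using hp
  -- The substitution x = t/(1 − t) turns the Mellin integral into Euler's beta integral on (0, 1).
  set φ : ℝ → ℝ := fun t => t / (1 - t) with hφ
  have himg : φ '' Ioo 0 1 = Ioi 0 := by
    ext x
    constructor
    · rintro ⟨t, ht, rfl⟩
      exact div_pos ht.1 (by linarith [ht.2])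
    · intro hx
      have hx : 0 < x := hx
      refine ⟨x / (1 + x), ⟨by positivity, by rw [div_lt_one (by positivity)]; linarith⟩, ?_⟩
      simp only [hφ]; field_simp; ring
  have hder : ∀ t ∈ Ioo (0:ℝ) 1, HasDerivWithinAt φ (1 / (1 - t) ^ 2) (Ioo 0 1) t := by
    intro t ht
    have h1 : 1 - t ≠ 0 := by linarith [ht.2]
    have := ((hasDerivAt_id t).div ((hasDerivAt_const t (1:ℝ)).sub (hasDerivAt_id t)) h1)
    refine (this.congr_deriv ?_).hasDerivWithinAt
    simp
  have hinj : InjOn φ (Ioo 0 1) := by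
    intro t ht t' ht' h
    have h1 : 1 - t ≠ 0 := by linarith [ht.2]
    have h2 : 1 - t' ≠ 0 := by linarith [ht'.2]
    simp only [hφ] at h
    rw [div_eq_div_iff h1 h2] at h
    linarith
  have hker : ∀ t ∈ Ioo (0:ℝ) 1,
      |1 / (1 - t) ^ 2| • ((φ t : ℂ) ^ (w - 1) • ((1 + φ t : ℝ) : ℂ) ^ (-p)) =
        (t : ℂ) ^ (w - 1) * (1 - (t : ℂ)) ^ (p - w - 1) := by
    intro t ht
    have h1 : 0 < 1 - t := by linarith [ht.2]
    have e1 : 1 + φ t = (1 - t)⁻¹ := by simp only [hφ]; field_simp; ring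
    have e2 : (1 - (t : ℂ)) = ((1 - t : ℝ) : ℂ) := by push_cast; ring
    have e3 : |1 / (1 - t) ^ 2| = Real.exp (Real.log (1 - t) * (-2)) := by
      rw [abs_of_pos (by positivity), mul_comm, ← Real.log_rpow h1, Real.exp_log (by positivity),
        Real.rpow_neg h1.le]
      simp
    rw [e1, e2, e3, cpow_eq_exp_log (inv_pos.mpr h1) (-p), cpow_eq_exp_log h1,
      cpow_eq_exp_log ht.1, show φ t = t / (1 - t) from rfl, cpow_eq_exp_log (div_pos ht.1 h1),
      Real.log_inv, Real.log_div ht.1.ne' h1.ne', real_smul, smul_eq_mul, ofReal_exp, ← Complex.exp_add,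
      ← Complex.exp_add, ← Complex.exp_add]
    congr 1
    push_cast
    ring
  have hint : IntegrableOn (fun t : ℝ => (t : ℂ) ^ (w - 1) * (1 - (t : ℂ)) ^ (p - w - 1)) (Ioo 0 1) :=
    ((intervalIntegrable_iff_integrableOn_Ioo_of_le zero_le_one).mp
      (betaIntegral_convergent hw hpw))
  refine ⟨?_, ?_⟩
  · rw [MellinConvergent, ← himg,
      integrableOn_image_iff_integrableOn_abs_deriv_smul measurableSet_Ioo hder hinj]
    exact hint.congr_fun (fun t ht => (hker t ht).symm) measurableSet_Ioo
  · rw [mellin, ← himg, integral_image_eq_integral_abs_deriv_smul measurableSet_Ioo hder hinj,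
      setIntegral_congr_fun measurableSet_Ioo hker, ← integral_Ioc_eq_integral_Ioo,
      ← intervalIntegral.integral_of_le zero_le_one]
    have := betaIntegral_eq_Gamma_mul_div w (p - w) hw hpw
    rw [add_sub_cancel] at this
    exact this

/-- Cauchy's theorem for vertical lines. -/
theorem vint_eq_of_strip {f : ℂ → ℂ} {a b C : ℝ} (hab : a ≤ b)
    (hf : DifferentiableOn ℂ f {z | a ≤ z.re ∧ z.re ≤ b})
    (hC : ∀ z : ℂ, a ≤ z.re → z.re ≤ b → ‖f z‖ ≤ C * (1 + z.im ^ 2)⁻¹) :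
    VerticalIntegrable f a ∧ VerticalIntegrable f b ∧ vint a f = vint b f := by
  have hint : ∀ c, a ≤ c → c ≤ b → VerticalIntegrable f c := by
    intro c h1 h2
    refine (integrable_inv_one_add_sq.const_mul C).mono' ?_ (Filter.Eventually.of_forall fun v => ?_)
    · refine Continuous.aestronglyMeasurable ?_
      refine hf.continuousOn.comp_continuous (by fun_prop) fun v => ?_
      simp [h1, h2]
    · simpa using hC (c + v * I) (by simpa) (by simpa)
  refine ⟨hint a le_rfl hab, hint b hab le_rfl, ?_⟩
  have hlim : ∀ c, a ≤ c → c ≤ b → Filter.Tendsto (fun T : ℝ => ∫ v in (-T)..T, f (c + v * I))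
      Filter.atTop (nhds (∫ v : ℝ, f (c + v * I))) := fun c h1 h2 =>
    intervalIntegral_tendsto_integral (hint c h1 h2) Filter.tendsto_neg_atTop_atBot Filter.tendsto_id
  have hrect : ∀ T : ℝ, I • (∫ v in (-T)..T, f (b + v * I)) - I • (∫ v in (-T)..T, f (a + v * I)) =
      (∫ x in a..b, f (x + T * I)) - ∫ x in a..b, f (x + (-T : ℝ) * I) := by
    intro T
    have := integral_boundary_rect_eq_zero_of_differentiableOn f (⟨a, -T⟩ : ℂ) ⟨b, T⟩ (hf.mono ?_)
    · simp only at this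
      rw [sub_eq_zero] at this
      rw [← sub_eq_zero, ← sub_eq_zero.mpr this]
      push_cast
      ring
    · intro z hz
      rw [mem_reProdIm, uIcc_of_le hab] at hz
      exact hz.1
  -- The horizontal sides of the rectangle at height ±T are O(1/T²).
  have hb : ∀ T : ℝ, ‖∫ x in a..b, f (x + T * I)‖ ≤ C * (1 + T ^ 2)⁻¹ * |b - a| := fun T => by
    refine intervalIntegral.norm_integral_le_of_norm_le_const fun x hx => ?_
    rw [uIoc_of_le hab] at hx
    simpa using hC (x + T * I) (by simpa using hx.1.le) (by simpa using hx.2)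
  have hzero : Filter.Tendsto (fun T : ℝ => (∫ x in a..b, f (x + T * I)) -
      ∫ x in a..b, f (x + (-T : ℝ) * I)) Filter.atTop (nhds 0) := by
    have hg : Filter.Tendsto (fun T : ℝ => C * (1 + T ^ 2)⁻¹ * |b - a| + C * (1 + T ^ 2)⁻¹ * |b - a|)
        Filter.atTop (nhds 0) := by
      have : Filter.Tendsto (fun T : ℝ => (1 + T ^ 2)⁻¹) Filter.atTop (nhds 0) :=
        tendsto_inv_atTop_zero.comp (Filter.tendsto_atTop_add_const_left _ _
          (Filter.tendsto_pow_atTop two_ne_zero))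
      have h2 := (this.const_mul C).mul_const |b - a|
      simpa using h2.add h2
    refine squeeze_zero_norm (fun T => ?_) hg
    refine (norm_sub_le _ _).trans (add_le_add (hb T) ?_)
    simpa using hb (-T)
  have hl := (((hlim b hab le_rfl).const_smul I).sub ((hlim a le_rfl hab).const_smul I))
  have h0 := tendsto_nhds_unique (hl.congr hrect) hzero
  rw [← smul_sub, smul_eq_mul, mul_eq_zero, or_iff_right I_ne_zero, sub_eq_zero] at h0
  rw [vint, vint, h0]

/-- Integrals depending holomorphically on a parameter. -/
theorem differentiableOn_integral {β : Type*} [MeasurableSpace β] {m : Measure β} {U : Set ℂ}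
    {f : ℂ → β → ℂ} (hU : IsOpen U) (hm : ∀ s ∈ U, AEStronglyMeasurable (f s) m)
    (hd : ∀ v, DifferentiableOn ℂ (fun s => f s v) U)
    (hb : ∀ s₀ ∈ U, ∃ r > 0, ∃ g : β → ℝ, Integrable g m ∧
      ∀ s ∈ Metric.ball s₀ r, ∀ v, ‖f s v‖ ≤ g v) :
    DifferentiableOn ℂ (fun s => ∫ v, f s v ∂m) U := by
  intro s₀ hs₀
  obtain ⟨r₁, hr₁, g, hg, hfg⟩ := hb s₀ hs₀
  obtain ⟨r₂, hr₂, hrU⟩ := Metric.isOpen_iff.mp hU s₀ hs₀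
  set r := min r₁ r₂ / 2 with hr
  have hr0 : 0 < r := by positivity
  have hrr : r + r ≤ r₁ ∧ r + r ≤ r₂ := ⟨by linarith [min_le_left r₁ r₂], by linarith [min_le_right r₁ r₂]⟩
  have hsub : ∀ s ∈ Metric.ball s₀ r, ∀ z ∈ Metric.closedBall s (r / 2), z ∈ Metric.ball s₀ r₁ ∧ z ∈ U := by
    intro s hs z hz
    have h1 : dist z s₀ < r + r := by
      refine (dist_triangle z s s₀).trans_lt ?_
      have := Metric.mem_closedBall.mp hz
      have := Metric.mem_ball.mp hs
      linarith
    exact ⟨h1.trans_le hrr.1, hrU (h1.trans_le hrr.2)⟩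
  have hdiff : ∀ v, ∀ s ∈ Metric.ball s₀ r, HasDerivAt (fun s => f s v) (deriv (fun s => f s v) s) s := by
    intro v s hs
    refine ((hd v).differentiableAt (hU.mem_nhds ?_)).hasDerivAt
    exact (hsub s hs s (Metric.mem_closedBall_self (by positivity))).2
  -- The derivative in s is measurable in v because it is a limit of difference quotients along
  -- steps tending to 0.
  have hmeas : AEStronglyMeasurable (fun v => deriv (fun s => f s v) s₀) m := by
    have hseq : ∀ n : ℕ, s₀ + ((r / 2 / (n + 1) : ℝ) : ℂ) ∈ U := fun n => by
      refine (hsub s₀ (Metric.mem_ball_self hr0) _ ?_).2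
      rw [Metric.mem_closedBall, dist_eq_norm, add_sub_cancel_left, norm_real, Real.norm_eq_abs,
        abs_of_pos (by positivity)]
      exact div_le_self (by positivity) (by linarith [(Nat.cast_nonneg n : (0:ℝ) ≤ n)])
    have hlim0 : Filter.Tendsto (fun n : ℕ => ((r / 2 / (n + 1) : ℝ) : ℂ)) Filter.atTop (nhdsWithin 0 {0}ᶜ) := by
      refine tendsto_nhdsWithin_iff.mpr ⟨?_, Filter.Eventually.of_forall fun n => ?_⟩
      · have := (tendsto_one_div_add_atTop_nhds_zero_nat (𝕜 := ℝ)).const_mul (r / 2)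
        rw [mul_zero] at this
        have h2 := (continuous_ofReal.tendsto 0).comp this
        simpa [Function.comp_def, div_eq_mul_inv] using h2
      · have : r / 2 / ((n : ℝ) + 1) ≠ 0 := by positivity
        exact mem_compl_singleton_iff.mpr (ofReal_ne_zero.mpr this)
    refine aestronglyMeasurable_of_tendsto_ae (u := Filter.atTop)
      (f := fun (n : ℕ) v => (((r / 2 / (n + 1) : ℝ) : ℂ))⁻¹ •
        (f (s₀ + ((r / 2 / (n + 1) : ℝ) : ℂ)) v - f s₀ v)) ?_ ?_
    · intro n
      exact ((hm _ (hseq n)).sub (hm _ hs₀)).const_smul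
        (((r / 2 / (n + 1) : ℝ) : ℂ))⁻¹
    · refine Filter.Eventually.of_forall fun v => ?_
      have h := (hasDerivAt_iff_tendsto_slope_zero.mp (hdiff v s₀ (Metric.mem_ball_self hr0)))
      exact h.comp hlim0
  have key := hasDerivAt_integral_of_dominated_loc_of_deriv_le (μ := m) (F := f)
    (F' := fun s v => deriv (fun s => f s v) s) (bound := fun v => g v / (r / 2))
    (Metric.ball_mem_nhds s₀ hr0)
    (Filter.eventually_of_mem (hU.mem_nhds hs₀) fun s hs => hm s hs)
    (hg.mono' (hm s₀ hs₀) (Filter.Eventually.of_forall fun v => hfg s₀ (Metric.mem_ball_self hr₁) v))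
    hmeas
    -- Cauchy's estimate on circles of radius r/2 converts the bound g for f into a bound for its
    -- derivative.
    (Filter.Eventually.of_forall fun v s hs => by
      refine norm_deriv_le_of_forall_mem_sphere_norm_le (by positivity) ?_ fun z hz => ?_
      · refine DifferentiableOn.diffContOnCl ((hd v).mono ?_)
        rw [closure_ball _ (by positivity)]
        exact fun z hz => (hsub s hs z hz).2
      · exact hfg z (hsub s hs z (Metric.sphere_subset_closedBall hz)).1 v)
    (hg.div_const _) (Filter.Eventually.of_forall hdiff)
  exact key.2.differentiableAt.differentiableWithinAt

/-- Mellin-Parseval by Fubini: on the line Re z = κ the factor x^(−iv) is unimodular, so F on the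
line and x^(−κ) k(x) on the half-line dominate the double integral. -/
theorem integral_mellinInv_mul {κ : ℝ} {F : ℂ → ℂ} {k : ℝ → ℂ} (hF : VerticalIntegrable F κ)
    (hk : MellinConvergent k (1 - κ)) :
    ∫ x in Ioi (0 : ℝ), mellinInv κ F x * k x = vint κ (fun z => F z * mellin k (1 - z)) := by
  have hker : ∀ x ∈ Ioi (0 : ℝ), ∀ v : ℝ, (x : ℂ) ^ (-((κ : ℂ) + v * I)) * F (κ + v * I) * k x =
      ((x : ℂ) ^ ((1 - κ : ℂ) - 1) • k x) * F (κ + v * I) * (x : ℂ) ^ (-((v : ℂ) * I)) := by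
    intro x hx v
    have hx : (x : ℂ) ≠ 0 := ofReal_ne_zero.mpr (ne_of_gt hx)
    rw [neg_add, cpow_add _ _ hx, smul_eq_mul, show (1 - κ : ℂ) - 1 = -κ by ring]
    ring
  have hint : Integrable (fun q : ℝ × ℝ => ((q.1 : ℂ) ^ ((1 - κ : ℂ) - 1) • k q.1) * F (κ + q.2 * I) *
      (q.1 : ℂ) ^ (-((q.2 : ℂ) * I))) ((volume.restrict (Ioi 0)).prod volume) := by
    have h1 := Integrable.mul_prod (L := ℂ) hk hF
    refine h1.norm.mono' (h1.aestronglyMeasurable.mul ?_) ?_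
    · exact Measurable.aestronglyMeasurable (by fun_prop)
    · have : ∀ᵐ q : ℝ × ℝ ∂((volume.restrict (Ioi 0)).prod volume), q.1 ∈ Ioi (0:ℝ) :=
        Measure.quasiMeasurePreserving_fst.ae (ae_restrict_mem measurableSet_Ioi)
      filter_upwards [this] with q hq
      rw [norm_mul _ ((q.1 : ℂ) ^ (-((q.2 : ℂ) * I))), norm_cpow_eq_rpow_re_of_pos hq]
      simp
  calc ∫ x in Ioi (0 : ℝ), mellinInv κ F x * k x
      = ∫ x in Ioi (0 : ℝ), (1 / (2 * Real.pi) : ℂ) * ∫ v : ℝ, ((x : ℂ) ^ ((1 - κ : ℂ) - 1) • k x) *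
          F (κ + v * I) * (x : ℂ) ^ (-((v : ℂ) * I)) := by
        refine setIntegral_congr_fun measurableSet_Ioi fun x hx => ?_
        simp only [mellinInv, ← hker x hx]
        rw [integral_mul_const, real_smul]
        push_cast
        simp only [smul_eq_mul]
        ring
    _ = (1 / (2 * Real.pi) : ℂ) * ∫ v : ℝ, ∫ x in Ioi (0 : ℝ), ((x : ℂ) ^ ((1 - κ : ℂ) - 1) • k x) *
          F (κ + v * I) * (x : ℂ) ^ (-((v : ℂ) * I)) := by
        rw [integral_const_mul, integral_integral_swap hint]
    _ = _ := by
        rw [vint]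
        congr 2
        funext v
        rw [mellin, ← integral_const_mul]
        refine setIntegral_congr_fun measurableSet_Ioi fun x hx => ?_
        simp only [← hker x hx]
        rw [show (1 : ℂ) - (κ + v * I) - 1 = -((κ : ℂ) + v * I) by ring, smul_eq_mul]
        ring

theorem hasMellin_cpow_mul_one_add_cpow {a p w : ℂ} (hw : 0 < (a + w).re) (hp : (a + w).re < p.re) :
    HasMellin (fun x : ℝ => (x : ℂ) ^ a • ((1 + x : ℝ) : ℂ) ^ (-p)) w
      (Gamma (a + w) * Gamma (p - a - w) / Gamma p) := by
  rw [add_comm a w] at hw hp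
  have h := hasMellin_one_add_cpow hw hp
  refine ⟨MellinConvergent.cpow_smul.mpr h.1, ?_⟩
  rw [mellin_cpow_smul, h.2, add_comm a w, sub_sub p a w, add_comm a w]

/-! ### Barnes' lemmas -/

theorem continuous_Gamma_comp {X : Type*} [TopologicalSpace X] {f : X → ℂ} (hf : Continuous f)
    (h : ∀ x, 0 < (f x).re) : Continuous fun x => Gamma (f x) := by
  refine continuous_iff_continuousAt.mpr fun x => ?_
  have : ContinuousAt Gamma (f x) := by
    refine (differentiableAt_Gamma _ fun m hm => ?_).continuousAt
    have h1 := congrArg re hm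
    have h2 := h x
    simp at h1
    have : (0 : ℝ) ≤ m := by positivity
    linarith
  exact ContinuousAt.comp (f := f) this hf.continuousAt

theorem integrable_Gamma_line {a : ℂ} (b : ℝ) (hb : b ≠ 0) (ha : 0 < a.re) :
    Integrable fun v : ℝ => Gamma (a + (b * v : ℝ) * I) := by
  obtain ⟨C, hC, h⟩ := exists_Gamma_decay 2 (b := a.re) ha
  have hb2 : 0 < |b| := abs_pos.mpr hb
  have hshift : Integrable fun v : ℝ => C * (1 + (a.im + b * v) ^ 2)⁻¹ := by
    have := ((integrable_inv_one_add_sq.comp_add_left a.im).comp_mul_left' hb).const_mul C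
    exact this
  refine hshift.mono' ?_ (Filter.Eventually.of_forall fun v => ?_)
  · exact (continuous_Gamma_comp (by fun_prop) (by simp [ha])).aestronglyMeasurable
  · have h1 := h (a + (b * v : ℝ) * I) (by simp) (by simp)
    rw [← div_eq_mul_inv, le_div_iff₀ (by positivity)]
    refine (mul_le_mul_of_nonneg_left ?_ (norm_nonneg _)).trans h1
    have h2 : |a.im + b * v| ≤ ‖a + (b * v : ℝ) * I‖ := by
      have := abs_im_le_norm (a + (b * v : ℝ) * I)
      simpa using this
    have h3 : (a.im + b * v) ^ 2 ≤ ‖a + (b * v : ℝ) * I‖ ^ 2 := sq_le_sq.mpr (by rwa [abs_norm])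
    nlinarith [norm_nonneg (a + (b * v : ℝ) * I)]

theorem norm_Gamma_line_le {a z : ℂ} (ha : 0 < a.re) (hz : z.re = 0) :
    ‖Gamma (a + z)‖ ≤ Real.Gamma a.re := by
  have := norm_Gamma_le (z := a + z) (by simp [hz, ha])
  simpa [hz] using this

theorem norm_Gamma_line_sub_le {a z : ℂ} (ha : 0 < a.re) (hz : z.re = 0) :
    ‖Gamma (a - z)‖ ≤ Real.Gamma a.re := by
  rw [sub_eq_add_neg]
  exact norm_Gamma_line_le ha (by simp [hz])

/-- Barnes' first lemma. -/
theorem barnes_first {a₁ a₂ b₁ b₂ : ℂ} (ha₁ : 0 < a₁.re) (ha₂ : 0 < a₂.re) (hb₁ : 0 < b₁.re)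
    (hb₂ : 0 < b₂.re) :
    vint 0 (fun z => Gamma (a₁ + z) * Gamma (a₂ + z) * Gamma (b₁ - z) * Gamma (b₂ - z)) =
      Gamma (a₁ + b₁) * Gamma (a₁ + b₂) * Gamma (a₂ + b₁) * Gamma (a₂ + b₂) /
        Gamma (a₁ + a₂ + b₁ + b₂) := by
  set p := a₁ + b₁ with hp
  set q := a₂ + b₂ with hq
  have hpr : 0 < p.re := by simp [hp]; linarith
  have hqr : 0 < q.re := by simp [hq]; linarith
  have hp0 := Gamma_ne_zero_of_re_pos hpr
  have hq0 := Gamma_ne_zero_of_re_pos hqr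
  -- The Mellin transform of f at z supplies the Gamma factors with a₁, b₁, and that of k at 1 − z
  -- those with a₂, b₂. Parseval then gives the left side of the lemma.
  set f : ℝ → ℂ := fun x => (x : ℂ) ^ a₁ • ((1 + x : ℝ) : ℂ) ^ (-p) with hf
  set k : ℝ → ℂ := fun x => (x : ℂ) ^ (b₂ - 1) • ((1 + x : ℝ) : ℂ) ^ (-q) with hk
  have hre : ∀ v : ℝ, (((0 : ℝ) : ℂ) + v * I).re = 0 := fun v => by simp
  have hfm : ∀ z : ℂ, z.re = 0 → HasMellin f z (Gamma (a₁ + z) * Gamma (b₁ - z) / Gamma p) := by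
    intro z hz
    have := hasMellin_cpow_mul_one_add_cpow (a := a₁) (p := p) (w := z) (by simpa [hz])
      (by simp [hz, hp]; linarith)
    rwa [hp, add_sub_cancel_left] at this
  have hkm : ∀ z : ℂ, z.re = 0 → HasMellin k (1 - z) (Gamma (a₂ + z) * Gamma (b₂ - z) / Gamma q) := by
    intro z hz
    have := hasMellin_cpow_mul_one_add_cpow (a := b₂ - 1) (p := q) (w := 1 - z) (by simpa [hz])
      (by simp [hz, hq]; linarith)
    rw [show b₂ - 1 + (1 - z) = b₂ - z by ring, show q - (b₂ - 1) - (1 - z) = a₂ + z by rw [hq]; ring,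
      mul_comm (Gamma (b₂ - z))] at this
    exact this
  have hF : VerticalIntegrable (mellin f) 0 := by
    have h1 := (integrable_Gamma_line 1 one_ne_zero ha₁).mul_bdd (c := Real.Gamma b₁.re)
      (g := fun v : ℝ => Gamma (b₁ - v * I))
      (continuous_Gamma_comp (by fun_prop) (by simp [hb₁])).aestronglyMeasurable
      (Filter.Eventually.of_forall fun v => norm_Gamma_line_sub_le hb₁ (by simp))
    refine (h1.div_const (Gamma p)).congr (Filter.Eventually.of_forall fun v => ?_)
    show _ = mellin f _
    rw [(hfm _ (hre v)).2]
    simp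
  have hpars := integral_mellinInv_mul hF (k := k) (by
    have := (hkm 0 (by simp)).1
    simpa using this)
  -- The product f·k is again a beta kernel, x^(a₁+b₂−1) (1+x)^(−(p+q)), which evaluates the other
  -- side of Parseval.
  have hL : ∫ x in Ioi (0 : ℝ), mellinInv 0 (mellin f) x * k x =
      mellin (fun x : ℝ => ((1 + x : ℝ) : ℂ) ^ (-(p + q))) (a₁ + b₂) := by
    rw [mellin]
    refine setIntegral_congr_fun measurableSet_Ioi fun x hx => ?_
    have hx : 0 < x := hx
    have hxc : (x : ℂ) ≠ 0 := ofReal_ne_zero.mpr hx.ne'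
    have hxc1 : ((1 + x : ℝ) : ℂ) ≠ 0 := ofReal_ne_zero.mpr (by positivity)
    rw [mellinInv_mellin_eq 0 f hx (by simpa using (hfm 0 (by simp)).1) hF]
    · simp only [hf, hk, smul_eq_mul]
      rw [show a₁ + b₂ - 1 = a₁ + (b₂ - 1) by ring, cpow_add _ _ hxc, neg_add (p : ℂ) q,
        cpow_add _ _ hxc1]
      exact mul_mul_mul_comm _ _ _ _
    · refine ContinuousAt.fun_smul ?_ ?_
      · exact (continuousAt_ofReal_cpow_const _ _ (Or.inr hx.ne'))
      · refine ContinuousAt.comp (f := fun x : ℝ => 1 + x)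
          (continuousAt_ofReal_cpow_const _ _ (Or.inr (by positivity))) (by fun_prop)
  rw [hL, (hasMellin_one_add_cpow (by simp; linarith) (by simp [hp, hq]; linarith)).2] at hpars
  have hR : vint 0 (fun z => mellin f z * mellin k (1 - z)) = (Gamma p * Gamma q)⁻¹ *
      vint 0 (fun z => Gamma (a₁ + z) * Gamma (a₂ + z) * Gamma (b₁ - z) * Gamma (b₂ - z)) := by
    simp only [vint]
    rw [mul_left_comm, ← integral_const_mul (Gamma p * Gamma q)⁻¹]
    congr 2
    funext v
    rw [(hfm _ (hre v)).2, (hkm _ (hre v)).2]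
    field_simp
  rw [hR] at hpars
  have e1 : p + q - (a₁ + b₂) = a₂ + b₁ := by rw [hp, hq]; ring
  have e2 : p + q = a₁ + a₂ + b₁ + b₂ := by rw [hp, hq]; ring
  rw [e1, e2, eq_comm, inv_mul_eq_iff_eq_mul₀ (mul_ne_zero hp0 hq0)] at hpars
  rw [hpars]
  ring

/-- Barnes' second lemma, for the imaginary axis. -/
theorem barnes_second_zero {a₁ a₂ a₃ b₁ b₂ : ℂ} (ha₁ : 0 < a₁.re) (ha₂ : 0 < a₂.re)
    (ha₃ : 0 < a₃.re) (hb₁ : 0 < b₁.re) (hb₂ : 0 < b₂.re) :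
    vint 0 (fun z => Gamma (a₁ + z) * Gamma (a₂ + z) * Gamma (a₃ + z) * Gamma (b₁ - z) *
        Gamma (b₂ - z) / Gamma (a₁ + a₂ + a₃ + b₁ + b₂ + z)) =
      Gamma (a₁ + b₁) * Gamma (a₁ + b₂) * Gamma (a₂ + b₁) * Gamma (a₂ + b₂) * Gamma (a₃ + b₁) *
        Gamma (a₃ + b₂) / (Gamma (a₂ + a₃ + b₁ + b₂) * Gamma (a₁ + a₃ + b₁ + b₂) *
          Gamma (a₁ + a₂ + b₁ + b₂)) := by
  -- The shift δ keeps the real part of δ + (v − w)i positive, so both integrations can run along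
  -- the imaginary axis.
  obtain ⟨δ, hδ, hδm⟩ := exists_between (lt_min ha₁ ha₂)
  have hδ₁ : δ < a₁.re := hδm.trans_le (min_le_left _ _)
  have hδ₂ : δ < a₂.re := hδm.trans_le (min_le_right _ _)
  set N := Gamma (a₂ + a₃ + b₁ + b₂) * Gamma (a₁ + a₃ + b₁ + b₂) with hN
  have hN0 : N ≠ 0 := mul_ne_zero (Gamma_ne_zero_of_re_pos (by simp; linarith))
    (Gamma_ne_zero_of_re_pos (by simp; linarith))
  set P : ℝ → ℂ := fun w => Gamma (a₁ - δ + w * I) * Gamma (a₂ - δ + w * I) *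
    Gamma (a₃ + b₁ + b₂ + δ - w * I) with hP
  set Q : ℝ → ℂ := fun v => Gamma (a₃ + v * I) * Gamma (b₁ - v * I) * Gamma (b₂ - v * I) with hQ
  set K : ℝ → ℝ → ℂ := fun v w => Gamma (δ + ((v : ℂ) - w) * I) with hK
  have hbd : ∀ a : ℂ, 0 < a.re → ∀ v : ℝ, ‖Gamma (a - v * I)‖ ≤ Real.Gamma a.re :=
    fun a ha v => norm_Gamma_line_sub_le ha (by simp)
  have hct : ∀ a : ℂ, 0 < a.re → Continuous fun v : ℝ => Gamma (a - v * I) :=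
    fun a ha => continuous_Gamma_comp (by fun_prop) (by simp [ha])
  have hPint : Integrable P := by
    have h1 := (integrable_Gamma_line (a := a₁ - δ) 1 one_ne_zero (by simpa)).mul_bdd
      (c := Real.Gamma (a₂ - δ).re) (g := fun v : ℝ => Gamma (a₂ - δ + v * I))
      (continuous_Gamma_comp (by fun_prop) (by simp [hδ₂])).aestronglyMeasurable
      (Filter.Eventually.of_forall fun v => norm_Gamma_line_le (by simpa) (by simp))
    have hre : 0 < (a₃ + b₁ + b₂ + δ).re := by simp; linarith
    have h2 := h1.mul_bdd (c := Real.Gamma (a₃ + b₁ + b₂ + δ).re) (hct _ hre).aestronglyMeasurable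
      (Filter.Eventually.of_forall fun v => hbd _ hre v)
    refine h2.congr (Filter.Eventually.of_forall fun v => ?_)
    simp [hP]
  have hQint : Integrable Q := by
    have h1 := (integrable_Gamma_line (a := a₃) 1 one_ne_zero ha₃).mul_bdd
      (hct _ hb₁).aestronglyMeasurable (Filter.Eventually.of_forall fun v => hbd _ hb₁ v)
    have h2 := h1.mul_bdd (hct _ hb₂).aestronglyMeasurable
      (Filter.Eventually.of_forall fun v => hbd _ hb₂ v)
    refine h2.congr (Filter.Eventually.of_forall fun v => ?_)
    simp [hQ]
  have hKint : Integrable (fun q : ℝ × ℝ => Q q.1 * P q.2 * K q.1 q.2) (volume.prod volume) := by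
    refine (hQint.mul_prod hPint).mul_bdd (c := Real.Gamma δ) ?_ ?_
    · exact (continuous_Gamma_comp (by fun_prop) (by simp [hδ])).aestronglyMeasurable
    · refine Filter.Eventually.of_forall fun q => ?_
      have := norm_Gamma_line_le (a := δ) (z := ((q.1 : ℂ) - q.2) * I) (by simpa) (by simp)
      simpa using this
  -- The first lemma in w reproduces Γ(a₁+z) Γ(a₂+z) over the denominator of the second lemma, up to
  -- the constant N.
  have hin : ∀ v : ℝ, (1 / (2 * Real.pi) : ℂ) * ∫ w : ℝ, P w * K v w =
      Gamma (a₁ + v * I) * Gamma (a₂ + v * I) * N / Gamma (a₁ + a₂ + a₃ + b₁ + b₂ + v * I) := by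
    intro v
    have h := barnes_first (a₁ := a₁ - δ) (a₂ := a₂ - δ) (b₁ := δ + v * I)
      (b₂ := a₃ + b₁ + b₂ + δ) (by simpa) (by simpa) (by simpa) (by simp; linarith)
    rw [vint] at h
    have e : ∀ w : ℝ, Gamma (a₁ - δ + (((0 : ℝ) : ℂ) + w * I)) * Gamma (a₂ - δ + (((0 : ℝ) : ℂ) + w * I)) *
        Gamma (δ + v * I - (((0 : ℝ) : ℂ) + w * I)) * Gamma (a₃ + b₁ + b₂ + δ - (((0 : ℝ) : ℂ) + w * I)) =
        P w * K v w := by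
      intro w
      simp only [hP, hK, ofReal_zero, zero_add]
      rw [show (δ : ℂ) + v * I - w * I = δ + ((v : ℂ) - w) * I by ring]
      ring
    simp only [e] at h
    rw [h, hN]
    ring_nf
  -- With the order reversed, the first lemma in v yields a denominator that cancels the third
  -- factor of P. A third application, `hlast`, finishes.
  have hout : ∀ w : ℝ, (1 / (2 * Real.pi) : ℂ) * ∫ v : ℝ, Q v * K v w =
      Gamma (a₃ + b₁) * Gamma (a₃ + b₂) * Gamma (b₁ + δ - w * I) * Gamma (b₂ + δ - w * I) /
        Gamma (a₃ + b₁ + b₂ + δ - w * I) := by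
    intro w
    have h := barnes_first (a₁ := a₃) (a₂ := δ - w * I) (b₁ := b₁) (b₂ := b₂) ha₃ (by simpa) hb₁ hb₂
    rw [vint] at h
    have e : ∀ v : ℝ, Gamma (a₃ + (((0 : ℝ) : ℂ) + v * I)) * Gamma (δ - w * I + (((0 : ℝ) : ℂ) + v * I)) *
        Gamma (b₁ - (((0 : ℝ) : ℂ) + v * I)) * Gamma (b₂ - (((0 : ℝ) : ℂ) + v * I)) = Q v * K v w := by
      intro v
      simp only [hQ, hK, ofReal_zero, zero_add]
      rw [show (δ : ℂ) - w * I + v * I = δ + ((v : ℂ) - w) * I by ring]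
      ring
    simp only [e] at h
    rw [h]
    ring_nf
  have hlast := barnes_first (a₁ := a₁ - δ) (a₂ := a₂ - δ) (b₁ := b₁ + δ) (b₂ := b₂ + δ)
      (by simpa) (by simpa) (by simp; linarith) (by simp; linarith)
  have hswap := integral_integral_swap (f := fun v w => Q v * P w * K v w) hKint
  have hleft : ∫ v : ℝ, ∫ w : ℝ, Q v * P w * K v w = (2 * Real.pi : ℂ) * (2 * Real.pi) * N *
      vint 0 (fun z => Gamma (a₁ + z) * Gamma (a₂ + z) * Gamma (a₃ + z) * Gamma (b₁ - z) *
        Gamma (b₂ - z) / Gamma (a₁ + a₂ + a₃ + b₁ + b₂ + z)) := by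
    have h2 : ∀ v : ℝ, ∫ w : ℝ, Q v * P w * K v w = (2 * Real.pi : ℂ) * N * (Gamma (a₁ + v * I) *
        Gamma (a₂ + v * I) * Gamma (a₃ + v * I) * Gamma (b₁ - v * I) * Gamma (b₂ - v * I) /
        Gamma (a₁ + a₂ + a₃ + b₁ + b₂ + v * I)) := by
      intro v
      simp only [mul_assoc (Q v)]
      rw [integral_const_mul]
      have := hin v
      rw [one_div, inv_mul_eq_iff_eq_mul₀ (by simp [Real.pi_ne_zero])] at this
      rw [this]
      simp only [hQ]
      ring
    have h4 : ∀ X : ℂ, (2 * Real.pi : ℂ) * N * X =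
        (2 * Real.pi : ℂ) * (2 * Real.pi) * N * (1 / (2 * Real.pi : ℂ) * X) := by
      intro X; field_simp
    simp only [h2, vint]
    rw [integral_const_mul, h4]
    simp only [ofReal_zero, zero_add]
  have hright : ∫ w : ℝ, ∫ v : ℝ, Q v * P w * K v w = (2 * Real.pi : ℂ) * (2 * Real.pi) *
      (Gamma (a₃ + b₁) * Gamma (a₃ + b₂)) * vint 0 (fun z => Gamma (a₁ - δ + z) * Gamma (a₂ - δ + z) *
        Gamma (b₁ + δ - z) * Gamma (b₂ + δ - z)) := by
    have h2 : ∀ w : ℝ, ∫ v : ℝ, Q v * P w * K v w = (2 * Real.pi : ℂ) *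
        (Gamma (a₃ + b₁) * Gamma (a₃ + b₂)) * (Gamma (a₁ - δ + w * I) * Gamma (a₂ - δ + w * I) *
        Gamma (b₁ + δ - w * I) * Gamma (b₂ + δ - w * I)) := by
      intro w
      simp only [mul_comm (Q _) (P w), mul_assoc (P w)]
      rw [integral_const_mul]
      have := hout w
      rw [one_div, inv_mul_eq_iff_eq_mul₀ (by simp [Real.pi_ne_zero])] at this
      rw [this]
      simp only [hP]
      have h0 : Gamma (a₃ + b₁ + b₂ + δ - w * I) ≠ 0 :=
        Gamma_ne_zero_of_re_pos (by simp; linarith)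
      field_simp
    have h4 : ∀ X : ℂ, (2 * Real.pi : ℂ) * (Gamma (a₃ + b₁) * Gamma (a₃ + b₂)) * X =
        (2 * Real.pi : ℂ) * (2 * Real.pi) * (Gamma (a₃ + b₁) * Gamma (a₃ + b₂)) *
          (1 / (2 * Real.pi : ℂ) * X) := by
      intro X; field_simp
    simp only [h2, vint]
    rw [integral_const_mul, h4]
    simp only [ofReal_zero, zero_add]
  rw [hleft, hright, hlast] at hswap
  have hpi : (2 * Real.pi : ℂ) ≠ 0 := by simp [Real.pi_ne_zero]
  have e1 : a₁ - δ + (b₁ + δ) = a₁ + b₁ := by ring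
  have e2 : a₁ - δ + (b₂ + δ) = a₁ + b₂ := by ring
  have e3 : a₂ - δ + (b₁ + δ) = a₂ + b₁ := by ring
  have e4 : a₂ - δ + (b₂ + δ) = a₂ + b₂ := by ring
  have e5 : a₁ - δ + (a₂ - δ) + (b₁ + δ) + (b₂ + δ) = a₁ + a₂ + b₁ + b₂ := by ring
  rw [e1, e2, e3, e4, e5, mul_assoc, mul_assoc (2 * (Real.pi : ℂ) * (2 * Real.pi))] at hswap
  have h3 := mul_left_cancel₀ (mul_ne_zero hpi hpi) hswap
  rw [mul_comm N, ← eq_div_iff hN0] at h3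
  rw [h3]
  have h6 : Gamma (a₁ + a₂ + b₁ + b₂) ≠ 0 := Gamma_ne_zero_of_re_pos (by simp; linarith)
  field_simp

/-- Barnes' second lemma. -/
theorem barnes_second {a₁ a₂ a₃ b₁ b₂ : ℂ} {c : ℝ} (ha₁ : 0 < a₁.re + c) (ha₂ : 0 < a₂.re + c)
    (ha₃ : 0 < a₃.re + c) (hb₁ : c < b₁.re) (hb₂ : c < b₂.re) :
    vint c (fun z => Gamma (a₁ + z) * Gamma (a₂ + z) * Gamma (a₃ + z) * Gamma (b₁ - z) *
        Gamma (b₂ - z) / Gamma (a₁ + a₂ + a₃ + b₁ + b₂ + z)) =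
      Gamma (a₁ + b₁) * Gamma (a₁ + b₂) * Gamma (a₂ + b₁) * Gamma (a₂ + b₂) * Gamma (a₃ + b₁) *
        Gamma (a₃ + b₂) / (Gamma (a₂ + a₃ + b₁ + b₂) * Gamma (a₁ + a₃ + b₁ + b₂) *
          Gamma (a₁ + a₂ + b₁ + b₂)) := by
  -- Translating the contour by c is absorbed by a ↦ a + c and b ↦ b − c; every combination in the
  -- formula is unchanged.
  have h := barnes_second_zero (a₁ := a₁ + c) (a₂ := a₂ + c) (a₃ := a₃ + c) (b₁ := b₁ - c)
    (b₂ := b₂ - c) (by simpa) (by simpa) (by simpa) (by simpa) (by simpa)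
  convert h using 1
  · simp only [vint]
    congr 2
    funext v
    simp only [ofReal_zero, zero_add]
    congr 1
    · congr 1
      · congr 1
        · ring_nf
        · ring_nf
      · ring_nf
    · ring_nf
  · ring_nf

/-! ### The Bessel function K and its Mellin transform -/

theorem norm_cosh_le (z : ℂ) : ‖Complex.cosh z‖ ≤ Real.cosh z.re := by
  rw [Complex.cosh, norm_div, Real.cosh_eq]
  simp only [Complex.norm_ofNat]
  gcongr
  refine (norm_add_le _ _).trans (le_of_eq ?_)
  simp [Complex.norm_exp]

theorem stronglyMeasurable_besselK : StronglyMeasurable fun q : ℂ × ℝ => besselK q.1 q.2 := by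
  unfold besselK
  refine StronglyMeasurable.integral_prod_right' (f := fun r : (ℂ × ℝ) × ℝ =>
    (Real.exp (-r.1.2 * Real.cosh r.2) : ℂ) * Complex.cosh (r.1.1 * (r.2 : ℂ))) ?_
  exact Continuous.stronglyMeasurable (by fun_prop)

/-- The substitution x = e^(2t), with 1 + x = 2 e^t cosh t, turns a beta integral over the half-line
into this integral over ℝ. -/
theorem exp_mul_cosh_cpow {p μ : ℂ} (hp : |μ.re| < p.re) :
    (Integrable fun t : ℝ => cexp (μ * t) * (Real.cosh t : ℂ) ^ (-p)) ∧
    ∫ t : ℝ, cexp (μ * t) * (Real.cosh t : ℂ) ^ (-p) =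
      2 ^ (p - 1) * (Gamma ((p + μ) / 2) * Gamma ((p - μ) / 2) / Gamma p) := by
  obtain ⟨h1, h2⟩ := abs_lt.mp hp
  have hB := hasMellin_one_add_cpow (p := p) (w := (p + μ) / 2) (by simp; linarith)
    (by simp; linarith)
  set φ : ℝ → ℝ := fun t => Real.exp (2 * t) with hφ
  have himg : φ '' univ = Ioi 0 := by
    rw [image_univ]
    ext x
    constructor
    · rintro ⟨t, rfl⟩
      exact Real.exp_pos _
    · intro hx
      exact ⟨Real.log x / 2, by simp only [hφ]; rw [mul_div_cancel₀ _ two_ne_zero, Real.exp_log hx]⟩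
  have hder : ∀ t ∈ (univ : Set ℝ), HasDerivWithinAt φ (2 * Real.exp (2 * t)) univ t := by
    intro t _
    have := ((hasDerivAt_id t).const_mul 2).exp
    refine (this.congr_deriv ?_).hasDerivWithinAt
    simp [mul_comm]
  have hinj : InjOn φ univ := fun t _ t' _ h => by simpa [hφ] using h
  have hker : ∀ t ∈ (univ : Set ℝ), |2 * Real.exp (2 * t)| •
      ((φ t : ℂ) ^ ((p + μ) / 2 - 1) • ((1 + φ t : ℝ) : ℂ) ^ (-p)) =
        2 ^ (1 - p) * (cexp (μ * t) * (Real.cosh t : ℂ) ^ (-p)) := by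
    intro t _
    have e1 : 1 + φ t = Real.exp t * 2 * Real.cosh t := by
      simp only [hφ]
      rw [Real.cosh_eq, two_mul, Real.exp_add]
      have : Real.exp t * Real.exp (-t) = 1 := by rw [← Real.exp_add]; simp
      linear_combination -this
    have e2 : |2 * Real.exp (2 * t)| = Real.exp (Real.log 2 + 2 * t) := by
      rw [abs_of_pos (by positivity), Real.exp_add, Real.exp_log two_pos]
    have h2c : (2 : ℂ) = ((2 : ℝ) : ℂ) := by simp
    rw [e1, e2, cpow_eq_exp_log (by positivity) (-p), cpow_eq_exp_log (Real.cosh_pos t),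
      show (φ t : ℂ) = ((Real.exp (2 * t) : ℝ) : ℂ) from rfl, cpow_eq_exp_log (Real.exp_pos _),
      Real.log_exp, Real.log_mul (by positivity) (Real.cosh_pos t).ne',
      Real.log_mul (by positivity) two_ne_zero, Real.log_exp, real_smul, smul_eq_mul, ofReal_exp,
      h2c, cpow_eq_exp_log two_pos, ← Complex.exp_add, ← Complex.exp_add, ← Complex.exp_add,
      ← Complex.exp_add]
    congr 1
    push_cast
    ring
  have h20 : (2 : ℂ) ^ (1 - p) ≠ 0 := by simp [cpow_eq_zero_iff]
  obtain ⟨hB1, hB2⟩ := hB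
  constructor
  · rw [MellinConvergent, ← himg,
      integrableOn_image_iff_integrableOn_abs_deriv_smul MeasurableSet.univ hder hinj] at hB1
    have := (hB1.congr_fun hker MeasurableSet.univ)
    rw [integrableOn_univ] at this
    have h3 := this.const_mul ((2 : ℂ) ^ (1 - p))⁻¹
    refine h3.congr (Filter.Eventually.of_forall fun t => ?_)
    simp only []
    rw [inv_mul_cancel_left₀ h20]
  · rw [mellin, ← himg, integral_image_eq_integral_abs_deriv_smul MeasurableSet.univ hder hinj,
      setIntegral_congr_fun MeasurableSet.univ hker, setIntegral_univ, integral_const_mul,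
      show p - (p + μ) / 2 = (p - μ) / 2 by ring] at hB2
    rw [← hB2, ← mul_assoc, ← cpow_add _ _ two_ne_zero]
    simp

theorem integrable_cosh_mul_cosh_rpow {ρ p : ℝ} (hp : |ρ| < p) :
    Integrable fun t : ℝ => Real.cosh (ρ * t) * Real.cosh t ^ (-p) := by
  have h1 := (exp_mul_cosh_cpow (p := p) (μ := ρ) (by simpa)).1.norm
  have h2 := (exp_mul_cosh_cpow (p := p) (μ := (-ρ : ℝ)) (by simpa)).1.norm
  refine ((h1.add h2).div_const 2).congr (Filter.Eventually.of_forall fun t => ?_)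
  simp only [Pi.add_apply, norm_mul, norm_cpow_eq_rpow_re_of_pos (Real.cosh_pos t), Complex.norm_exp]
  rw [Real.cosh_eq (ρ * t)]
  simp
  ring

/-- Any power (x cosh t)^n is at most n! exp(x cosh t), so taking n > |ρ| beats cosh(ρt). -/
theorem integrable_besselK_kernel {x : ℝ} (hx : 0 < x) (ρ : ℝ) :
    Integrable fun t : ℝ => Real.exp (-x * Real.cosh t) * Real.cosh (ρ * t) := by
  obtain ⟨n, hn⟩ := exists_nat_gt |ρ|
  refine ((integrable_cosh_mul_cosh_rpow hn).const_mul (n.factorial / x ^ n)).mono'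
    (Continuous.aestronglyMeasurable (by fun_prop)) (Filter.Eventually.of_forall fun t => ?_)
  have hc := Real.cosh_pos t
  rw [Real.norm_of_nonneg (by positivity)]
  have h := Real.pow_div_factorial_le_exp (x * Real.cosh t) (by positivity) n
  rw [neg_mul, Real.exp_neg, Real.rpow_neg hc.le, Real.rpow_natCast]
  have h3 : (Real.exp (x * Real.cosh t))⁻¹ ≤ n.factorial / x ^ n * (Real.cosh t ^ n)⁻¹ := by
    refine (inv_anti₀ (by positivity) h).trans (le_of_eq ?_)
    rw [mul_pow]
    field_simp
  calc _ ≤ n.factorial / x ^ n * (Real.cosh t ^ n)⁻¹ * Real.cosh (ρ * t) := by gcongr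
    _ = _ := by ring

theorem norm_besselK_kernel_le (μ : ℂ) (x t : ℝ) :
    ‖(Real.exp (-x * Real.cosh t) : ℂ) * Complex.cosh (μ * (t : ℂ))‖ ≤
      Real.exp (-x * Real.cosh t) * Real.cosh (μ.re * t) := by
  rw [norm_mul, norm_real, Real.norm_of_nonneg (Real.exp_pos _).le]
  gcongr
  simpa using norm_cosh_le (μ * t)

theorem continuousAt_besselK (μ : ℂ) {x : ℝ} (hx : 0 < x) : ContinuousAt (besselK μ) x := by
  unfold besselK
  refine continuousAt_of_dominated (bound := fun t =>
    Real.exp (-(x / 2) * Real.cosh t) * Real.cosh (μ.re * t)) ?_ ?_ ?_ ?_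
  · exact Filter.Eventually.of_forall fun y => Continuous.aestronglyMeasurable (by fun_prop)
  · filter_upwards [lt_mem_nhds (half_lt_self hx)] with y hy
    refine Filter.Eventually.of_forall fun t => (norm_besselK_kernel_le μ y t).trans ?_
    have := Real.cosh_pos t
    gcongr
  · exact (integrable_besselK_kernel (half_pos hx) _).integrableOn
  · exact Filter.Eventually.of_forall fun t => by fun_prop

/-- The Mellin transform of the Bessel function `K_μ`. -/
theorem hasMellin_besselK {p μ : ℂ} (hp : |μ.re| < p.re) :
    HasMellin (besselK μ) p (2 ^ (p - 2) * (Gamma ((p + μ) / 2) * Gamma ((p - μ) / 2))) := by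
  have hp0 : 0 < p.re := (abs_nonneg _).trans_lt hp
  set m := volume.restrict (Ioi (0 : ℝ)) with hm
  set f : ℝ → ℝ → ℂ := fun x t => (x : ℂ) ^ (p - 1) *
    ((Real.exp (-x * Real.cosh t) : ℂ) * Complex.cosh (μ * (t : ℂ))) with hf
  have hmeas : AEStronglyMeasurable (Function.uncurry f) (m.prod m) := by
    refine Measurable.aestronglyMeasurable ?_
    simp only [hf, Function.uncurry_def]
    refine Measurable.mul (by fun_prop) (Continuous.measurable (by fun_prop))
  have hx : ∀ t : ℝ, IntegrableOn (fun x : ℝ => (x : ℂ) ^ (p - 1) * (Real.exp (-x * Real.cosh t) : ℂ)) (Ioi 0) := by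
    intro t
    have h := integrableOn_rpow_mul_exp_neg_mul_rpow (p := 1) (s := p.re - 1) (b := Real.cosh t)
      (by linarith) one_pos (Real.cosh_pos t)
    refine h.mono' (Measurable.aestronglyMeasurable (Measurable.mul (by fun_prop)
      (Continuous.measurable (by fun_prop)))) ?_
    refine (ae_restrict_iff' measurableSet_Ioi).mpr (Filter.Eventually.of_forall fun x hx => ?_)
    rw [norm_mul, norm_cpow_eq_rpow_re_of_pos hx, norm_real, Real.norm_of_nonneg (Real.exp_pos _).le]
    simp [mul_comm]
  have hint : Integrable (Function.uncurry f) (m.prod m) := by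
    rw [integrable_prod_iff' hmeas]
    constructor
    · refine Filter.Eventually.of_forall fun t => ?_
      refine ((hx t).mul_const (Complex.cosh (μ * t))).congr (Filter.Eventually.of_forall fun x => ?_)
      simp only [hf, Function.uncurry_apply_pair]
      ring
    · refine (((integrable_cosh_mul_cosh_rpow hp).const_mul (Real.Gamma p.re)).integrableOn
        (s := Ioi 0)).mono' hmeas.norm.prod_swap.integral_prod_right' ?_
      refine Filter.Eventually.of_forall fun t => ?_
      have e : ∫ x in Ioi (0 : ℝ), ‖f x t‖ = ‖Complex.cosh (μ * t)‖ *
          ((1 / Real.cosh t) ^ p.re * Real.Gamma p.re) := by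
        rw [← Real.integral_rpow_mul_exp_neg_mul_Ioi hp0 (Real.cosh_pos t), ← integral_const_mul]
        refine setIntegral_congr_fun measurableSet_Ioi fun x hx => ?_
        simp only [hf]
        rw [norm_mul, norm_mul, norm_cpow_eq_rpow_re_of_pos hx, norm_real,
          Real.norm_of_nonneg (Real.exp_pos _).le]
        simp only [sub_re, one_re]
        ring_nf
      simp only [Function.uncurry_apply_pair]
      rw [e, Real.norm_of_nonneg (by have := Real.cosh_pos t; have := Real.Gamma_pos_of_pos hp0; positivity),
        Real.rpow_neg (Real.cosh_pos t).le, one_div, Real.inv_rpow (Real.cosh_pos t).le]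
      have h1 := norm_cosh_le (μ * t)
      simp only [mul_re, ofReal_re, ofReal_im, mul_zero, sub_zero] at h1
      have h2 := Real.cosh_pos t
      have h3 := Real.Gamma_pos_of_pos hp0
      calc _ ≤ Real.cosh (μ.re * t) * ((Real.cosh t ^ p.re)⁻¹ * Real.Gamma p.re) := by gcongr
        _ = _ := by ring
  have hfx : ∀ x : ℝ, (x : ℂ) ^ (p - 1) • besselK μ x = ∫ t, f x t ∂m := by
    intro x
    simp only [hf, smul_eq_mul, besselK]
    rw [integral_const_mul]
  constructor
  · rw [MellinConvergent]
    simp only [hfx]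
    exact hint.integral_prod_left
  · rw [mellin]
    simp only [hfx]
    rw [integral_integral_swap hint]
    set E : ℂ → ℝ → ℂ := fun μ t => cexp (μ * t) * (Real.cosh t : ℂ) ^ (-p) with hE
    obtain ⟨hE1, hE2⟩ := exp_mul_cosh_cpow hp
    obtain ⟨hE3, -⟩ := exp_mul_cosh_cpow (p := p) (μ := -μ) (by simpa)
    -- The x-integral is a Gamma integral equal to Γ(p) cosh(t)^(−p). Splitting cosh(μt) into two
    -- exponentials then unfolds the half-line to ℝ.
    have h1 : ∀ t : ℝ, ∫ x in Ioi (0 : ℝ), f x t = Gamma p / 2 * (E μ t + E (-μ) t) := by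
      intro t
      have h := integral_cpow_mul_exp_neg_mul_Ioi (a := p) (r := Real.cosh t) hp0
        (by simpa using Real.cosh_pos t)
      have h2 : ∫ x in Ioi (0 : ℝ), f x t = Complex.cosh (μ * t) * ∫ x in Ioi (0 : ℝ),
          (x : ℂ) ^ (p - 1) * cexp (-(Real.cosh t : ℂ) * x) := by
        rw [← integral_const_mul]
        refine integral_congr_ae (Filter.Eventually.of_forall fun x => ?_)
        simp only [hf]
        push_cast
        ring_nf
      have h4 : (1 / (Real.cosh t : ℂ)) ^ p = (Real.cosh t : ℂ) ^ (-p) := by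
        rw [one_div, inv_cpow_eq_ite, if_neg, cpow_neg]
        rw [arg_ofReal_of_nonneg (Real.cosh_pos t).le]
        exact Real.pi_ne_zero.symm
      rw [h2]
      simp only [neg_mul] at h ⊢
      rw [h, h4]
      simp only [hE, Complex.cosh]
      ring_nf
    simp only [hm]
    rw [integral_congr_ae (Filter.Eventually.of_forall h1), integral_const_mul,
      integral_add hE1.integrableOn hE3.integrableOn]
    have h2 : ∫ t in Ioi (0 : ℝ), E (-μ) t = ∫ t in Iic (0 : ℝ), E μ t := by
      have h := integral_comp_neg_Ioi (0 : ℝ) (E μ)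
      rw [neg_zero] at h
      rw [← h]
      refine setIntegral_congr_fun measurableSet_Ioi fun t _ => ?_
      simp [hE]
    have h3 : ∫ t : ℝ, E μ t = (∫ t in Iic (0 : ℝ), E μ t) + ∫ t in Ioi (0 : ℝ), E μ t := by
      rw [← compl_Iic, integral_add_compl measurableSet_Iic hE1]
    rw [h2, add_comm, ← h3, hE2, show p - 1 = (p - 2) + 1 by ring, cpow_add _ _ two_ne_zero, cpow_one]
    have := Gamma_ne_zero_of_re_pos hp0
    field_simp

theorem norm_besselK_le {μ : ℂ} (hμ : μ.re = 0) {x : ℝ} (hx : 0 < x) :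
    ‖besselK μ x‖ ≤ ‖besselK 0 x‖ := by
  have h0 : besselK 0 x = ((∫ t in Ioi (0 : ℝ), Real.exp (-x * Real.cosh t) : ℝ) : ℂ) := by
    rw [besselK, ← integral_complex_ofReal]
    simp
  have hk := integrable_besselK_kernel hx 0
  simp only [zero_mul, Real.cosh_zero, mul_one] at hk
  rw [h0, norm_real, Real.norm_of_nonneg (integral_nonneg fun t => (Real.exp_pos _).le), besselK]
  refine norm_integral_le_of_norm_le hk.integrableOn (Filter.Eventually.of_forall fun t => ?_)
  simpa [hμ] using norm_besselK_kernel_le μ x t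

theorem verticalIntegrable_mellin_besselK {μ : ℂ} {κ : ℝ} (hκ : |μ.re| < κ) :
    VerticalIntegrable (mellin (besselK μ)) κ := by
  obtain ⟨h1, h2⟩ := abs_lt.mp hκ
  have ha : 0 < ((κ + μ) / 2).re := by simp; linarith
  have hb : 0 < ((κ - μ) / 2).re := by simp; linarith
  have h := (integrable_Gamma_line (a := (κ + μ) / 2) (1 / 2) (by norm_num) ha).mul_bdd
    (c := Real.Gamma ((κ - μ) / 2).re) (g := fun v : ℝ => 2 ^ ((v : ℂ) * I) * Gamma ((κ - μ) / 2 + (v / 2 : ℝ) * I))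
    (Continuous.aestronglyMeasurable (Continuous.mul
      (Continuous.const_cpow (by fun_prop) (Or.inl two_ne_zero))
      (continuous_Gamma_comp (by fun_prop) fun v => by
        rw [add_re, re_ofReal_mul, I_re, mul_zero, add_zero]; exact hb)))
    (Filter.Eventually.of_forall fun v => by
      rw [norm_mul, norm_cpow_of_ne_zero two_ne_zero]
      have h := norm_Gamma_line_le (z := (v / 2 : ℝ) * I) hb (by simp)
      have h2 : (arg 2 : ℝ) = 0 := arg_ofReal_of_nonneg (x := 2) (by norm_num)
      simpa [h2] using h)
  refine (h.const_mul (2 ^ ((κ : ℂ) - 2))).congr (Filter.Eventually.of_forall fun v => ?_)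
  show _ = mellin (besselK μ) (κ + v * I)
  rw [(hasMellin_besselK (by simpa using hκ)).2, show (κ : ℂ) + v * I - 2 = (κ - 2) + v * I by ring,
    cpow_add _ _ two_ne_zero]
  push_cast
  ring_nf

theorem mellinInv_mellin_besselK {μ : ℂ} {κ x : ℝ} (hκ : |μ.re| < κ) (hx : 0 < x) :
    mellinInv κ (mellin (besselK μ)) x = besselK μ x :=
  mellinInv_mellin_eq κ _ hx (hasMellin_besselK (by simpa using hκ)).1
    (verticalIntegrable_mellin_besselK hκ) (continuousAt_besselK μ hx)

/-- Mellin inversion on Re z = κ converges absolutely, which bounds K_μ(x) by a multiple of x^(−κ).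
Since κ may be arbitrarily large, this supplies all the decay needed at infinity. -/
theorem exists_norm_besselK_le {μ : ℂ} {κ : ℝ} (hκ : |μ.re| < κ) :
    ∃ C : ℝ, 0 ≤ C ∧ ∀ x : ℝ, 0 < x → ‖besselK μ x‖ ≤ C * x ^ (-κ) := by
  refine ⟨‖(1 / (2 * Real.pi) : ℝ)‖ * ∫ v : ℝ, ‖mellin (besselK μ) (κ + v * I)‖,
    mul_nonneg (norm_nonneg _) (integral_nonneg fun _ => norm_nonneg _), fun x hx => ?_⟩
  rw [← mellinInv_mellin_besselK hκ hx, mellinInv, norm_smul, mul_assoc]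
  gcongr
  refine (norm_integral_le_integral_norm _).trans (le_of_eq ?_)
  rw [← integral_mul_const]
  congr 1
  funext v
  rw [norm_smul, norm_cpow_eq_rpow_re_of_pos hx, mul_comm]
  simp

/-! ### The spectral weight and the vanishing moments of its Fourier transform -/

/-- The function `-H(μ) μ sin(πμ) / π`, which agrees with `H(μ) / |Γ(μ)|²` on the imaginary axis. -/
noncomputable def spectral (H : ℂ → ℂ) (μ : ℂ) : ℂ := H μ * (-μ * Complex.sin (Real.pi * μ) / Real.pi)

/-- For imaginary μ the conjugate is −μ, so |Γ(μ)|² = Γ(μ) Γ(−μ), and the reflection formula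
applies. At μ = 0 both sides are 0, by the conventions Γ(0) = 0 and 0⁻¹ = 0. -/
theorem inv_norm_Gamma_sq {μ : ℂ} (hμ : μ.re = 0) :
    (((‖Gamma μ‖ ^ 2 : ℝ) : ℂ))⁻¹ = -μ * Complex.sin (Real.pi * μ) / Real.pi := by
  rcases eq_or_ne μ 0 with rfl | h0
  · simp
  have hconj : (starRingEnd ℂ) μ = -μ := by
    apply Complex.ext <;> simp [hμ]
  have hne : ∀ z : ℂ, z.re = 0 → z ≠ 0 → Gamma z ≠ 0 := by
    intro z hz hz0
    refine Gamma_ne_zero fun m hm => hz0 ?_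
    have := congrArg re hm
    rw [hz] at this
    simp at this
    rw [hm, this]; simp
  have h1 : ((‖Gamma μ‖ ^ 2 : ℝ) : ℂ) = Gamma μ * Gamma (-μ) := by
    rw [← hconj, Gamma_conj, mul_conj, Complex.normSq_eq_norm_sq]
  have h2 := Gamma_mul_Gamma_one_sub μ
  rw [show 1 - μ = -μ + 1 by ring, Gamma_add_one _ (neg_ne_zero.mpr h0)] at h2
  have ha : Gamma μ * Gamma (-μ) ≠ 0 := mul_ne_zero (hne _ hμ h0) (hne _ (by simp [hμ]) (by simpa))
  have hs : Complex.sin (Real.pi * μ) ≠ 0 := by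
    intro h
    rw [h, div_zero] at h2
    exact mul_ne_zero ha (neg_ne_zero.mpr h0) (by rw [← h2]; ring)
  rw [h1]
  refine inv_eq_of_mul_eq_one_right ?_
  have hpi : (Real.pi : ℂ) ≠ 0 := by simp [Real.pi_ne_zero]
  rw [eq_div_iff hs] at h2
  rw [← mul_div_assoc, div_eq_one_iff_eq hpi]
  linear_combination h2

theorem div_norm_Gamma_sq {μ : ℂ} (hμ : μ.re = 0) (H : ℂ → ℂ) :
    H μ / ((‖Gamma μ‖ ^ 2 : ℝ) : ℂ) = spectral H μ := by
  rw [div_eq_mul_inv, inv_norm_Gamma_sq hμ, spectral]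

theorem norm_sin_le_exp (z : ℂ) : ‖Complex.sin z‖ ≤ Real.exp ‖z‖ := by
  rw [Complex.sin, norm_div, norm_mul, norm_I, mul_one]
  simp only [Complex.norm_ofNat]
  have h1 : ‖cexp (-z * I)‖ ≤ Real.exp ‖z‖ := by
    refine (norm_exp_le_exp_norm _).trans ?_
    simp
  have h2 : ‖cexp (z * I)‖ ≤ Real.exp ‖z‖ := by
    refine (norm_exp_le_exp_norm _).trans ?_
    simp
  linarith [norm_sub_le (cexp (-z * I)) (cexp (z * I))]

section

variable {η : ℝ} {H : ℂ → ℂ}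

theorem TestClass.differentiableOn_spectral (hH : TestClass η H) :
    DifferentiableOn ℂ (spectral H) {μ : ℂ | |μ.re| < 2 * η} := by
  refine hH.holo.mul (Differentiable.differentiableOn ?_)
  fun_prop

theorem TestClass.spectral_neg (hH : TestClass η H) {μ : ℂ} (hμ : |μ.re| < 2 * η) :
    spectral H (-μ) = spectral H μ := by
  simp [spectral, hH.even μ hμ]

/-- These zeros of the sine are the source of the high-order vanishing of H^♭ at the origin. -/
theorem spectral_int (H : ℂ → ℂ) (n : ℤ) : spectral H n = 0 := by
  have : Complex.sin (Real.pi * n) = 0 := by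
    rw [mul_comm]; exact Complex.sin_int_mul_pi n
  simp [spectral, this]

theorem TestClass.exists_norm_spectral_le (hH : TestClass η H) :
    ∃ C : ℝ, 0 ≤ C ∧ ∀ μ : ℂ, |μ.re| < 2 * η → ‖spectral H μ‖ ≤ C * (1 + μ.im ^ 2)⁻¹ := by
  obtain ⟨C, hC⟩ := hH.decay
  refine ⟨|C| * 7, by positivity, fun μ hμ => ?_⟩
  set r := ‖μ‖ with hr
  have hr0 : 0 ≤ r := norm_nonneg _
  have h1 := hC μ hμ
  have h2 : ‖Complex.sin (Real.pi * μ)‖ ≤ Real.exp (Real.pi * r) := by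
    refine (norm_sin_le_exp _).trans (le_of_eq ?_)
    rw [norm_mul, norm_real, Real.norm_of_nonneg Real.pi_pos.le]
  have h3 : μ.im ^ 2 ≤ r ^ 2 := sq_le_sq.mpr (by rw [abs_norm]; exact abs_im_le_norm μ)
  -- The constant 7 = 1 + 6 comes from r ≤ e^r and r³/3! ≤ e^r. The exponentials balance exactly:
  -- −2π from H, π from the sine and π spent here.
  have h4 : r * (1 + r ^ 2) ≤ 7 * Real.exp (Real.pi * r) := by
    have e1 : Real.exp r ≤ Real.exp (Real.pi * r) :=
      Real.exp_le_exp.mpr (by nlinarith [Real.pi_gt_three])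
    have e2 := Real.add_one_le_exp r
    have e3 := Real.pow_div_factorial_le_exp r hr0 3
    have : ((3 : ℕ).factorial : ℝ) = 6 := by norm_num [Nat.factorial]
    rw [this] at e3
    nlinarith
  have hpi := Real.pi_gt_three
  have e0 : ‖spectral H μ‖ ≤ |C| * Real.exp (-2 * Real.pi * r) * (r * Real.exp (Real.pi * r)) := by
    rw [spectral, norm_mul, norm_div, norm_mul, norm_neg, norm_real, Real.norm_of_nonneg Real.pi_pos.le]
    have a1 : ‖H μ‖ ≤ |C| * Real.exp (-2 * Real.pi * r) :=
      h1.trans (by gcongr; exact le_abs_self C)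
    have a2 : ‖μ‖ * ‖Complex.sin (Real.pi * μ)‖ / Real.pi ≤ r * Real.exp (Real.pi * r) := by
      refine (div_le_self (by positivity) (by linarith)).trans ?_
      gcongr
    gcongr
  rw [← div_eq_mul_inv, le_div_iff₀ (by positivity)]
  calc ‖spectral H μ‖ * (1 + μ.im ^ 2)
      ≤ |C| * Real.exp (-2 * Real.pi * r) * (r * Real.exp (Real.pi * r)) * (1 + r ^ 2) := by gcongr
    _ = |C| * Real.exp (-2 * Real.pi * r) * Real.exp (Real.pi * r) * (r * (1 + r ^ 2)) := by ring
    _ ≤ |C| * Real.exp (-2 * Real.pi * r) * Real.exp (Real.pi * r) * (7 * Real.exp (Real.pi * r)) := by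
        gcongr
    _ = |C| * 7 * (Real.exp (-2 * Real.pi * r) * Real.exp (Real.pi * r) * Real.exp (Real.pi * r)) := by ring
    _ = |C| * 7 := by rw [← Real.exp_add, ← Real.exp_add]; ring_nf; simp

theorem TestClass.continuous_spectral_line (hH : TestClass η H) {c : ℝ} (hc : |c| < 2 * η) :
    Continuous fun v : ℝ => spectral H (c + v * I) :=
  hH.differentiableOn_spectral.continuousOn.comp_continuous (by fun_prop) fun v => by simpa

theorem TestClass.integrable_spectral_line (hH : TestClass η H) {c : ℝ} (hc : |c| < 2 * η) :
    VerticalIntegrable (spectral H) c := by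
  obtain ⟨C, -, h⟩ := hH.exists_norm_spectral_le
  refine (integrable_inv_one_add_sq.const_mul C).mono'
    (hH.continuous_spectral_line hc).aestronglyMeasurable (Filter.Eventually.of_forall fun v => ?_)
  simpa using h (c + v * I) (by simpa)

/-- The Fourier transform of the spectral function along the imaginary axis. -/
noncomputable def spectralFourier (H : ℂ → ℂ) (t : ℝ) : ℂ := vint 0 fun μ => spectral H μ * cexp (μ * t)

theorem TestClass.spectralFourier_neg (hH : TestClass η H) (hη : 0 < η) (t : ℝ) :
    spectralFourier H (-t) = spectralFourier H t := by
  simp only [spectralFourier, vint]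
  rw [← integral_neg_eq_self]
  congr 2
  funext v
  have := hH.spectral_neg (μ := v * I) (by simp; linarith)
  simp only [ofReal_zero, zero_add, ofReal_neg, neg_mul, this]
  ring_nf

theorem TestClass.spectralFourier_shift (hH : TestClass η H) {c : ℝ} (hc : |c| < 2 * η) (t : ℝ) :
    spectralFourier H t = vint c fun μ => spectral H μ * cexp (μ * t) := by
  obtain ⟨C, hC0, h⟩ := hH.exists_norm_spectral_le
  have key : ∀ a b : ℝ, a ≤ b → |a| < 2 * η → |b| < 2 * η →
      vint a (fun μ => spectral H μ * cexp (μ * t)) = vint b (fun μ => spectral H μ * cexp (μ * t)) := by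
    intro a b hab ha hb
    have hre : ∀ z : ℂ, a ≤ z.re → z.re ≤ b → |z.re| < 2 * η := fun z h1 h2 =>
      abs_lt.mpr ⟨(abs_lt.mp ha).1.trans_le h1, h2.trans_lt (abs_lt.mp hb).2⟩
    refine (vint_eq_of_strip (C := C * Real.exp (2 * η * |t|)) hab ?_ ?_).2.2
    · refine DifferentiableOn.mul (hH.differentiableOn_spectral.mono fun z hz => hre z hz.1 hz.2) ?_
      exact Differentiable.differentiableOn (by fun_prop)
    · intro z h1 h2
      have h3 : ‖cexp (z * t)‖ ≤ Real.exp (2 * η * |t|) := by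
        rw [Complex.norm_exp]
        refine Real.exp_le_exp.mpr ?_
        simp only [mul_re, ofReal_re, ofReal_im, mul_zero, sub_zero]
        refine (le_abs_self _).trans ?_
        rw [abs_mul]
        have := (hre z h1 h2).le
        gcongr
      rw [norm_mul]
      calc _ ≤ C * (1 + z.im ^ 2)⁻¹ * Real.exp (2 * η * |t|) := by
            gcongr
            exact h z (hre z h1 h2)
        _ = _ := by ring
  have h0 : |(0 : ℝ)| < 2 * η := by rw [abs_zero]; exact (abs_nonneg c).trans_lt hc
  rw [spectralFourier]
  rcases le_total 0 c with h | h
  · exact key 0 c h h0 hc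
  · exact (key c 0 h hc h0).symm

/-- For t ≥ 0 the contour is moved to Re μ = −c, where |e^(μt)| = e^(−ct); evenness covers t < 0. -/
theorem TestClass.exists_norm_spectralFourier_le (hH : TestClass η H) {c : ℝ} (hc0 : 0 ≤ c)
    (hc : c < 2 * η) : ∃ C : ℝ, 0 ≤ C ∧ ∀ t : ℝ, ‖spectralFourier H t‖ ≤ C * Real.exp (-c * |t|) := by
  have hη : 0 < η := by linarith
  have hc' : |(-c)| < 2 * η := by rwa [abs_neg, abs_of_nonneg hc0]
  refine ⟨‖(1 / (2 * Real.pi) : ℂ)‖ * ∫ v : ℝ, ‖spectral H ((-c : ℝ) + v * I)‖,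
    mul_nonneg (norm_nonneg _) (integral_nonneg fun _ => norm_nonneg _), ?_⟩
  have key : ∀ t : ℝ, 0 ≤ t → ‖spectralFourier H t‖ ≤ ‖(1 / (2 * Real.pi) : ℂ)‖ *
      (∫ v : ℝ, ‖spectral H ((-c : ℝ) + v * I)‖) * Real.exp (-c * t) := by
    intro t ht
    rw [hH.spectralFourier_shift hc', vint, norm_mul, mul_assoc]
    gcongr
    refine (norm_integral_le_integral_norm _).trans (le_of_eq ?_)
    rw [← integral_mul_const]
    congr 1
    funext v
    rw [norm_mul, Complex.norm_exp]
    simp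
  intro t
  rcases le_total 0 t with h | h
  · rw [abs_of_nonneg h]; exact key t h
  · rw [abs_of_nonpos h, ← hH.spectralFourier_neg hη]
    exact key (-t) (by linarith)

theorem TestClass.continuous_spectralFourier (hH : TestClass η H) (hη : 0 < η) :
    Continuous (spectralFourier H) := by
  unfold spectralFourier vint
  have hc : |(0 : ℝ)| < 2 * η := by rw [abs_zero]; linarith
  refine continuous_const.mul (continuous_of_dominated (bound := fun v : ℝ => ‖spectral H ((0:ℝ) + v * I)‖) ?_ ?_ ?_ ?_)
  · intro t
    exact ((hH.continuous_spectral_line hc).mul (by fun_prop)).aestronglyMeasurable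
  · intro t
    refine Filter.Eventually.of_forall fun v => ?_
    rw [norm_mul, Complex.norm_exp]
    simp
  · exact (hH.integrable_spectral_line hc).norm
  · exact Filter.Eventually.of_forall fun v => by fun_prop

theorem integrable_exp_neg_abs {c : ℝ} (hc : 0 < c) : Integrable fun t : ℝ => Real.exp (-c * |t|) := by
  have h : IntegrableOn (fun t : ℝ => Real.exp (-c * t)) (Ioi 0) := by
    simpa using integrableOn_exp_mul_Ioi (by linarith : -c < 0) 0
  have h' : IntegrableOn (fun t : ℝ => Real.exp (c * t)) (Iic 0) := by
    simpa using integrableOn_exp_mul_Iic hc 0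
  rw [← integrableOn_univ, ← Iic_union_Ioi (a := (0 : ℝ))]
  refine IntegrableOn.union (h'.congr_fun (fun t ht => ?_) measurableSet_Iic)
    (h.congr_fun (fun t ht => ?_) measurableSet_Ioi)
  · simp only []
    rw [abs_of_nonpos ht, neg_mul_neg]
  · simp only []
    rw [abs_of_pos ht]

theorem TestClass.integrable_mul_spectralFourier (hH : TestClass η H) {c : ℝ} (hc0 : 0 ≤ c)
    (hc : c < 2 * η) {f : ℝ → ℂ} (hf : Continuous f) {A : ℝ} (hfA : ∀ t, ‖f t‖ ≤ A * Real.exp (c * |t|)) :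
    Integrable fun t => f t * spectralFourier H t := by
  obtain ⟨d, hd1, hd2⟩ := exists_between hc
  obtain ⟨C, hC0, hC⟩ := hH.exists_norm_spectralFourier_le (hc0.trans hd1.le) hd2
  refine ((integrable_exp_neg_abs (sub_pos.mpr hd1)).const_mul (A * C)).mono'
    (hf.mul (hH.continuous_spectralFourier (by linarith))).aestronglyMeasurable
    (Filter.Eventually.of_forall fun t => ?_)
  rw [norm_mul]
  calc _ ≤ A * Real.exp (c * |t|) * (C * Real.exp (-d * |t|)) :=
        mul_le_mul (hfA t) (hC t) (norm_nonneg _) ((norm_nonneg _).trans (hfA t))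
    _ = A * C * (Real.exp (c * |t|) * Real.exp (-d * |t|)) := by ring
    _ = _ := by rw [← Real.exp_add]; ring_nf

/-- On the line Re μ = −n the factor e^(nt) cancels, so the integral is Fourier inversion at 0 of v
↦ `spectral H (-n + iv)`, whose value there is 0. -/
theorem TestClass.integral_exp_mul_spectralFourier (hH : TestClass η H) {n : ℤ}
    (hn : |(n : ℝ)| < 2 * η) :
    (Integrable fun t : ℝ => cexp (n * t) * spectralFourier H t) ∧
      ∫ t : ℝ, cexp (n * t) * spectralFourier H t = 0 := by
  have hint : Integrable fun t : ℝ => cexp (n * t) * spectralFourier H t := by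
    refine hH.integrable_mul_spectralFourier (abs_nonneg _) hn (by fun_prop) (A := 1) fun t => ?_
    rw [Complex.norm_exp, one_mul]
    refine Real.exp_le_exp.mpr ?_
    simp only [mul_re, intCast_re, ofReal_re, intCast_im, ofReal_im, mul_zero, sub_zero]
    rw [← abs_mul]
    exact le_abs_self _
  refine ⟨hint, ?_⟩
  have hn' : |((-n : ℤ) : ℝ)| < 2 * η := by push_cast; rwa [abs_neg]
  set f : ℝ → ℂ := fun v => spectral H (((-n : ℤ) : ℝ) + v * I) with hf
  have hfi : Integrable f := hH.integrable_spectral_line hn'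
  have hfc : Continuous f := hH.continuous_spectral_line hn'
  have hfour : ∀ w : ℝ, FourierTransform.fourier f w = (fun t : ℝ => (2 * Real.pi : ℂ) *
      (cexp (n * t) * spectralFourier H t)) (-(2 * Real.pi) * w) := by
    intro w
    simp only []
    rw [Real.fourier_eq', hH.spectralFourier_shift hn', vint, mul_left_comm, ← mul_assoc (2 * (Real.pi : ℂ)),
      mul_one_div_cancel (by simp [Real.pi_ne_zero]), one_mul, ← integral_const_mul]
    congr 1
    funext v
    rw [hf, smul_eq_mul, mul_left_comm, ← Complex.exp_add, mul_comm]
    congr 2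
    simp
    ring
  have hfi2 : Integrable (FourierTransform.fourier f) := by
    rw [show FourierTransform.fourier f = _ from funext hfour]
    exact (hint.const_mul (2 * Real.pi : ℂ)).comp_mul_left' (by simp [Real.pi_ne_zero])
  have hinv := hfi.fourierInv_fourier_eq hfi2 (v := 0) hfc.continuousAt
  rw [Real.fourierInv_eq'] at hinv
  simp only [hfour] at hinv
  simp only [inner_zero_right, mul_zero, ofReal_zero, zero_mul, Complex.exp_zero, one_smul] at hinv
  rw [Measure.integral_comp_mul_left (fun t : ℝ => (2 * Real.pi : ℂ) * (cexp (n * t) * spectralFourier H t)),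
    integral_const_mul] at hinv
  have h0 : f 0 = 0 := by
    simp only [hf]
    have := spectral_int H (-n)
    simpa using this
  rw [h0, smul_eq_zero, or_iff_right (by simp [Real.pi_ne_zero]), mul_eq_zero,
    or_iff_right (by simp [Real.pi_ne_zero])] at hinv
  exact hinv

/-- Each factor cosh t = (e^t + e^(−t))/2 moves n by ±1, so |n| + k < 2η keeps every exponent in the
admissible range. The extra exponential is carried only for this induction; later n = 0. -/
theorem TestClass.integral_cosh_pow_mul_spectralFourier (hH : TestClass η H) (k : ℕ) : ∀ n : ℤ,
    |(n : ℝ)| + k < 2 * η →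
    (Integrable fun t : ℝ => (Real.cosh t : ℂ) ^ k * cexp (n * t) * spectralFourier H t) ∧
      ∫ t : ℝ, (Real.cosh t : ℂ) ^ k * cexp (n * t) * spectralFourier H t = 0 := by
  induction k with
  | zero =>
    intro n hn
    simpa using hH.integral_exp_mul_spectralFourier (n := n) (by simpa using hn)
  | succ k ih =>
    intro n hn
    push_cast at hn
    have habs1 : |((n + 1 : ℤ) : ℝ)| ≤ |(n : ℝ)| + 1 := by
      push_cast; exact (abs_add_le _ _).trans (by simp)
    have habs2 : |((n - 1 : ℤ) : ℝ)| ≤ |(n : ℝ)| + 1 := by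
      push_cast; exact (abs_sub _ _).trans (by simp)
    obtain ⟨i1, e1⟩ := ih (n + 1) (by linarith)
    obtain ⟨i2, e2⟩ := ih (n - 1) (by linarith)
    have hker : ∀ t : ℝ, (Real.cosh t : ℂ) ^ (k + 1) * cexp (n * t) * spectralFourier H t =
        (1 / 2 : ℂ) * ((Real.cosh t : ℂ) ^ k * cexp ((n + 1 : ℤ) * t) * spectralFourier H t +
          (Real.cosh t : ℂ) ^ k * cexp ((n - 1 : ℤ) * t) * spectralFourier H t) := by
      intro t
      have h1 : cexp ((n + 1 : ℤ) * t) = cexp (n * t) * cexp t := by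
        rw [← Complex.exp_add]; push_cast; ring_nf
      have h2 : cexp ((n - 1 : ℤ) * t) = cexp (n * t) * cexp (-t) := by
        rw [← Complex.exp_add]; push_cast; ring_nf
      rw [h1, h2, pow_succ]
      have h3 : (Real.cosh t : ℂ) = (cexp t + cexp (-t)) / 2 := by
        rw [ofReal_cosh, Complex.cosh]
      nth_rewrite 2 [h3]
      ring
    simp only [hker]
    refine ⟨(i1.add i2).const_mul _, ?_⟩
    rw [integral_const_mul, integral_add i1 i2, e1, e2]
    simp

end

/-! ### The inverse Kontorovich-Lebedev transform at the origin and its Mellin transform -/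

section

variable {η : ℝ} {H : ℂ → ℂ}

theorem TestClass.flat_eq_vint_spectral (y : ℝ) :
    flat H y = (1 / 2 : ℂ) * vint 0 (fun μ => spectral H μ * whittaker μ y) := by
  rw [flat, vint, vint]
  congr 3
  funext v
  rw [← div_norm_Gamma_sq (by simp)]
  ring

theorem measurable_besselK_line : Measurable fun q : ℝ × ℝ => besselK (((0 : ℝ) : ℂ) + q.2 * I) q.1 :=
  stronglyMeasurable_besselK.measurable.comp
    (f := fun q : ℝ × ℝ => ((((0 : ℝ) : ℂ) + q.2 * I : ℂ), q.1)) (by fun_prop)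

/-- Inserting the cosh integral for K_μ and integrating over μ first leaves the Fourier transform of
the spectral weight, which is even. In this form a Taylor expansion in y becomes possible. -/
theorem TestClass.flat_eq_integral_exp (hH : TestClass η H) (hη : 0 < η) {y : ℝ} (hy : 0 < y) :
    flat H y = (1 / 2 : ℂ) * (Real.sqrt y : ℂ) *
      ∫ t : ℝ, (Real.exp (-(2 * Real.pi * y) * Real.cosh t) : ℂ) * spectralFourier H t := by
  set x := 2 * Real.pi * y with hx
  have hx0 : 0 < x := by positivity
  have hc : |(0 : ℝ)| < 2 * η := by rw [abs_zero]; linarith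
  set m := volume.restrict (Ioi (0 : ℝ)) with hm
  set G : ℝ → ℂ := fun v => spectral H (((0 : ℝ) : ℂ) + v * I) with hG
  set e : ℝ → ℂ := fun t => (Real.exp (-x * Real.cosh t) : ℂ) with he
  set co : ℝ → ℝ → ℂ := fun v t => Complex.cosh ((((0 : ℝ) : ℂ) + v * I) * t) with hco
  have hGi : Integrable G := hH.integrable_spectral_line hc
  have hei : Integrable e m := by
    have := (integrable_besselK_kernel hx0 0).integrableOn (s := Ioi 0)
    simp only [zero_mul, Real.cosh_zero, mul_one] at this
    exact this.ofReal
  have hint : Integrable (fun q : ℝ × ℝ => G q.1 * e q.2 * co q.1 q.2) (volume.prod m) := by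
    refine (hGi.mul_prod hei).mul_bdd (c := 1) (Continuous.aestronglyMeasurable (by fun_prop)) ?_
    refine Filter.Eventually.of_forall fun q => ?_
    simpa [hco] using norm_cosh_le ((((0 : ℝ) : ℂ) + q.1 * I) * q.2)
  have hswap := integral_integral_swap (f := fun v t => G v * e t * co v t) hint
  have hGc : ∀ t : ℝ, (1 / (2 * Real.pi) : ℂ) * ∫ v : ℝ, G v * co v t = spectralFourier H t := by
    intro t
    have i1 : ∀ t : ℝ, Integrable fun v : ℝ => G v * cexp ((((0 : ℝ) : ℂ) + v * I) * t) := by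
      intro t
      refine hGi.mul_bdd (c := 1) (Continuous.aestronglyMeasurable (by fun_prop)) ?_
      refine Filter.Eventually.of_forall fun v => ?_
      rw [Complex.norm_exp]
      simp
    have h1 : ∀ v : ℝ, G v * co v t = (1 / 2 : ℂ) * (G v * cexp ((((0 : ℝ) : ℂ) + v * I) * t) +
        G v * cexp ((((0 : ℝ) : ℂ) + v * I) * (-t : ℝ))) := by
      intro v
      simp only [hco, Complex.cosh]
      push_cast
      ring_nf
    have h2 : spectralFourier H t = (1 / 2 : ℂ) * (spectralFourier H t + spectralFourier H (-t)) := by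
      rw [hH.spectralFourier_neg hη]; ring
    rw [h2, spectralFourier, spectralFourier, vint, vint]
    simp only [h1]
    rw [integral_const_mul, integral_add (i1 t) (i1 (-t))]
    ring
  have hleft : ∀ v : ℝ, ∫ t, G v * e t * co v t ∂m = G v * besselK (((0 : ℝ) : ℂ) + v * I) x := by
    intro v
    simp only [mul_assoc (G v)]
    rw [integral_const_mul, besselK]
  have hright : ∀ t : ℝ, ∫ v : ℝ, G v * e t * co v t = e t * ∫ v : ℝ, G v * co v t := by
    intro t
    rw [← integral_const_mul]
    congr 1
    funext v
    ring
  simp only [hleft, hright] at hswap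
  have habs : ∀ t : ℝ, e t * spectralFourier H t = e |t| * spectralFourier H |t| := by
    intro t
    rcases le_total 0 t with h | h
    · rw [abs_of_nonneg h]
    · rw [abs_of_nonpos h, hH.spectralFourier_neg hη]
      simp only [he, Real.cosh_neg]
  have hei' : Integrable fun t : ℝ => e t * spectralFourier H t := by
    refine hH.integrable_mul_spectralFourier le_rfl (c := 0) (by linarith) (by fun_prop) (A := 1) fun t => ?_
    simp only [he]
    rw [norm_real, Real.norm_of_nonneg (Real.exp_pos _).le]
    simpa using by positivity
  have hhalf : ∫ t : ℝ, e t * spectralFourier H t = 2 * ∫ t, e t * spectralFourier H t ∂m := by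
    have h3 : ∫ t in Ioi (0 : ℝ), e t * spectralFourier H t = ∫ t in Iic (0 : ℝ), e t * spectralFourier H t := by
      have h := integral_comp_neg_Ioi (0 : ℝ) (fun t => e t * spectralFourier H t)
      rw [neg_zero] at h
      rw [← h]
      refine setIntegral_congr_fun measurableSet_Ioi fun t _ => ?_
      simp only [he, Real.cosh_neg, hH.spectralFourier_neg hη]
    rw [← integral_add_compl measurableSet_Iic hei', compl_Iic, ← h3, two_mul]
  rw [TestClass.flat_eq_vint_spectral, hhalf, vint]
  have h4 : ∀ v : ℝ, spectral H (((0 : ℝ) : ℂ) + v * I) * whittaker (((0 : ℝ) : ℂ) + v * I) y =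
      2 * (Real.sqrt y : ℂ) * (G v * besselK (((0 : ℝ) : ℂ) + v * I) x) := by
    intro v
    rw [whittaker]
    ring
  have h5 : (1 / (2 * Real.pi) : ℂ) * ∫ v : ℝ, G v * besselK (((0 : ℝ) : ℂ) + v * I) x =
      ∫ t, e t * spectralFourier H t ∂m := by
    rw [hswap, ← integral_const_mul]
    congr 1
    funext t
    rw [← hGc t]
    ring
  simp only [h4]
  rw [integral_const_mul, ← h5]
  ring

theorem TestClass.norm_flat_le (hH : TestClass η H) (hη : 0 < η) :
    ∃ C : ℝ, 0 ≤ C ∧ ∀ y : ℝ, 0 < y → ‖flat H y‖ ≤ C * ‖whittaker 0 y‖ := by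
  have hc : |(0 : ℝ)| < 2 * η := by rw [abs_zero]; linarith
  refine ⟨‖(1 / 2 : ℂ)‖ * (‖(1 / (2 * Real.pi) : ℂ)‖ * ∫ v : ℝ, ‖spectral H ((0 : ℝ) + v * I)‖),
    mul_nonneg (norm_nonneg _) (mul_nonneg (norm_nonneg _) (integral_nonneg fun _ => norm_nonneg _)), fun y hy => ?_⟩
  rw [TestClass.flat_eq_vint_spectral, vint, norm_mul, norm_mul, mul_assoc, mul_assoc]
  gcongr
  rw [← integral_mul_const]
  refine norm_integral_le_of_norm_le ((hH.integrable_spectral_line hc).norm.mul_const _)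
    (Filter.Eventually.of_forall fun v => ?_)
  rw [norm_mul]
  gcongr
  rw [whittaker, whittaker, norm_mul, norm_mul (2 * _) (besselK 0 _)]
  gcongr
  exact norm_besselK_le (by simp) (by positivity)

/-- The Taylor remainder is needed for all z ≥ 0, since z = 2πy cosh t is unbounded. For z ≥ 1 each
Taylor term is itself at most z^N. -/
theorem exists_exp_neg_sub_sum_le (N : ℕ) : ∃ C : ℝ, 0 ≤ C ∧ ∀ z : ℝ, 0 ≤ z →
    ‖cexp (-(z : ℂ)) - ∑ k ∈ Finset.range N, (-(z : ℂ)) ^ k / (k.factorial : ℂ)‖ ≤ C * z ^ N := by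
  refine ⟨Real.exp 1 + N + 1, by positivity, fun z hz => ?_⟩
  rcases le_total z 1 with h | h
  · refine (norm_exp_sub_sum_le_norm_mul_exp (-(z : ℂ)) N).trans ?_
    rw [norm_neg, norm_real, Real.norm_of_nonneg hz, mul_comm]
    have : Real.exp z ≤ Real.exp 1 := Real.exp_le_exp.mpr h
    have : (0 : ℝ) ≤ N := by positivity
    gcongr
    linarith
  · have h1 : ‖cexp (-(z : ℂ))‖ ≤ 1 := by
      rw [Complex.norm_exp]; simpa
    have h2 : ‖∑ k ∈ Finset.range N, (-(z : ℂ)) ^ k / (k.factorial : ℂ)‖ ≤ N * z ^ N := by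
      refine (norm_sum_le_of_le (Finset.range N) (f := fun k => (-(z : ℂ)) ^ k / (k.factorial : ℂ))
        (n := fun _ => z ^ N) fun k hk => ?_).trans (le_of_eq (by simp))
      rw [norm_div, norm_pow, norm_neg, norm_real, Real.norm_of_nonneg hz, Complex.norm_natCast]
      have : (1 : ℝ) ≤ k.factorial := by exact_mod_cast k.factorial_pos
      exact (div_le_self (by positivity) this).trans
        (pow_le_pow_right₀ h (Finset.mem_range.mp hk).le)
    have h3 : 1 ≤ z ^ N := one_le_pow₀ h
    have h4 := norm_sub_le (cexp (-(z : ℂ))) (∑ k ∈ Finset.range N, (-(z : ℂ)) ^ k / (k.factorial : ℂ))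
    have h5 := Real.exp_pos 1
    nlinarith

/-- The inverse Kontorovich-Lebedev transform vanishes to high order at the origin. -/
theorem TestClass.norm_flat_le_rpow (hH : TestClass η H) {N : ℕ} (hN : (N : ℝ) < 2 * η) :
    ∃ C : ℝ, 0 ≤ C ∧ ∀ y : ℝ, 0 < y → ‖flat H y‖ ≤ C * y ^ ((N : ℝ) + 1 / 2) := by
  have hη : 0 < η := by
    have : (0 : ℝ) ≤ N := by positivity
    linarith
  obtain ⟨A, hA0, hA⟩ := exists_exp_neg_sub_sum_le N
  have hcosh : ∀ t : ℝ, Real.cosh t ≤ Real.exp |t| := fun t => by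
    rw [← Real.cosh_abs, Real.cosh_eq]
    have : Real.exp (-|t|) ≤ Real.exp |t| := Real.exp_le_exp.mpr (by linarith [abs_nonneg t])
    linarith
  have hB : Integrable fun t : ℝ => (Real.cosh t : ℂ) ^ N * spectralFourier H t := by
    refine hH.integrable_mul_spectralFourier (c := N) (by positivity) hN (by fun_prop) (A := 1) fun t => ?_
    rw [norm_pow, norm_real, Real.norm_of_nonneg (Real.cosh_pos t).le, one_mul, Real.exp_nat_mul]
    have := Real.cosh_pos t
    gcongr
    exact hcosh t
  refine ⟨1 / 2 * (A * (2 * Real.pi) ^ N * ∫ t : ℝ, ‖(Real.cosh t : ℂ) ^ N * spectralFourier H t‖),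
    mul_nonneg (by norm_num) (mul_nonneg (by positivity) (integral_nonneg fun _ => norm_nonneg _)), fun y hy => ?_⟩
  set x := 2 * Real.pi * y with hx
  have hx0 : 0 < x := by positivity
  have hei : Integrable fun t : ℝ => (Real.exp (-x * Real.cosh t) : ℂ) * spectralFourier H t := by
    refine hH.integrable_mul_spectralFourier le_rfl (c := 0) (by linarith) (by fun_prop) (A := 1) fun t => ?_
    rw [norm_real, Real.norm_of_nonneg (Real.exp_pos _).le]
    simpa using by positivity
  have hterm : ∀ k ∈ Finset.range N,
      (Integrable fun t : ℝ => (-((x * Real.cosh t : ℝ) : ℂ)) ^ k / (k.factorial : ℂ) * spectralFourier H t) ∧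
      ∫ t : ℝ, (-((x * Real.cosh t : ℝ) : ℂ)) ^ k / (k.factorial : ℂ) * spectralFourier H t = 0 := by
    intro k hk
    have hkN : (k : ℝ) < N := by exact_mod_cast Finset.mem_range.mp hk
    obtain ⟨i, e⟩ := hH.integral_cosh_pow_mul_spectralFourier k 0 (by simp; linarith)
    simp only [Int.cast_zero, zero_mul, Complex.exp_zero, mul_one] at i e
    have h1 : ∀ t : ℝ, (-((x * Real.cosh t : ℝ) : ℂ)) ^ k / (k.factorial : ℂ) * spectralFourier H t =
        (-x : ℂ) ^ k / (k.factorial : ℂ) * ((Real.cosh t : ℂ) ^ k * spectralFourier H t) := by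
      intro t
      rw [ofReal_mul, ← neg_mul, mul_pow]
      ring
    simp only [h1]
    exact ⟨i.const_mul _, by rw [integral_const_mul, e, mul_zero]⟩
  -- Subtracting the Taylor polynomial of degree N − 1 changes nothing, by the vanishing moments.
  -- The remainder is O(y^N cosh(t)^N), and the prefactor √y contributes the extra 1/2.
  have hmain : ∫ t : ℝ, (Real.exp (-x * Real.cosh t) : ℂ) * spectralFourier H t =
      ∫ t : ℝ, (cexp (-((x * Real.cosh t : ℝ) : ℂ)) - ∑ k ∈ Finset.range N,
        (-((x * Real.cosh t : ℝ) : ℂ)) ^ k / (k.factorial : ℂ)) * spectralFourier H t := by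
    simp only [sub_mul, Finset.sum_mul]
    rw [integral_sub, integral_finsetSum _ fun k hk => (hterm k hk).1,
      Finset.sum_eq_zero fun k hk => (hterm k hk).2, sub_zero]
    · congr 1
      funext t
      rw [ofReal_exp, ← ofReal_neg, neg_mul]
    · refine hei.congr (Filter.Eventually.of_forall fun t => ?_)
      simp only []
      rw [ofReal_exp, ← ofReal_neg, neg_mul]
    · exact integrable_finsetSum _ fun k hk => (hterm k hk).1
  rw [hH.flat_eq_integral_exp hη hy, hmain, norm_mul, norm_mul, norm_real,
    Real.norm_of_nonneg (Real.sqrt_nonneg y), Real.rpow_add hy, Real.rpow_natCast, ← Real.sqrt_eq_rpow]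
  have hbound : ‖∫ t : ℝ, (cexp (-((x * Real.cosh t : ℝ) : ℂ)) - ∑ k ∈ Finset.range N,
        (-((x * Real.cosh t : ℝ) : ℂ)) ^ k / (k.factorial : ℂ)) * spectralFourier H t‖ ≤
      A * x ^ N * ∫ t : ℝ, ‖(Real.cosh t : ℂ) ^ N * spectralFourier H t‖ := by
    rw [← integral_const_mul]
    refine norm_integral_le_of_norm_le (hB.norm.const_mul _) (Filter.Eventually.of_forall fun t => ?_)
    have hc := Real.cosh_pos t
    rw [norm_mul, norm_mul, norm_pow, norm_real, Real.norm_of_nonneg hc.le]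
    calc _ ≤ A * (x * Real.cosh t) ^ N * ‖spectralFourier H t‖ := by
          gcongr
          exact hA _ (by positivity)
      _ = _ := by rw [mul_pow]; ring
  have h2 : ‖(1 / 2 : ℂ)‖ = 1 / 2 := by norm_num
  rw [h2]
  calc _ ≤ 1 / 2 * √y * (A * x ^ N * ∫ t : ℝ, ‖(Real.cosh t : ℂ) ^ N * spectralFourier H t‖) := by
        gcongr
    _ = _ := by rw [hx, mul_pow]; ring

theorem TestClass.continuousOn_flat (hH : TestClass η H) (hη : 0 < η) :
    ContinuousOn (flat H) (Ioi 0) := by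
  have hc : Continuous fun y : ℝ => (1 / 2 : ℂ) * (Real.sqrt y : ℂ) *
      ∫ t : ℝ, (Real.exp (-(2 * Real.pi * |y|) * Real.cosh t) : ℂ) * spectralFourier H t := by
    refine Continuous.mul (by fun_prop) (continuous_of_dominated
      (bound := fun t => ‖spectralFourier H t‖) ?_ ?_ ?_ ?_)
    · intro y
      have := hH.continuous_spectralFourier hη
      exact Continuous.aestronglyMeasurable (by fun_prop)
    · intro y
      refine Filter.Eventually.of_forall fun t => ?_
      rw [norm_mul, norm_real, Real.norm_of_nonneg (Real.exp_pos _).le]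
      refine mul_le_of_le_one_left (norm_nonneg _) (Real.exp_le_one_iff.mpr ?_)
      have := Real.cosh_pos t
      rw [neg_mul, Left.neg_nonpos_iff]
      positivity
    · have := hH.integrable_mul_spectralFourier le_rfl (c := 0) (f := fun _ => 1) (by linarith)
        continuous_const (A := 1) (by simp)
      simpa using this.norm
    · exact Filter.Eventually.of_forall fun t => by fun_prop
  refine hc.continuousOn.congr fun y hy => ?_
  have hy : 0 < y := hy
  simp only []
  rw [hH.flat_eq_integral_exp hη hy, abs_of_pos hy]

theorem hasMellin_whittaker {μ w : ℂ} (hw : |μ.re| < w.re + 1 / 2) :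
    HasMellin (whittaker μ) w (1 / 2 * (Real.pi : ℂ) ^ (-w - 1 / 2) *
      (Gamma ((w + 1 / 2 + μ) / 2) * Gamma ((w + 1 / 2 - μ) / 2))) := by
  have hK := hasMellin_besselK (p := w + 1 / 2) (μ := μ) (by simpa using hw)
  have h2 : (0 : ℝ) < 2 * Real.pi := by positivity
  have hW : ∀ y ∈ Ioi (0 : ℝ), whittaker μ y = (2 : ℂ) • ((y : ℂ) ^ (1 / 2 : ℂ) • besselK μ (2 * Real.pi * y)) := by
    intro y hy
    have hy : 0 < y := hy
    rw [whittaker, Real.sqrt_eq_rpow, ofReal_cpow hy.le]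
    simp only [smul_eq_mul]
    push_cast
    ring
  have hW' : ∀ y ∈ Ioi (0 : ℝ), (y : ℂ) ^ (w - 1) • whittaker μ y =
      (y : ℂ) ^ (w - 1) • ((2 : ℂ) • ((y : ℂ) ^ (1 / 2 : ℂ) • besselK μ (2 * Real.pi * y))) :=
    fun y hy => by rw [hW y hy]
  have hconv : MellinConvergent (fun y : ℝ => (2 : ℂ) • ((y : ℂ) ^ (1 / 2 : ℂ) • besselK μ (2 * Real.pi * y))) w :=
    (MellinConvergent.cpow_smul.mpr ((MellinConvergent.comp_mul_left h2).mpr hK.1)).const_smul _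
  refine ⟨IntegrableOn.congr_fun hconv (fun y hy => (hW' y hy).symm) measurableSet_Ioi, ?_⟩
  have : mellin (whittaker μ) w = mellin (fun y : ℝ => (2 : ℂ) • ((y : ℂ) ^ (1 / 2 : ℂ) • besselK μ (2 * Real.pi * y))) w :=
    setIntegral_congr_fun measurableSet_Ioi hW'
  rw [this, mellin_const_smul, mellin_cpow_smul, mellin_comp_mul_left _ _ h2, hK.2]
  have h3 : ((2 * Real.pi : ℝ) : ℂ) ^ (-(w + 1 / 2)) = 2 ^ (-(w + 1 / 2)) * (Real.pi : ℂ) ^ (-w - 1 / 2) := by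
    rw [ofReal_mul, mul_cpow_ofReal_nonneg zero_le_two Real.pi_pos.le]
    push_cast
    ring_nf
  have h4 : (2 : ℂ) ^ (-(w + 1 / 2)) * 2 ^ (w + 1 / 2 - 2) = 1 / 4 := by
    rw [← cpow_add _ _ two_ne_zero, show -(w + 1 / 2) + (w + 1 / 2 - 2) = ((-2 : ℤ) : ℂ) by push_cast; ring,
      cpow_intCast]
    norm_num
  rw [h3]
  simp only [smul_eq_mul]
  linear_combination 2 * (Real.pi : ℂ) ^ (-w - 1 / 2) * (Gamma ((w + 1 / 2 + μ) / 2) * Gamma ((w + 1 / 2 - μ) / 2)) * h4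

theorem isBigO_flat_atTop (hH : TestClass η H) (hη : 0 < η) (a : ℝ) :
    flat H =O[Filter.atTop] fun y : ℝ => y ^ (-a) := by
  obtain ⟨C, hC0, hC⟩ := hH.norm_flat_le hη
  -- The 1 added to |a| absorbs the factor √y in the Whittaker function.
  obtain ⟨K, hK0, hK⟩ := exists_norm_besselK_le (μ := 0) (κ := |a| + 1) (by simp; positivity)
  refine Asymptotics.IsBigO.of_bound (C * (2 * (K * (2 * Real.pi) ^ (-(|a| + 1))))) ?_
  filter_upwards [Filter.eventually_ge_atTop 1] with y hy
  have hy0 : 0 < y := by linarith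
  refine (hC y hy0).trans ?_
  rw [mul_assoc]
  gcongr
  rw [whittaker, norm_mul, norm_mul, norm_real, Complex.norm_ofNat, Real.norm_of_nonneg (Real.sqrt_nonneg y),
    Real.norm_of_nonneg (Real.rpow_nonneg hy0.le _)]
  have h1 := hK (2 * Real.pi * y) (by positivity)
  rw [Real.mul_rpow (by positivity) hy0.le] at h1
  have h2 : √y * y ^ (-(|a| + 1)) ≤ y ^ (-a) := by
    rw [Real.sqrt_eq_rpow, ← Real.rpow_add hy0]
    refine Real.rpow_le_rpow_of_exponent_le hy ?_
    linarith [le_abs_self a]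
  calc 2 * √y * ‖besselK 0 (2 * Real.pi * y)‖
      ≤ 2 * √y * (K * ((2 * Real.pi) ^ (-(|a| + 1)) * y ^ (-(|a| + 1)))) := by gcongr
    _ = 2 * (K * (2 * Real.pi) ^ (-(|a| + 1))) * (√y * y ^ (-(|a| + 1))) := by ring
    _ ≤ 2 * (K * (2 * Real.pi) ^ (-(|a| + 1))) * y ^ (-a) := by gcongr

theorem isBigO_flat_zero (hH : TestClass η H) {N : ℕ} (hN : (N : ℝ) < 2 * η) :
    flat H =O[nhdsWithin 0 (Ioi 0)] fun y : ℝ => y ^ (-(-((N : ℝ) + 1 / 2))) := by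
  obtain ⟨C, hC0, hC⟩ := hH.norm_flat_le_rpow hN
  refine Asymptotics.IsBigO.of_bound C ?_
  filter_upwards [self_mem_nhdsWithin] with y hy
  have hy : 0 < y := hy
  rw [neg_neg, Real.norm_of_nonneg (Real.rpow_nonneg hy.le _)]
  exact hC y hy

theorem TestClass.mellinConvergent_flat (hH : TestClass η H) {N : ℕ} (hN : (N : ℝ) < 2 * η) {w : ℂ}
    (hw : -((N : ℝ) + 1 / 2) < w.re) : MellinConvergent (flat H) w := by
  have hη : 0 < η := by
    have : (0 : ℝ) ≤ N := by positivity
    linarith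
  exact mellinConvergent_of_isBigO_rpow ((hH.continuousOn_flat hη).locallyIntegrableOn measurableSet_Ioi)
    (isBigO_flat_atTop hH hη (w.re + 1)) (by linarith) (isBigO_flat_zero hH hN) hw

theorem TestClass.differentiableAt_mellin_flat (hH : TestClass η H) {N : ℕ} (hN : (N : ℝ) < 2 * η) {w : ℂ}
    (hw : -((N : ℝ) + 1 / 2) < w.re) : DifferentiableAt ℂ (mellin (flat H)) w := by
  have hη : 0 < η := by
    have : (0 : ℝ) ≤ N := by positivity
    linarith
  exact mellin_differentiableAt_of_isBigO_rpow ((hH.continuousOn_flat hη).locallyIntegrableOn measurableSet_Ioi)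
    (isBigO_flat_atTop hH hη (w.re + 1)) (by linarith) (isBigO_flat_zero hH hN) hw

theorem TestClass.exists_norm_mellin_flat_le (hH : TestClass η H) {N : ℕ} (hN : (N : ℝ) < 2 * η) {a b : ℝ}
    (ha : -((N : ℝ) + 1 / 2) < a) (hab : a ≤ b) :
    ∃ C : ℝ, 0 ≤ C ∧ ∀ w : ℂ, a ≤ w.re → w.re ≤ b → ‖mellin (flat H) w‖ ≤ C := by
  have ia := (hH.mellinConvergent_flat hN (w := a) (by rwa [ofReal_re])).norm
  have ib := (hH.mellinConvergent_flat hN (w := b) (by simp only [ofReal_re]; linarith)).norm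
  refine ⟨(∫ y in Ioi (0 : ℝ), ‖(y : ℂ) ^ ((a : ℂ) - 1) • flat H y‖) +
    ∫ y in Ioi (0 : ℝ), ‖(y : ℂ) ^ ((b : ℂ) - 1) • flat H y‖,
    add_nonneg (integral_nonneg fun _ => norm_nonneg _) (integral_nonneg fun _ => norm_nonneg _), fun w h1 h2 => ?_⟩
  rw [mellin, ← integral_add ia ib]
  refine norm_integral_le_of_norm_le (ia.add ib) ?_
  refine (ae_restrict_iff' measurableSet_Ioi).mpr (Filter.Eventually.of_forall fun y hy => ?_)
  have hy : 0 < y := hy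
  rw [norm_smul, norm_smul, norm_smul, ← add_mul, norm_cpow_eq_rpow_re_of_pos hy,
    norm_cpow_eq_rpow_re_of_pos hy, norm_cpow_eq_rpow_re_of_pos hy]
  gcongr
  simp only [sub_re, one_re, ofReal_re]
  have := Real.rpow_nonneg hy.le (a - 1)
  have := Real.rpow_nonneg hy.le (b - 1)
  rcases le_total y 1 with h | h
  · linarith [Real.rpow_le_rpow_of_exponent_ge hy h (by linarith : a - 1 ≤ w.re - 1)]
  · linarith [Real.rpow_le_rpow_of_exponent_le h (by linarith : w.re - 1 ≤ b - 1)]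

/-- Fubini, dominating W_μ by W₀ on the imaginary axis; the integral of W₀ converges only for Re w >
−1/2. Further left h̃ is known to be holomorphic and bounded in strips, but this formula is not
available there. -/
theorem TestClass.mellin_flat (hH : TestClass η H) (hη : 0 < η) {w : ℂ} (hw : -(1 / 2) < w.re) :
    mellin (flat H) w = (1 / 4 : ℂ) * (Real.pi : ℂ) ^ (-w - 1 / 2) * vint 0 (fun μ => spectral H μ *
      (Gamma ((w + 1 / 2 + μ) / 2) * Gamma ((w + 1 / 2 - μ) / 2))) := by
  have hc : |(0 : ℝ)| < 2 * η := by rw [abs_zero]; linarith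
  set m := volume.restrict (Ioi (0 : ℝ)) with hm
  set G : ℝ → ℂ := fun v => spectral H (((0 : ℝ) : ℂ) + v * I) with hG
  have hGi : Integrable G := hH.integrable_spectral_line hc
  have hW0 := (hasMellin_whittaker (μ := 0) (w := w) (by simp; linarith)).1
  set f : ℝ → ℝ → ℂ := fun y v => (y : ℂ) ^ (w - 1) * (G v * whittaker (((0 : ℝ) : ℂ) + v * I) y) with hf
  have hae : ∀ᵐ q : ℝ × ℝ ∂(m.prod volume), q.1 ∈ Ioi (0:ℝ) :=
    Measure.quasiMeasurePreserving_fst.ae (ae_restrict_mem measurableSet_Ioi)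
  have hint : Integrable (Function.uncurry f) (m.prod volume) := by
    refine (Integrable.mul_prod (L := ℂ) hW0 hGi).norm.mono' ?_ ?_
    · refine Measurable.aestronglyMeasurable ?_
      have h1 : Measurable G := (hH.continuous_spectral_line hc).measurable
      simp only [hf, Function.uncurry_def, whittaker]
      refine Measurable.mul (by fun_prop) (Measurable.mul (h1.comp measurable_snd) (Measurable.mul ?_ ?_))
      · exact Continuous.measurable (by fun_prop)
      · exact measurable_besselK_line.comp (f := fun q : ℝ × ℝ => ((2 * Real.pi * q.1, q.2) : ℝ × ℝ)) (by fun_prop)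
    · filter_upwards [hae] with q hq
      have hq : 0 < q.1 := hq
      simp only [hf, Function.uncurry_def, smul_eq_mul, norm_mul]
      have h1 : ‖whittaker (((0 : ℝ) : ℂ) + q.2 * I) q.1‖ ≤ ‖whittaker 0 q.1‖ := by
        rw [whittaker, whittaker, norm_mul, norm_mul (2 * _) (besselK 0 _)]
        gcongr
        exact norm_besselK_le (by simp) (by positivity)
      calc _ ≤ ‖(q.1 : ℂ) ^ (w - 1)‖ * (‖G q.2‖ * ‖whittaker 0 q.1‖) := by gcongr
        _ = _ := by ring
  have h1 : ∀ y : ℝ, (y : ℂ) ^ (w - 1) • flat H y = (1 / 2 : ℂ) * (1 / (2 * Real.pi) : ℂ) * ∫ v, f y v := by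
    intro y
    simp only [hf]
    rw [integral_const_mul, TestClass.flat_eq_vint_spectral, vint, smul_eq_mul]
    ring
  have h2 : ∀ v : ℝ, ∫ y, f y v ∂m = (1 / 2 * (Real.pi : ℂ) ^ (-w - 1 / 2)) * (G v *
      (Gamma ((w + 1 / 2 + (((0 : ℝ) : ℂ) + v * I)) / 2) * Gamma ((w + 1 / 2 - (((0 : ℝ) : ℂ) + v * I)) / 2))) := by
    intro v
    have h3 := (hasMellin_whittaker (μ := ((0 : ℝ) : ℂ) + v * I) (w := w) (by simp; linarith)).2
    have h4 : ∫ y, f y v ∂m = G v * mellin (whittaker (((0 : ℝ) : ℂ) + v * I)) w := by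
      rw [mellin, ← integral_const_mul]
      congr 1
      funext y
      simp only [hf, smul_eq_mul]
      ring
    rw [h4, h3]
    ring
  rw [mellin]
  simp only [h1]
  rw [integral_const_mul, ← hm, integral_integral_swap hint]
  simp only [h2]
  rw [integral_const_mul, vint]
  ring

end

/-! ### The master Mellin-Barnes integral -/

/-- The quotient `Γ(a₁ + p/2) Γ(a₂ + p/2) Γ(a₃ + p/2) / Γ(e + p/2)`. -/
noncomputable def gammaQuot (a₁ a₂ a₃ e p : ℂ) : ℂ :=
  Gamma (a₁ + p / 2) * Gamma (a₂ + p / 2) * (Gamma (a₃ + p / 2) / Gamma (e + p / 2))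

/-- The rapid decay of the first Gamma factor pays for the degree-k growth of the quotient and
leaves 1/(1 + (Im p)²). For a₂ only the real part is constrained, so a₂ may run along a vertical
line. -/
theorem exists_norm_gammaQuot_le (k : ℕ) {δ M : ℝ} (hδ : 0 < δ) (hM : 0 ≤ M) :
    ∃ C : ℝ, 0 ≤ C ∧ ∀ a₁ a₂ a₃ e p : ℂ, ‖a₁‖ ≤ M → ‖a₃‖ ≤ M → ‖e‖ ≤ M →
      δ ≤ (a₁ + p / 2).re → (a₁ + p / 2).re ≤ M → δ ≤ (a₂ + p / 2).re → (a₂ + p / 2).re ≤ M →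
      k + δ ≤ (a₃ + p / 2).re → δ ≤ (e - a₃).re + k →
      ‖gammaQuot a₁ a₂ a₃ e p‖ ≤ C * (1 + p.im ^ 2)⁻¹ := by
  obtain ⟨C₁, hC₁, h₁⟩ := exists_Gamma_decay (k + 2) (b := M) hδ
  obtain ⟨C₂, hC₂, h₂⟩ := exists_Gamma_decay 0 (b := M) hδ
  obtain ⟨C₃, hC₃, h₃⟩ := exists_Gamma_div_le k hδ (2 * M)
  refine ⟨C₁ * C₂ * C₃ * (1 + 2 * M) ^ k * (2 * (1 + M)) ^ 2, by positivity, ?_⟩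
  intro a₁ a₂ a₃ e p n1 n3 ne r1 r1' r2 r2' r3 r4
  have b1 := h₁ (a₁ + p / 2) r1 r1'
  have b2 := h₂ (a₂ + p / 2) r2 r2'
  rw [pow_zero, mul_one] at b2
  have b3 := h₃ (a₃ + p / 2) (e + p / 2) r3 (by rwa [add_sub_add_right_eq_sub])
    (by rw [add_sub_add_right_eq_sub]; linarith [norm_sub_le e a₃])
  set X := ‖a₁ + p / 2‖ with hX
  have hX0 : 0 ≤ X := norm_nonneg _
  have e3 : 1 + ‖a₃ + p / 2‖ ≤ (1 + 2 * M) * (1 + X) := by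
    have e : a₃ + p / 2 = (a₃ - a₁) + (a₁ + p / 2) := by ring
    have := norm_add_le (a₃ - a₁) (a₁ + p / 2)
    rw [← e] at this
    have := norm_sub_le a₃ a₁
    nlinarith
  have e4 : 1 + p.im ^ 2 ≤ (2 * (1 + M)) ^ 2 * (1 + X) ^ 2 := by
    have h1 : |(a₁ + p / 2).im| ≤ X := abs_im_le_norm _
    have h2 : |a₁.im| ≤ M := (abs_im_le_norm _).trans n1
    have h3 : |p.im| ≤ 2 * X + 2 * M := by
      have : p.im = 2 * ((a₁ + p / 2).im - a₁.im) := by simp; ring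
      rw [this, abs_mul, abs_two]
      linarith [abs_sub (a₁ + p / 2).im a₁.im]
    rw [← sq_abs p.im, ← mul_pow]
    have h5 : 1 + |p.im| ≤ 2 * (1 + M) * (1 + X) := by nlinarith
    have := abs_nonneg p.im
    nlinarith [pow_le_pow_left₀ (by positivity) h5 2]
  rw [← div_eq_mul_inv, le_div_iff₀ (by positivity), gammaQuot, norm_mul, norm_mul]
  calc _ ≤ ‖Gamma (a₁ + p / 2)‖ * C₂ * (C₃ * ((1 + 2 * M) * (1 + X)) ^ k) *
        ((2 * (1 + M)) ^ 2 * (1 + X) ^ 2) := by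
        gcongr
        exact b3.trans (by gcongr)
    _ = ‖Gamma (a₁ + p / 2)‖ * (1 + X) ^ (k + 2) * C₂ * C₃ * (1 + 2 * M) ^ k * (2 * (1 + M)) ^ 2 := by
        rw [mul_pow, pow_add]; ring
    _ ≤ _ := by gcongr

theorem differentiableAt_gammaQuot {a₁ a₂ a₃ e p : ℂ} (h₁ : 0 < (a₁ + p / 2).re)
    (h₂ : 0 < (a₂ + p / 2).re) (h₃ : 0 < (a₃ + p / 2).re) :
    DifferentiableAt ℂ (gammaQuot a₁ a₂ a₃ e) p := by
  have hG : ∀ a : ℂ, 0 < (a + p / 2).re → DifferentiableAt ℂ (fun p => Gamma (a + p / 2)) p := by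
    intro a ha
    have : DifferentiableAt ℂ Gamma (a + p / 2) := by
      refine differentiableAt_Gamma _ fun m hm => ?_
      rw [hm] at ha
      simp at ha
      have : (0 : ℝ) ≤ m := by positivity
      linarith
    exact this.comp p (f := fun p => a + p / 2) (by fun_prop)
  have hI : DifferentiableAt ℂ (fun p => (Gamma (e + p / 2))⁻¹) p :=
    (differentiable_one_div_Gamma (e + p / 2)).comp p (f := fun p => e + p / 2) (by fun_prop)
  simp only [div_eq_mul_inv] at hG hI ⊢
  exact ((hG a₁ h₁).mul (hG a₂ h₂)).mul ((hG a₃ h₃).mul hI)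

section

variable {η : ℝ} {H : ℂ → ℂ}

theorem verticalIntegrable_gammaQuot {a₁ a₂ a₃ e : ℂ} {κ : ℝ} (h₁ : 0 < a₁.re + κ / 2)
    (h₂ : 0 < a₂.re + κ / 2) (h₃ : 0 < a₃.re + κ / 2) (he : 0 < (e - a₃).re) :
    VerticalIntegrable (gammaQuot a₁ a₂ a₃ e) κ := by
  obtain ⟨δ, hδ, hδm⟩ := exists_between (lt_min (lt_min h₁ h₂) (lt_min h₃ he))
  simp only [lt_min_iff] at hδm
  obtain ⟨⟨d1, d2⟩, d3, d4⟩ := hδm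
  set M := max (max (max ‖a₁‖ ‖a₃‖) ‖e‖) (max (a₁.re + κ / 2) (a₂.re + κ / 2)) with hM
  have m0 : 0 ≤ M := (norm_nonneg a₁).trans (by simp [hM])
  obtain ⟨C, hC, h⟩ := exists_norm_gammaQuot_le 0 hδ m0
  have hre : ∀ a : ℂ, ∀ v : ℝ, (a + (κ + v * I) / 2).re = a.re + κ / 2 := fun a v => by
    simp
  refine (integrable_inv_one_add_sq.const_mul C).mono' ?_ (Filter.Eventually.of_forall fun v => ?_)
  · refine Continuous.aestronglyMeasurable (continuous_iff_continuousAt.mpr fun v => ?_)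
    refine ContinuousAt.comp (f := fun v : ℝ => (κ + v * I : ℂ)) (g := gammaQuot a₁ a₂ a₃ e)
      (differentiableAt_gammaQuot ?_ ?_ ?_).continuousAt (by fun_prop)
    all_goals rw [hre]; assumption
  · have := h a₁ a₂ a₃ e (κ + v * I) (by simp [hM]) (by simp [hM]) (by simp [hM])
      (by rw [hre]; exact d1.le) (by rw [hre]; simp [hM]) (by rw [hre]; exact d2.le) (by rw [hre]; simp [hM])
      (by rw [hre]; simpa using d3.le) (by simpa using d4.le)
    simpa using this

/-- The Mellin-Barnes integral against the Mellin transform of `H^♭`. -/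
theorem TestClass.vint_mellin_flat_mul_gammaQuot (hH : TestClass η H) (hη : 0 < η) {s a₁ a₂ a₃ : ℂ}
    {κ : ℝ} (h₁ : 0 < a₁.re + κ / 2) (h₂ : 0 < a₂.re + κ / 2) (h₃ : 0 < a₃.re + κ / 2) (hκ : κ < s.re) :
    vint κ (fun p => mellin (flat H) (s - p - 1 / 2) * (Real.pi : ℂ) ^ (-p) *
        gammaQuot a₁ a₂ a₃ (s + a₁ + a₂ + a₃) p) =
      1 / 2 * (Real.pi : ℂ) ^ (-s) * (vint 0 (fun μ => spectral H μ *
        (gammaPM (2 * a₁ + s) μ * gammaPM (2 * a₂ + s) μ * gammaPM (2 * a₃ + s) μ)) /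
        (Gamma (s + a₂ + a₃) * Gamma (s + a₁ + a₃) * Gamma (s + a₁ + a₂))) := by
  have hc : |(0 : ℝ)| < 2 * η := by rw [abs_zero]; linarith
  set e := s + a₁ + a₂ + a₃ with he
  set G : ℝ → ℂ := fun v => spectral H (((0 : ℝ) : ℂ) + v * I) with hG
  set R : ℝ → ℂ := fun v => gammaQuot a₁ a₂ a₃ e (κ + v * I) with hR
  set K : ℝ → ℝ → ℂ := fun v t => Gamma ((s - (κ + v * I) + t * I) / 2) *
    Gamma ((s - (κ + v * I) - t * I) / 2) with hK
  have hGi : Integrable G := hH.integrable_spectral_line hc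
  have hRi : Integrable R := verticalIntegrable_gammaQuot h₁ h₂ h₃ (by simp [he]; linarith)
  have hσ : 0 < (s.re - κ) / 2 := by linarith
  have hint : Integrable (fun q : ℝ × ℝ => R q.1 * G q.2 * K q.1 q.2) (volume.prod volume) := by
    refine (hRi.mul_prod hGi).mul_bdd (c := Real.Gamma ((s.re - κ) / 2) * Real.Gamma ((s.re - κ) / 2)) ?_ ?_
    · refine Continuous.aestronglyMeasurable (Continuous.mul ?_ ?_)
      · exact continuous_Gamma_comp (by fun_prop) fun q => by simpa using hκ
      · exact continuous_Gamma_comp (by fun_prop) fun q => by simpa using hκ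
    · refine Filter.Eventually.of_forall fun q => ?_
      rw [norm_mul]
      have g1 := norm_Gamma_le (z := (s - (κ + q.1 * I) + q.2 * I) / 2) (by simpa using hκ)
      have g2 := norm_Gamma_le (z := (s - (κ + q.1 * I) - q.2 * I) / 2) (by simpa using hκ)
      have r1 : ((s - (κ + q.1 * I) + q.2 * I) / 2).re = (s.re - κ) / 2 := by simp
      have r2 : ((s - (κ + q.1 * I) - q.2 * I) / 2).re = (s.re - κ) / 2 := by simp
      rw [r1] at g1
      rw [r2] at g2
      have := Real.Gamma_pos_of_pos hσ
      gcongr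
  have hswap := integral_integral_swap (f := fun v t => R v * G t * K v t) hint
  have hinner : ∀ t : ℝ, ∫ v : ℝ, R v * G t * K v t = G t * (4 * Real.pi *
      (gammaPM (2 * a₁ + s) (t * I) * gammaPM (2 * a₂ + s) (t * I) * gammaPM (2 * a₃ + s) (t * I) /
        (Gamma (s + a₂ + a₃) * Gamma (s + a₁ + a₃) * Gamma (s + a₁ + a₂)))) := by
    intro t
    -- The integration variable is p/2, hence the abscissa κ/2. With b₁ + b₂ = s the required
    -- denominator is Γ(e + p/2); κ < Re s puts b₁ and b₂ to the right of the line.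
    have hB := barnes_second (a₁ := a₁) (a₂ := a₂) (a₃ := a₃) (b₁ := (s + t * I) / 2)
      (b₂ := (s - t * I) / 2) (c := κ / 2) h₁ h₂ h₃ (by simp; linarith) (by simp; linarith)
    rw [vint] at hB
    have hpi : (2 * Real.pi : ℂ) ≠ 0 := by simp [Real.pi_ne_zero]
    rw [one_div, inv_mul_eq_iff_eq_mul₀ hpi] at hB
    have hsc := Measure.integral_comp_mul_left (fun v : ℝ => Gamma (a₁ + ((κ / 2 : ℝ) + v * I)) *
      Gamma (a₂ + ((κ / 2 : ℝ) + v * I)) * Gamma (a₃ + ((κ / 2 : ℝ) + v * I)) *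
      Gamma ((s + t * I) / 2 - ((κ / 2 : ℝ) + v * I)) * Gamma ((s - t * I) / 2 - ((κ / 2 : ℝ) + v * I)) /
      Gamma (a₁ + a₂ + a₃ + (s + t * I) / 2 + (s - t * I) / 2 + ((κ / 2 : ℝ) + v * I))) (1 / 2)
    rw [hB] at hsc
    have e1 : ∀ v : ℝ, R v * G t * K v t = G t * (Gamma (a₁ + ((κ / 2 : ℝ) + (1 / 2 * v : ℝ) * I)) *
      Gamma (a₂ + ((κ / 2 : ℝ) + (1 / 2 * v : ℝ) * I)) * Gamma (a₃ + ((κ / 2 : ℝ) + (1 / 2 * v : ℝ) * I)) *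
      Gamma ((s + t * I) / 2 - ((κ / 2 : ℝ) + (1 / 2 * v : ℝ) * I)) *
      Gamma ((s - t * I) / 2 - ((κ / 2 : ℝ) + (1 / 2 * v : ℝ) * I)) /
      Gamma (a₁ + a₂ + a₃ + (s + t * I) / 2 + (s - t * I) / 2 + ((κ / 2 : ℝ) + (1 / 2 * v : ℝ) * I))) := by
      intro v
      have x1 : (((κ / 2 : ℝ) : ℂ) + (1 / 2 * v : ℝ) * I) = (κ + v * I) / 2 := by push_cast; ring
      have x2 : (s - (κ + v * I) + t * I) / 2 = (s + t * I) / 2 - (κ + v * I) / 2 := by ring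
      have x3 : (s - (κ + v * I) - t * I) / 2 = (s - t * I) / 2 - (κ + v * I) / 2 := by ring
      have x4 : a₁ + a₂ + a₃ + (s + t * I) / 2 + (s - t * I) / 2 = e := by rw [he]; ring
      rw [x1, x4]
      simp only [hR, hK, gammaQuot]
      rw [x2, x3]
      ring
    simp only [e1]
    rw [integral_const_mul, hsc]
    have y1 : a₂ + a₃ + (s + t * I) / 2 + (s - t * I) / 2 = s + a₂ + a₃ := by ring
    have y2 : a₁ + a₃ + (s + t * I) / 2 + (s - t * I) / 2 = s + a₁ + a₃ := by ring
    have y3 : a₁ + a₂ + (s + t * I) / 2 + (s - t * I) / 2 = s + a₁ + a₂ := by ring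
    have y4 : ∀ a : ℂ, gammaPM (2 * a + s) (t * I) = Gamma (a + (s + t * I) / 2) * Gamma (a + (s - t * I) / 2) := by
      intro a
      rw [gammaPM]
      ring_nf
    rw [y1, y2, y3, y4, y4, y4, real_smul]
    have : |((1 / 2 : ℝ))⁻¹| = 2 := by norm_num
    rw [this]
    push_cast
    ring
  have hleft : ∀ v : ℝ, mellin (flat H) (s - (κ + v * I) - 1 / 2) * (Real.pi : ℂ) ^ (-(κ + v * I) : ℂ) *
      gammaQuot a₁ a₂ a₃ e (κ + v * I) =
      (1 / 4 * (Real.pi : ℂ) ^ (-s) * (1 / (2 * Real.pi))) * ∫ t : ℝ, R v * G t * K v t := by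
    intro v
    have hpi : (Real.pi : ℂ) ≠ 0 := by simp [Real.pi_ne_zero]
    rw [hH.mellin_flat hη (by simp; linarith), vint]
    have e1 : (Real.pi : ℂ) ^ (-s) = (Real.pi : ℂ) ^ (-(s - (κ + v * I) - 1 / 2) - 1 / 2) *
        (Real.pi : ℂ) ^ (-(κ + v * I) : ℂ) := by
      rw [← cpow_add _ _ hpi]; ring_nf
    have e2 : ∫ t : ℝ, R v * G t * K v t = R v * ∫ t : ℝ, spectral H (((0 : ℝ) : ℂ) + t * I) *
        (Gamma ((s - (κ + v * I) - 1 / 2 + 1 / 2 + (((0 : ℝ) : ℂ) + t * I)) / 2) *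
          Gamma ((s - (κ + v * I) - 1 / 2 + 1 / 2 - (((0 : ℝ) : ℂ) + t * I)) / 2)) := by
      simp only [mul_assoc (R v)]
      rw [integral_const_mul]
      congr 2
      funext t
      simp only [hG, hK, ofReal_zero, zero_add, sub_add_cancel]
    rw [e2, e1]
    simp only [hR]
    ring
  rw [vint]
  simp only [hleft]
  rw [integral_const_mul, hswap]
  simp only [hinner]
  have hfin : ∀ t : ℝ, G t * (4 * Real.pi *
      (gammaPM (2 * a₁ + s) (t * I) * gammaPM (2 * a₂ + s) (t * I) * gammaPM (2 * a₃ + s) (t * I) /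
        (Gamma (s + a₂ + a₃) * Gamma (s + a₁ + a₃) * Gamma (s + a₁ + a₂)))) =
      4 * Real.pi / (Gamma (s + a₂ + a₃) * Gamma (s + a₁ + a₃) * Gamma (s + a₁ + a₂)) *
      (spectral H (((0 : ℝ) : ℂ) + t * I) * (gammaPM (2 * a₁ + s) (((0 : ℝ) : ℂ) + t * I) *
        gammaPM (2 * a₂ + s) (((0 : ℝ) : ℂ) + t * I) * gammaPM (2 * a₃ + s) (((0 : ℝ) : ℂ) + t * I))) := by
    intro t
    simp only [hG, ofReal_zero, zero_add]
    ring
  simp only [hfin]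
  rw [integral_const_mul, vint]
  have hpi : (Real.pi : ℂ) ≠ 0 := by simp [Real.pi_ne_zero]
  generalize (∫ t : ℝ, spectral H (((0 : ℝ) : ℂ) + t * I) * (gammaPM (2 * a₁ + s) (((0 : ℝ) : ℂ) + t * I) *
        gammaPM (2 * a₂ + s) (((0 : ℝ) : ℂ) + t * I) * gammaPM (2 * a₃ + s) (((0 : ℝ) : ℂ) + t * I))) = X
  field_simp

/-- Moving the contour of the Mellin-Barnes integral. -/
theorem TestClass.vint_mellin_flat_shift (hH : TestClass η H) {N : ℕ} (hN : (N : ℝ) < 2 * η)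
    {s a₁ a₂ a₃ : ℂ} {κ c : ℝ} (h₁ : 0 < a₁.re + κ / 2) (h₂ : 0 < a₂.re + κ / 2)
    (h₃ : 0 < a₃.re + κ / 2) (hκ : κ < s.re) (hκc : κ ≤ c) (hc : c < s.re + N) :
    vint c (fun p => mellin (flat H) (s - p - 1 / 2) * (Real.pi : ℂ) ^ (-p) *
        gammaQuot a₁ a₂ a₃ (s + a₁ + a₂ + a₃) p) =
      vint κ (fun p => mellin (flat H) (s - p - 1 / 2) * (Real.pi : ℂ) ^ (-p) *
        gammaQuot a₁ a₂ a₃ (s + a₁ + a₂ + a₃) p) := by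
  set e := s + a₁ + a₂ + a₃ with he
  have hee : 0 < (e - a₃).re := by simp [he]; linarith
  obtain ⟨δ, hδ, hδm⟩ := exists_between (lt_min (lt_min h₁ h₂) (lt_min h₃ hee))
  simp only [lt_min_iff] at hδm
  obtain ⟨⟨d1, d2⟩, d3, d4⟩ := hδm
  set M := max (max (max ‖a₁‖ ‖a₃‖) ‖e‖) (max (a₁.re + c / 2) (a₂.re + c / 2)) with hM
  have m0 : 0 ≤ M := (norm_nonneg a₁).trans (by simp [hM])
  obtain ⟨C, hC, h⟩ := exists_norm_gammaQuot_le 0 hδ m0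
  obtain ⟨D, hD, hm⟩ := hH.exists_norm_mellin_flat_le hN (a := s.re - c - 1 / 2) (b := s.re - κ - 1 / 2)
    (by linarith) (by linarith)
  have hre : ∀ a z : ℂ, (a + z / 2).re = a.re + z.re / 2 := fun a z => by simp
  have hre2 : ∀ z : ℂ, (s - z - 1 / 2).re = s.re - z.re - 1 / 2 := fun z => by simp
  have hpi : (Real.pi : ℂ) ≠ 0 := by simp [Real.pi_ne_zero]
  -- No pole is met: the Gamma arguments already have positive real part at κ, and c < Re s + N
  -- keeps s − p − 1/2 to the right of −(N + 1/2).
  refine (vint_eq_of_strip (C := D * Real.pi ^ (-κ) * C) hκc ?_ ?_).2.2.symm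
  · intro z hz
    obtain ⟨z1, z2⟩ := hz
    refine DifferentiableAt.differentiableWithinAt ?_
    refine DifferentiableAt.mul (DifferentiableAt.mul ?_ ?_) (differentiableAt_gammaQuot ?_ ?_ ?_)
    · exact DifferentiableAt.comp (g := mellin (flat H)) (f := fun p => s - p - 1 / 2) z
        (hH.differentiableAt_mellin_flat hN (by rw [hre2]; linarith)) (by fun_prop)
    · exact DifferentiableAt.const_cpow (by fun_prop) (Or.inl hpi)
    all_goals rw [hre]; linarith
  · intro z z1 z2
    rw [norm_mul, norm_mul, norm_cpow_eq_rpow_re_of_pos Real.pi_pos, mul_assoc (D * _)]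
    have b1 := hm (s - z - 1 / 2) (by rw [hre2]; linarith) (by rw [hre2]; linarith)
    have b2 : Real.pi ^ (-z).re ≤ Real.pi ^ (-κ) :=
      Real.rpow_le_rpow_of_exponent_le (by linarith [Real.pi_gt_three]) (by simpa)
    have b3 := h a₁ a₂ a₃ e z (by simp [hM]) (by simp [hM]) (by simp [hM])
      (by rw [hre]; linarith) (by rw [hre]; exact le_trans (by linarith) (le_trans (le_max_left _ _) (le_max_right _ _)))
      (by rw [hre]; linarith) (by rw [hre]; exact le_trans (by linarith) (le_trans (le_max_right _ _) (le_max_right _ _)))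
      (by rw [hre, Nat.cast_zero]; linarith) (by rw [Nat.cast_zero]; linarith)
    have := Real.pi_pos
    gcongr

end

/-! ### The 1-swap identity -/

section

variable {η : ℝ} {H : ℂ → ℂ}

theorem continuous_gammaPM_line {a : ℂ} (ha : 0 < a.re) :
    Continuous fun v : ℝ => gammaPM a (((0 : ℝ) : ℂ) + v * I) := by
  unfold gammaPM
  exact (continuous_Gamma_comp (by fun_prop) (by simpa)).mul (continuous_Gamma_comp (by fun_prop) (by simpa))

theorem norm_gammaPM_line_le {a : ℂ} (ha : 0 < a.re) (v : ℝ) :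
    ‖gammaPM a (((0 : ℝ) : ℂ) + v * I)‖ ≤ Real.Gamma (a.re / 2) * Real.Gamma (a.re / 2) := by
  have h1 := norm_Gamma_le (z := (a + (((0 : ℝ) : ℂ) + v * I)) / 2) (by simpa)
  have h2 := norm_Gamma_le (z := (a - (((0 : ℝ) : ℂ) + v * I)) / 2) (by simpa)
  have r1 : ((a + (((0 : ℝ) : ℂ) + v * I)) / 2).re = a.re / 2 := by simp
  have r2 : ((a - (((0 : ℝ) : ℂ) + v * I)) / 2).re = a.re / 2 := by simp
  rw [r1] at h1
  rw [r2] at h2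
  have := Real.Gamma_pos_of_pos (half_pos ha)
  rw [gammaPM, norm_mul]
  gcongr

theorem TestClass.verticalIntegrable_mul_gammaPM (hH : TestClass η H) (hη : 0 < η) {a b c : ℂ}
    (ha : 0 < a.re) (hb : 0 < b.re) (hc : 0 < c.re) :
    VerticalIntegrable (fun μ => H μ / ((‖Gamma μ‖ ^ 2 : ℝ) : ℂ) *
      (gammaPM a μ * gammaPM b μ * gammaPM c μ)) 0 := by
  have h0 : |(0 : ℝ)| < 2 * η := by rw [abs_zero]; linarith
  have i1 := (hH.integrable_spectral_line h0).mul_bdd (continuous_gammaPM_line ha).aestronglyMeasurable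
    (Filter.Eventually.of_forall (norm_gammaPM_line_le ha))
  have i2 := i1.mul_bdd (continuous_gammaPM_line hb).aestronglyMeasurable
    (Filter.Eventually.of_forall (norm_gammaPM_line_le hb))
  have i3 := i2.mul_bdd (continuous_gammaPM_line hc).aestronglyMeasurable
    (Filter.Eventually.of_forall (norm_gammaPM_line_le hc))
  refine i3.congr (Filter.Eventually.of_forall fun v => ?_)
  simp only []
  rw [← div_norm_Gamma_sq (by simp)]
  ring

theorem vint_zero_div_norm_Gamma_sq (H f : ℂ → ℂ) :
    vint 0 (fun μ => H μ / ((‖Gamma μ‖ ^ 2 : ℝ) : ℂ) * f μ) = vint 0 (fun μ => spectral H μ * f μ) := by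
  rw [vint, vint]
  congr 2
  funext v
  rw [div_norm_Gamma_sq (by simp)]

theorem hasMellin_one_add_sq_cpow {q c : ℂ} (hc : 0 < c.re) (hq : c.re < q.re) :
    HasMellin (fun y : ℝ => ((1 + y ^ 2 : ℝ) : ℂ) ^ (-q)) (2 * c)
      (1 / 2 * (Gamma c * Gamma (q - c) / Gamma q)) := by
  have h := hasMellin_one_add_cpow hc hq
  have e : (fun y : ℝ => ((1 + y ^ 2 : ℝ) : ℂ) ^ (-q)) =
      fun y : ℝ => (fun x : ℝ => ((1 + x : ℝ) : ℂ) ^ (-q)) (y ^ (2 : ℝ)) := by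
    funext y
    simp only [Real.rpow_two]
  have e2 : 2 * c / ((2 : ℝ) : ℂ) = c := by push_cast; field_simp
  rw [e]
  constructor
  · rw [MellinConvergent.comp_rpow (f := fun x : ℝ => ((1 + x : ℝ) : ℂ) ^ (-q)) two_ne_zero, e2]
    exact h.1
  · rw [mellin_comp_rpow (fun x : ℝ => ((1 + x : ℝ) : ℂ) ^ (-q)), e2, h.2, real_smul]
    norm_num

/-- The Mellin-Barnes representation of the Whittaker function. -/
theorem whittaker_eq_integral {ν : ℂ} {κ y r : ℝ} (hκ : |ν.re| < κ) (hy : 0 < y) (hr : 0 < r) :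
    whittaker ν (y * r) = ∫ v : ℝ, (y : ℂ) ^ (1 / 2 - (κ + v * I)) * (r : ℂ) ^ (1 / 2 - (κ + v * I)) *
      (1 / (2 * Real.pi) * (1 / 2 * (Real.pi : ℂ) ^ (-(κ + v * I) : ℂ) *
        (Gamma (ν / 2 + (κ + v * I) / 2) * Gamma (-ν / 2 + (κ + v * I) / 2)))) := by
  have hyr : 0 < y * r := by positivity
  rw [whittaker, ← mellinInv_mellin_besselK hκ (by positivity), mellinInv, real_smul, ← mul_assoc,
    ← integral_const_mul]
  congr 1
  funext v
  set p : ℂ := κ + v * I with hp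
  have hpi : (0 : ℝ) < 2 * Real.pi := by positivity
  have hyc : (y : ℂ) ≠ 0 := ofReal_ne_zero.mpr hy.ne'
  have hrc : (r : ℂ) ≠ 0 := ofReal_ne_zero.mpr hr.ne'
  rw [(hasMellin_besselK (by simpa [hp] using hκ)).2, smul_eq_mul, Real.sqrt_eq_rpow, ofReal_cpow hyr.le,
    ofReal_mul (2 * Real.pi), mul_cpow_ofReal_nonneg hpi.le hyr.le, ofReal_mul y,
    mul_cpow_ofReal_nonneg hy.le hr.le, mul_cpow_ofReal_nonneg hy.le hr.le, ofReal_mul 2,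
    mul_cpow_ofReal_nonneg zero_le_two Real.pi_pos.le, sub_eq_add_neg (1 / 2 : ℂ) p, cpow_add _ _ hyc, cpow_add _ _ hrc,
    cpow_sub _ _ two_ne_zero, show ν / 2 + p / 2 = (p + ν) / 2 by ring,
    show -ν / 2 + p / 2 = (p - ν) / 2 by ring]
  have h2 : (((2 : ℝ) : ℂ)) ^ (-p) * 2 ^ p = 1 := by
    rw [ofReal_ofNat, ← cpow_add _ _ two_ne_zero]; simp
  have h4 : (2 : ℂ) ^ (2 : ℂ) = 4 := by
    have := cpow_ofNat (2 : ℂ) 2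
    rw [this]; norm_num
  rw [h4]
  have e1 : (((1 / 2 : ℝ) : ℝ) : ℂ) = 1 / 2 := by push_cast; ring
  rw [e1]
  push_cast at h2 ⊢
  linear_combination (1 / (2 * Real.pi) * (y : ℂ) ^ (1 / 2 : ℂ) * (r : ℂ) ^ (1 / 2 : ℂ) * (y : ℂ) ^ (-p) *
    (r : ℂ) ^ (-p) * (Real.pi : ℂ) ^ (-p) * Gamma ((p + ν) / 2) * Gamma ((p - ν) / 2) / 2) * h2

/-- Fubini for a kernel that is a superposition of separated products: absolute integrability of the
triple integrand yields both the convergence of the double integral and its value. -/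
theorem integral_integral_of_eq_integral_mul {m : Measure ℝ} [SFinite m] {S A B : ℝ → ℝ → ℂ} {D : ℝ → ℂ}
    (hT : Integrable (fun q : (ℝ × ℝ) × ℝ => A q.1.1 q.2 * B q.1.2 q.2 * D q.2) ((m.prod m).prod volume))
    (hS : (fun q : ℝ × ℝ => S q.1 q.2) =ᵐ[m.prod m] fun q => ∫ v, A q.1 v * B q.2 v * D v) :
    Integrable (fun q : ℝ × ℝ => S q.1 q.2) (m.prod m) ∧
    ∫ y₁, ∫ y₀, S y₀ y₁ ∂m ∂m = ∫ v, (∫ y, A y v ∂m) * (∫ y, B y v ∂m) * D v := by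
  have hS_int : Integrable (fun q : ℝ × ℝ => S q.1 q.2) (m.prod m) :=
    hT.integral_prod_left.congr hS.symm
  refine ⟨hS_int, ?_⟩
  have h1 := integral_prod_symm _ hS_int
  have h2 := integral_integral_swap (f := fun (q : ℝ × ℝ) v => A q.1 v * B q.2 v * D v) hT
  rw [← h1, integral_congr_ae hS, h2]
  congr 1
  funext v
  rw [integral_mul_const, integral_prod_mul (fun y => A y v) (fun y => B y v)]

set_option maxHeartbeats 400000 in
-- The Mellin-Barnes integral for W_ν separates y₀ from y₁, producing the master integral at c = s −
-- β₂/2 with parameters ν/2, −ν/2 and a.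
theorem TestClass.swap_identity (hH : TestClass η H) (hη : 0 < η) {β : Fin 3 → ℂ}
    (hβ : β 0 + β 1 + β 2 = 0) {s : ℂ} (h₀ : -(β 0).re < s.re) (h₁ : -(β 1).re < s.re)
    (h₂ : s.re < 1 - (β 2).re) :
    IntegrableOn (fun p : ℝ × ℝ => swapIntegrand β (flat H) s p.1 p.2) (Ioi 0 ×ˢ Ioi 0) ∧
    ∫ y₁ in Ioi (0 : ℝ), ∫ y₀ in Ioi (0 : ℝ), swapIntegrand β (flat H) s y₀ y₁ =
      (Real.pi : ℂ) ^ (-(s - β 2 / 2)) / 8 * (Gamma ((1 + β 1 - β 2) / 2))⁻¹ *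
        (Gamma ((1 + β 0 - β 2) / 2))⁻¹ * vint 0 (oneSwap β H s) := by
  set c := s - β 2 / 2 with hc
  set ν := (β 0 - β 1) / 2 with hν
  set e := 1 / 2 - 3 / 4 * β 2 with he
  set a := e - c with ha
  have hβr : (β 0).re + (β 1).re + (β 2).re = 0 := by
    have := congrArg re hβ
    simpa using this
  have hcr : c.re = s.re - (β 2).re / 2 := by simp [hc]
  have hνr : ν.re = ((β 0).re - (β 1).re) / 2 := by simp [hν]
  have her : e.re = 1 / 2 - 3 / 4 * (β 2).re := by
    simp [he]
  have har : a.re = e.re - c.re := by simp [ha]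
  -- The line must lie right of |Re ν| for the Whittaker integral, right of −2 Re a for the beta
  -- integral in y₀, and left of Re c for h̃. Since the βᵢ sum to zero, such κ exists precisely
  -- under `h₀`, `h₁`, `h₂`.
  obtain ⟨κ, hκ1, hκ2⟩ : ∃ κ, max |ν.re| (-2 * a.re) < κ ∧ κ < c.re := by
    refine exists_between (max_lt (abs_lt.mpr ⟨?_, ?_⟩) ?_) <;> linarith
  rw [max_lt_iff] at hκ1
  obtain ⟨hκν, hκa⟩ := hκ1
  have hκ0 : 0 < κ := (abs_nonneg _).trans_lt hκν
  have hκν' := abs_lt.mp hκν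
  set m := volume.restrict (Ioi (0 : ℝ)) with hm
  set p : ℝ → ℂ := fun v => κ + v * I with hp
  have hpr : ∀ v, (p v).re = κ := fun v => by simp [hp]
  set A : ℝ → ℝ → ℂ := fun y v => (y : ℂ) ^ (2 * c - 1) * ((1 + y ^ 2 : ℝ) : ℂ) ^ (-(e + p v / 2)) with hA
  set B : ℝ → ℝ → ℂ := fun y v => (y : ℂ) ^ (c - p v - 1 / 2 - 1) * flat H y with hB
  set D : ℝ → ℂ := fun v => 1 / (2 * Real.pi) * (1 / 2 * (Real.pi : ℂ) ^ (-(p v)) *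
        (Gamma (ν / 2 + p v / 2) * Gamma (-ν / 2 + p v / 2))) with hD
  have hAm : ∀ v, HasMellin (fun y : ℝ => ((1 + y ^ 2 : ℝ) : ℂ) ^ (-(e + p v / 2))) (2 * c)
      (1 / 2 * (Gamma c * Gamma (a + p v / 2) / Gamma (e + p v / 2))) := fun v => by
    have := hasMellin_one_add_sq_cpow (c := c) (q := e + p v / 2) (by linarith)
      (by simp [hpr]; linarith)
    rwa [show e + p v / 2 - c = a + p v / 2 by rw [ha]; ring] at this
  have hBm : ∀ v, MellinConvergent (flat H) (c - p v - 1 / 2) := fun v =>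
    hH.mellinConvergent_flat (N := 0) (by simp; linarith) (by simp [hpr]; linarith)
  have hD_int : Integrable D := by
    have g1 : 0 < (ν / 2 + κ / 2).re := by simp; linarith
    have g2 : 0 < (-ν / 2 + κ / 2).re := by simp; linarith
    have h := (integrable_Gamma_line (a := ν / 2 + κ / 2) (1 / 2) (by norm_num) g1).mul_bdd
      (c := Real.pi ^ (-κ) * Real.Gamma (-ν / 2 + κ / 2).re)
      (g := fun v : ℝ => (Real.pi : ℂ) ^ (-(p v)) * Gamma (-ν / 2 + κ / 2 + (v / 2 : ℝ) * I))
      (Continuous.aestronglyMeasurable (Continuous.mul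
        (Continuous.const_cpow (by fun_prop) (Or.inl (by simp [Real.pi_ne_zero])))
        (continuous_Gamma_comp (by fun_prop) fun v => by
          rw [add_re, re_ofReal_mul, I_re, mul_zero, add_zero]; exact g2)))
      (Filter.Eventually.of_forall fun v => by
        rw [norm_mul, norm_cpow_eq_rpow_re_of_pos Real.pi_pos, neg_re, hpr]
        have := Real.pi_pos
        gcongr
        exact norm_Gamma_line_le g2 (by simp))
    refine (h.const_mul (1 / (2 * Real.pi) * (1 / 2) : ℂ)).congr (Filter.Eventually.of_forall fun v => ?_)
    simp only [hD]
    rw [show ν / 2 + κ / 2 + ((1 / 2 * v : ℝ) : ℂ) * I = ν / 2 + p v / 2 by simp only [hp]; push_cast; ring,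
      show -ν / 2 + κ / 2 + ((v / 2 : ℝ) : ℂ) * I = -ν / 2 + p v / 2 by simp only [hp]; push_cast; ring]
    ring
  have hA_int : ∀ v, Integrable (fun y => A y v) m := fun v => (hAm v).1
  have hB_int : ∀ v, Integrable (fun y => B y v) m := fun v => hBm v
  have hT_int : Integrable (fun q : (ℝ × ℝ) × ℝ => A q.1.1 q.2 * B q.1.2 q.2 * D q.2)
      ((m.prod m).prod volume) := by
    -- The absolute values of A and B do not depend on v, so the integrand is its v = 0 version
    -- times D and a unimodular factor U.
    have h1 := ((hA_int 0).mul_prod (hB_int 0)).mul_prod hD_int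
    have hae : ∀ᵐ q : (ℝ × ℝ) × ℝ ∂((m.prod m).prod volume), 0 < q.1.2 := by
      have h2 : ∀ᵐ q : ℝ × ℝ ∂(m.prod m), q.2 ∈ Ioi (0 : ℝ) :=
        Measure.quasiMeasurePreserving_snd.ae (ae_restrict_mem measurableSet_Ioi)
      exact Measure.quasiMeasurePreserving_fst.ae h2
    set U : (ℝ × ℝ) × ℝ → ℂ := fun q => ((1 + q.1.1 ^ 2 : ℝ) : ℂ) ^ (-(((q.2 / 2 : ℝ) : ℂ) * I)) *
      (q.1.2 : ℂ) ^ (-((q.2 : ℂ) * I)) with hU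
    have hUb : ∀ᵐ q ∂((m.prod m).prod volume), ‖U q‖ ≤ 1 := by
      filter_upwards [hae] with q hq
      simp only [hU]
      rw [norm_mul, norm_cpow_eq_rpow_re_of_pos (by positivity), norm_cpow_eq_rpow_re_of_pos hq]
      simp
    refine (h1.mul_bdd (Measurable.aestronglyMeasurable (f := U) (by fun_prop)) hUb).congr ?_
    filter_upwards [hae] with q hq
    have x1 : (((1 + q.1.1 ^ 2 : ℝ)) : ℂ) ≠ 0 := ofReal_ne_zero.mpr (by positivity)
    have x2 : (q.1.2 : ℂ) ≠ 0 := ofReal_ne_zero.mpr hq.ne'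
    have y1 : ((1 + q.1.1 ^ 2 : ℝ) : ℂ) ^ (-(e + p q.2 / 2)) = ((1 + q.1.1 ^ 2 : ℝ) : ℂ) ^ (-(e + p 0 / 2)) *
        ((1 + q.1.1 ^ 2 : ℝ) : ℂ) ^ (-(((q.2 / 2 : ℝ) : ℂ) * I)) := by
      rw [← cpow_add _ _ x1]
      congr 1
      simp only [hp]
      push_cast
      ring
    have y2 : (q.1.2 : ℂ) ^ (c - p q.2 - 1 / 2 - 1) = (q.1.2 : ℂ) ^ (c - p 0 - 1 / 2 - 1) *
        (q.1.2 : ℂ) ^ (-((q.2 : ℂ) * I)) := by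
      rw [← cpow_add _ _ x2]
      congr 1
      simp only [hp]
      push_cast
      ring
    simp only [hA, hB, hU]
    rw [y1, y2]
    ring
  have hpt : ∀ y₀ > 0, ∀ y₁ > 0, swapIntegrand β (flat H) s y₀ y₁ = ∫ v, A y₀ v * B y₁ v * D v := by
    intro y₀ hy₀ y₁ hy₁
    have x0 : (y₀ : ℂ) ≠ 0 := ofReal_ne_zero.mpr hy₀.ne'
    have x1 : (y₁ : ℂ) ≠ 0 := ofReal_ne_zero.mpr hy₁.ne'
    have hr : (0 : ℝ) < 1 + y₀ ^ 2 := by positivity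
    have x2 : ((1 + y₀ ^ 2 : ℝ) : ℂ) ≠ 0 := ofReal_ne_zero.mpr hr.ne'
    rw [swapIntegrand, ← hν, ← hc, whittaker_eq_integral hκν hy₁ (Real.sqrt_pos.mpr hr), ← integral_const_mul,
      ← integral_div]
    congr 1
    funext v
    have z1 : ((Real.sqrt (1 + y₀ ^ 2) : ℝ) : ℂ) ^ (1 / 2 - (κ + v * I) : ℂ) =
        ((1 + y₀ ^ 2 : ℝ) : ℂ) ^ ((1 / 2 - p v) / 2) := by
      rw [cpow_eq_exp_log (Real.sqrt_pos.mpr hr), cpow_eq_exp_log hr, Real.log_sqrt hr.le]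
      congr 1
      simp only [hp]
      push_cast
      ring
    have z2 : ((1 + y₀ ^ 2 : ℝ) : ℂ) ^ (-(e + p v / 2)) = ((1 + y₀ ^ 2 : ℝ) : ℂ) ^ (-(3 / 4 : ℂ) * (1 - β 2)) *
        ((1 + y₀ ^ 2 : ℝ) : ℂ) ^ ((1 / 2 - p v) / 2) := by
      rw [← cpow_add _ _ x2]
      congr 1
      rw [he]
      ring
    have z3 : (y₀ : ℂ) ^ (2 * c - 1) = (y₀ : ℂ) ^ (2 * s - β 2) / y₀ := by
      rw [cpow_sub _ _ x0, cpow_one, hc]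
      ring_nf
    have z4 : (y₁ : ℂ) ^ (c - p v - 1 / 2 - 1) = (y₁ : ℂ) ^ c * (y₁ : ℂ) ^ (1 / 2 - (κ + v * I) : ℂ) / (y₁ : ℂ) ^ 2 := by
      rw [← cpow_add _ _ x1, ← cpow_ofNat, ← cpow_sub _ _ x1]
      congr 1
      simp only [hp, OfNat.ofNat]
      push_cast
      ring
    simp only [hA, hB, hD]
    rw [z1, z2, z3, z4]
    simp only [hp]
    field_simp
  have hae2 : ∀ᵐ q : ℝ × ℝ ∂(m.prod m), 0 < q.1 ∧ 0 < q.2 := by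
    have h1 : ∀ᵐ q : ℝ × ℝ ∂(m.prod m), q.1 ∈ Ioi (0 : ℝ) :=
      Measure.quasiMeasurePreserving_fst.ae (ae_restrict_mem measurableSet_Ioi)
    have h2 : ∀ᵐ q : ℝ × ℝ ∂(m.prod m), q.2 ∈ Ioi (0 : ℝ) :=
      Measure.quasiMeasurePreserving_snd.ae (ae_restrict_mem measurableSet_Ioi)
    filter_upwards [h1, h2] with q h1 h2 using ⟨h1, h2⟩
  have hS_eq : (fun q : ℝ × ℝ => swapIntegrand β (flat H) s q.1 q.2) =ᵐ[m.prod m]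
      fun q => ∫ v, A q.1 v * B q.2 v * D v := by
    filter_upwards [hae2] with q hq using hpt q.1 hq.1 q.2 hq.2
  obtain ⟨hS_int, hS_val⟩ := integral_integral_of_eq_integral_mul
    (S := swapIntegrand β (flat H) s) (m := m) hT_int hS_eq
  refine ⟨?_, ?_⟩
  · rw [IntegrableOn, Measure.volume_eq_prod, ← Measure.prod_restrict]
    exact hS_int
  rw [hS_val]
  have hin : ∀ v, (∫ y, A y v ∂m) * (∫ y, B y v ∂m) * D v = (1 / (2 * Real.pi) * (1 / 4 * Gamma c)) *
      (mellin (flat H) (c - p v - 1 / 2) * (Real.pi : ℂ) ^ (-(p v)) *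
        gammaQuot (ν / 2) (-ν / 2) a (c + ν / 2 + -ν / 2 + a) (p v)) := by
    intro v
    have i1 : ∫ y, A y v ∂m = 1 / 2 * (Gamma c * Gamma (a + p v / 2) / Gamma (e + p v / 2)) := (hAm v).2
    have i2 : ∫ y, B y v ∂m = mellin (flat H) (c - p v - 1 / 2) := rfl
    rw [i1, i2, gammaQuot, show c + ν / 2 + -ν / 2 + a = e by rw [ha]; ring]
    simp only [hD]
    ring
  simp only [hin]
  have hkey := hH.vint_mellin_flat_mul_gammaQuot hη (s := c) (a₁ := ν / 2) (a₂ := -ν / 2) (a₃ := a)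
    (κ := κ) (by simp; linarith) (by simp; linarith) (by linarith) hκ2
  rw [vint] at hkey
  rw [integral_const_mul]
  have hvi : vint 0 (oneSwap β H s) = vint 0 (fun μ => spectral H μ *
      (gammaPM (2 * (ν / 2) + c) μ * gammaPM (2 * (-ν / 2) + c) μ * gammaPM (2 * a + c) μ)) := by
    have h3 := vint_zero_div_norm_Gamma_sq H (fun μ =>
      gammaPM (2 * (ν / 2) + c) μ * gammaPM (2 * (-ν / 2) + c) μ * gammaPM (2 * a + c) μ)
    rw [← h3]
    congr 1
    funext μ
    -- Here β₀ + β₁ + β₂ = 0 turns the symmetric parameters ±ν/2 around c back into β₀ and β₁.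
    have w0 : s + β 0 = 2 * (ν / 2) + c := by rw [hν, hc]; linear_combination (1 / 2 : ℂ) * hβ
    have w1 : s + β 1 = 2 * (-ν / 2) + c := by rw [hν, hc]; linear_combination (1 / 2 : ℂ) * hβ
    have w2 : 1 - s - β 2 = 2 * a + c := by rw [ha, he, hc]; ring
    rw [oneSwap, w0, w1, w2]
  rw [hvi]
  have q1 : c + -ν / 2 + a = (1 + β 1 - β 2) / 2 := by
    rw [ha, he, hν]; linear_combination (-1 / 4 : ℂ) * hβ
  have q2 : c + ν / 2 + a = (1 + β 0 - β 2) / 2 := by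
    rw [ha, he, hν]; linear_combination (-1 / 4 : ℂ) * hβ
  have q3 : Gamma (c + ν / 2 + -ν / 2) = Gamma c := by ring_nf
  rw [q1, q2, q3] at hkey
  have hG : Gamma c ≠ 0 := Gamma_ne_zero_of_re_pos (by linarith)
  rw [mul_comm (1 / (2 * (Real.pi : ℂ))) (1 / 4 * Gamma c), mul_assoc (1 / 4 * Gamma c), hkey]
  field_simp
  ring

end

/-! ### The dual transform as a single Mellin-Barnes integral -/

/-- Barnes' second lemma in the form needed for the inner Mellin-Barnes integral. -/
theorem vint_barnes_half {A B₁ B₂ B₃ : ℂ} {ε : ℝ} (hε : 0 < ε) (hA : 0 < A.re + ε / 2)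
    (hB₁ : ε / 2 < B₁.re) (hB₂ : ε / 2 < B₂.re) (hB₃ : ε / 2 < B₃.re) :
    vint ε (fun u => Gamma (u / 2) * Gamma (A + u / 2) * Gamma (B₁ - u / 2) * Gamma (B₂ - u / 2) *
      (Gamma (B₃ - u / 2) / Gamma (A + B₁ + B₂ + B₃ - u / 2))) =
    2 * (Gamma B₁ * Gamma B₂ * Gamma B₃ * (Gamma (A + B₁) * Gamma (A + B₂) * Gamma (A + B₃)) /
      (Gamma (A + B₂ + B₃) * Gamma (A + B₁ + B₃) * Gamma (A + B₁ + B₂))) := by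
  -- The variable is z = −u/2, so the roles are exchanged: Γ(u/2) and Γ(A + u/2) are the factors
  -- with b₁ = 0 and b₂ = A. The Jacobian gives the factor 2.
  have hB := barnes_second (a₁ := B₁) (a₂ := B₂) (a₃ := B₃) (b₁ := 0) (b₂ := A) (c := -(ε / 2))
    (by linarith) (by linarith) (by linarith) (by simpa) (by linarith)
  rw [vint] at hB
  have hpi : (2 * Real.pi : ℂ) ≠ 0 := by simp [Real.pi_ne_zero]
  rw [one_div, inv_mul_eq_iff_eq_mul₀ hpi] at hB
  have hsc := Measure.integral_comp_mul_left (fun v : ℝ => Gamma (B₁ + ((-(ε / 2) : ℝ) + v * I)) *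
      Gamma (B₂ + ((-(ε / 2) : ℝ) + v * I)) * Gamma (B₃ + ((-(ε / 2) : ℝ) + v * I)) *
      Gamma (0 - ((-(ε / 2) : ℝ) + v * I)) * Gamma (A - ((-(ε / 2) : ℝ) + v * I)) /
      Gamma (B₁ + B₂ + B₃ + 0 + A + ((-(ε / 2) : ℝ) + v * I))) (-1 / 2)
  rw [hB] at hsc
  have e1 : ∀ v : ℝ, Gamma ((ε + v * I) / 2) * Gamma (A + (ε + v * I) / 2) * Gamma (B₁ - (ε + v * I) / 2) *
      Gamma (B₂ - (ε + v * I) / 2) *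
      (Gamma (B₃ - (ε + v * I) / 2) / Gamma (A + B₁ + B₂ + B₃ - (ε + v * I) / 2)) =
      Gamma (B₁ + ((-(ε / 2) : ℝ) + (-1 / 2 * v : ℝ) * I)) *
      Gamma (B₂ + ((-(ε / 2) : ℝ) + (-1 / 2 * v : ℝ) * I)) * Gamma (B₃ + ((-(ε / 2) : ℝ) + (-1 / 2 * v : ℝ) * I)) *
      Gamma (0 - ((-(ε / 2) : ℝ) + (-1 / 2 * v : ℝ) * I)) * Gamma (A - ((-(ε / 2) : ℝ) + (-1 / 2 * v : ℝ) * I)) /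
      Gamma (B₁ + B₂ + B₃ + 0 + A + ((-(ε / 2) : ℝ) + (-1 / 2 * v : ℝ) * I)) := by
    intro v
    have x1 : (((-(ε / 2) : ℝ) : ℂ) + (-1 / 2 * v : ℝ) * I) = -((ε + v * I) / 2) := by push_cast; ring
    rw [x1, show B₁ + B₂ + B₃ + 0 + A + -((ε + v * I) / 2) = A + B₁ + B₂ + B₃ - (ε + v * I) / 2 by ring,
      zero_sub, neg_neg, sub_neg_eq_add, ← sub_eq_add_neg, ← sub_eq_add_neg, ← sub_eq_add_neg]
    ring
  rw [vint]
  simp only [e1]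
  rw [hsc, real_smul]
  have h2 : |((-1 / 2 : ℝ))⁻¹| = 2 := by norm_num
  rw [h2]
  have y1 : B₂ + B₃ + 0 + A = A + B₂ + B₃ := by ring
  have y2 : B₁ + B₃ + 0 + A = A + B₁ + B₃ := by ring
  have y3 : B₁ + B₂ + 0 + A = A + B₁ + B₂ := by ring
  rw [y1, y2, y3, add_zero, add_zero, add_zero, add_comm B₁ A, add_comm B₂ A, add_comm B₃ A]
  push_cast
  field_simp

section

variable {η : ℝ} {H : ℂ → ℂ}

/-- The meromorphic continuation of the dual transform, as a single Mellin-Barnes integral. -/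
noncomputable def mellinBarnes (η : ℝ) (H : ℂ → ℂ) (a₁ a₂ a₃ s : ℂ) : ℂ :=
  vint (η - 1 / 2) (fun p => mellin (flat H) (s - p - 1 / 2) * (Real.pi : ℂ) ^ (-p) *
    gammaQuot a₁ a₂ a₃ (s + a₁ + a₂ + a₃) p)

/-- N ≥ η puts Re(s − p − 1/2) = σ − η to the right of −(N + 1/2) on the line Re p = η − 1/2 when σ
> 0, while N < 2η is what the vanishing of H^♭ permits. -/
theorem exists_nat_between {η : ℝ} (hη : 40 < η) : ∃ N : ℕ, η ≤ N ∧ (N : ℝ) < 2 * η := by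
  refine ⟨⌈η⌉₊, Nat.le_ceil η, ?_⟩
  have := Nat.ceil_lt_add_one (a := η) (by linarith)
  linarith

/-- The contour stays fixed. As η > 40, Re(p/2) exceeds 19, so parameters with real part at least −5
keep all Gamma arguments far to the right throughout 0 < σ < 4. -/
theorem TestClass.differentiableOn_mellinBarnes (hH : TestClass η H) (hη : 40 < η) {a₁ a₂ a₃ : ℂ → ℂ}
    (d₁ : Differentiable ℂ a₁) (d₂ : Differentiable ℂ a₂) (d₃ : Differentiable ℂ a₃)
    (h₁ : ∀ s ∈ strip 0 4, -5 ≤ (a₁ s).re) (h₂ : ∀ s ∈ strip 0 4, -5 ≤ (a₂ s).re)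
    (h₃ : ∀ s ∈ strip 0 4, -5 ≤ (a₃ s).re) (h₁₂ : ∀ s ∈ strip 0 4, -5 ≤ (s + a₁ s + a₂ s).re) :
    DifferentiableOn ℂ (fun s => mellinBarnes η H (a₁ s) (a₂ s) (a₃ s) s) (strip 0 4) := by
  obtain ⟨N, hN1, hN2⟩ := exists_nat_between hη
  have hopen : IsOpen (strip 0 4) :=
    (isOpen_lt continuous_const continuous_re).inter (isOpen_lt continuous_re continuous_const)
  set e : ℂ → ℂ := fun s => s + a₁ s + a₂ s + a₃ s with he
  have de : Differentiable ℂ e := ((differentiable_id.add d₁).add d₂).add d₃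
  obtain ⟨D, hD, hm⟩ := hH.exists_norm_mellin_flat_le hN2 (a := -η) (b := 4 - η) (by linarith) (by linarith)
  set p : ℝ → ℂ := fun v => ((η - 1 / 2 : ℝ) : ℂ) + v * I with hp
  have hpr : ∀ v, (p v).re = η - 1 / 2 := fun v => by simp [hp]
  have hre : ∀ (a : ℂ) (v : ℝ), (a + p v / 2).re = a.re + (η - 1 / 2) / 2 := fun a v => by
    rw [add_re, show p v / 2 = ((1 / 2 : ℝ) : ℂ) * p v by push_cast; ring, re_ofReal_mul, hpr]
    ring
  have hpi : (Real.pi : ℂ) ≠ 0 := by simp [Real.pi_ne_zero]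
  have hre2 : ∀ (s : ℂ) (v : ℝ), (s - p v - 1 / 2).re = s.re - η := fun s v => by
    simp [hpr]; ring
  unfold mellinBarnes vint
  refine DifferentiableOn.const_mul (differentiableOn_integral hopen ?_ ?_ ?_) _
  · intro s hs
    refine Continuous.aestronglyMeasurable (continuous_iff_continuousAt.mpr fun v => ?_)
    refine ContinuousAt.mul (ContinuousAt.mul ?_ ?_) ?_
    · refine ContinuousAt.comp (f := fun v : ℝ => s - p v - 1 / 2) (g := mellin (flat H))
        (hH.differentiableAt_mellin_flat hN2 ?_).continuousAt (by fun_prop)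
      rw [hre2]; linarith [hs.1]
    · refine Continuous.continuousAt (Continuous.const_cpow ?_ (Or.inl hpi))
      fun_prop
    · refine ContinuousAt.comp (f := p) (g := gammaQuot (a₁ s) (a₂ s) (a₃ s) (e s))
        (differentiableAt_gammaQuot ?_ ?_ ?_).continuousAt (by fun_prop)
      · rw [hre]; linarith [h₁ s hs]
      · rw [hre]; linarith [h₂ s hs]
      · rw [hre]; linarith [h₃ s hs]
  · intro v s hs
    refine DifferentiableAt.differentiableWithinAt ?_
    have hG : ∀ a : ℂ → ℂ, Differentiable ℂ a → -5 ≤ (a s).re →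
        DifferentiableAt ℂ (fun s => Gamma (a s + p v / 2)) s := by
      intro a da ha
      have : DifferentiableAt ℂ Gamma (a s + p v / 2) := by
        refine differentiableAt_Gamma _ fun m hm => ?_
        have h3 := congrArg re hm
        rw [hre] at h3
        simp at h3
        have : (0 : ℝ) ≤ m := by positivity
        linarith
      exact this.comp s (f := fun s => a s + p v / 2) (da.differentiableAt.add_const _)
    have hI : DifferentiableAt ℂ (fun s => (Gamma (e s + p v / 2))⁻¹) s :=
      (differentiable_one_div_Gamma _).comp s (f := fun s => e s + p v / 2)
        (de.differentiableAt.add_const _)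
    refine DifferentiableAt.mul (DifferentiableAt.mul ?_ (differentiableAt_const _)) ?_
    · refine DifferentiableAt.comp (f := fun s : ℂ => s - p v - 1 / 2) (g := mellin (flat H)) s
        (hH.differentiableAt_mellin_flat hN2 ?_) (by fun_prop)
      rw [hre2]; linarith [hs.1]
    · have := ((hG a₁ d₁ (h₁ s hs)).mul (hG a₂ d₂ (h₂ s hs))).mul ((hG a₃ d₃ (h₃ s hs)).mul hI)
      exact this
  · intro s₀ hs₀
    obtain ⟨r, hr, hrs⟩ := Metric.isOpen_iff.mp hopen s₀ hs₀
    have hK := isCompact_closedBall s₀ r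
    obtain ⟨M₁, hM₁⟩ := hK.exists_bound_of_continuousOn d₁.continuous.continuousOn
    obtain ⟨M₂, hM₂⟩ := hK.exists_bound_of_continuousOn d₂.continuous.continuousOn
    obtain ⟨M₃, hM₃⟩ := hK.exists_bound_of_continuousOn d₃.continuous.continuousOn
    obtain ⟨M₄, hM₄⟩ := hK.exists_bound_of_continuousOn de.continuous.continuousOn
    set M := |M₁| + |M₂| + |M₃| + |M₄| + η with hM
    have hM0 : 0 ≤ M := by positivity
    -- With δ = 1, eight shifts suffice: Re(e − a₃) ≥ −5 gives 1 ≤ −5 + 8, and Re(a₃ + p/2) still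
    -- exceeds 8 + 1.
    obtain ⟨C, hC, h⟩ := exists_norm_gammaQuot_le 8 one_pos hM0
    have q1 := abs_nonneg M₁
    have q2 := abs_nonneg M₂
    have q3 := abs_nonneg M₃
    have q4 := abs_nonneg M₄
    refine ⟨r, hr, fun v => D * Real.pi ^ (-(η - 1 / 2)) * C * (1 + v ^ 2)⁻¹,
      integrable_inv_one_add_sq.const_mul _, fun s hs v => ?_⟩
    have hst := hrs hs
    have hsc := Metric.ball_subset_closedBall hs
    have n1 := (hM₁ s hsc).trans (le_abs_self _)
    have n2 := (hM₂ s hsc).trans (le_abs_self _)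
    have n3 := (hM₃ s hsc).trans (le_abs_self _)
    have n4 := (hM₄ s hsc).trans (le_abs_self _)
    have b1 := hm (s - p v - 1 / 2) (by rw [hre2]; linarith [hst.1]) (by rw [hre2]; linarith [hst.2])
    have b2 := h (a₁ s) (a₂ s) (a₃ s) (e s) (p v) (by linarith) (by linarith) (by linarith)
      (by rw [hre]; linarith [h₁ s hst]) (by rw [hre]; linarith [re_le_norm (a₁ s)])
      (by rw [hre]; linarith [h₂ s hst]) (by rw [hre]; linarith [re_le_norm (a₂ s)])
      (by rw [hre]; norm_num; linarith [h₃ s hst])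
      (by
        have : e s - a₃ s = s + a₁ s + a₂ s := by simp [he]
        rw [this]
        norm_num
        have := h₁₂ s hst
        simp only [add_re] at this
        linarith)
    have him : (p v).im = v := by simp [hp]
    rw [him] at b2
    show ‖mellin (flat H) (s - p v - 1 / 2) * (Real.pi : ℂ) ^ (-(p v)) * gammaQuot (a₁ s) (a₂ s) (a₃ s) (e s) (p v)‖ ≤
      D * Real.pi ^ (-(η - 1 / 2)) * C * (1 + v ^ 2)⁻¹
    rw [norm_mul, norm_mul, norm_cpow_eq_rpow_re_of_pos Real.pi_pos, neg_re, hpr, mul_assoc (D * _)]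
    have := Real.pi_pos
    gcongr

end

/-- `i, j, k` enumerate the three indices, and `α` is a small parameter triple of sum zero. -/
structure IsEnumeration (α : Fin 3 → ℂ) (i j k : Fin 3) : Prop where
  prod : ∀ f : Fin 3 → ℂ, ∏ l, f l = f i * (f j * f k)
  prod_erase : ∀ f : Fin 3 → ℂ, ∏ l ∈ Finset.univ.erase i, f l = f j * f k
  ne_j : j ≠ i
  ne_k : k ≠ i
  sum : α i + α j + α k = 0
  small : ∀ l, |(α l).re| < 1 / 10000

theorem exists_isEnumeration {α : Fin 3 → ℂ} (hsum : α 0 + α 1 + α 2 = 0)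
    (hα : ∀ l, |(α l).re| < 1 / 10000) (i : Fin 3) : ∃ j k, IsEnumeration α i j k := by
  have e0 : (Finset.univ : Finset (Fin 3)).erase 0 = {1, 2} := by decide
  have e1 : (Finset.univ : Finset (Fin 3)).erase 1 = {0, 2} := by decide
  have e2 : (Finset.univ : Finset (Fin 3)).erase 2 = {0, 1} := by decide
  fin_cases i
  · exact ⟨1, 2, fun f => by rw [Fin.prod_univ_three]; simp [mul_assoc], fun f => by simp [e0], by decide,
      by decide, hsum, hα⟩
  · exact ⟨0, 2, fun f => by rw [Fin.prod_univ_three]; simp; ring, fun f => by simp [e1], by decide,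
      by decide, by simp; linear_combination hsum, hα⟩
  · exact ⟨0, 1, fun f => by rw [Fin.prod_univ_three]; simp; ring, fun f => by simp [e2], by decide,
      by decide, by simp; linear_combination hsum, hα⟩

section

variable {η : ℝ} {H : ℂ → ℂ} {α : Fin 3 → ℂ} {i j k : Fin 3}

/-- At the two special values of s₀ the u-dependence takes the shape of Barnes' second lemma; the
condition on the denominator is the relation αᵢ + αⱼ + αₖ = 0. -/
theorem dualIntegrand_eq (hE : IsEnumeration α i j k) {s₀ s : ℂ} (hs₀ : s₀ = 1 - α i ∨ s₀ = 2 * s - 1)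
    (s₁ : ℂ) {u : ℂ} (hu : u.re < 1) :
    dualIntegrand α H s₀ s s₁ u = mellin (flat H) (s - s₁ - 1 / 2) * (Real.pi : ℂ) ^ (-s₁) *
      ((Gamma ((s₁ - α i) / 2) * (Gamma ((s₁ - α j) / 2) * Gamma ((s₁ - α k) / 2))) /
        Gamma ((1 + s₁) / 2 - s₀)) *
      (Gamma (u / 2) * Gamma (s₁ / 2 - s₀ / 2 + 1 / 2 - s + u / 2) * Gamma (s - 1 / 2 + α i / 2 - u / 2) *
        Gamma ((s₀ + α k) / 2 - u / 2) * (Gamma ((s₀ + α j) / 2 - u / 2) /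
          Gamma ((s₁ / 2 - s₀ / 2 + 1 / 2 - s) + (s - 1 / 2 + α i / 2) + (s₀ + α k) / 2 +
            (s₀ + α j) / 2 - u / 2))) := by
  have hne : Gamma ((1 - u) / 2) ≠ 0 := by
    refine Gamma_ne_zero_of_re_pos ?_
    rw [show (1 - u) / 2 = ((1 / 2 : ℝ) : ℂ) * (1 - u) by push_cast; ring, re_ofReal_mul]
    simp; linarith
  have hk : α k = -α i - α j := by linear_combination hE.sum
  have hC : (s₁ / 2 - s₀ / 2 + 1 / 2 - s) + (s - 1 / 2 + α i / 2) + (s₀ + α k) / 2 +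
      (s₀ + α j) / 2 - u / 2 = (s₀ - u + s₁) / 2 := by rw [hk]; ring
  -- For s₀ = 1 − αᵢ the first factor is Γ((1 − u)/2); for s₀ = 2s − 1 the second one is. The other
  -- factor is the same in both cases.
  have hpair : Gamma ((s₀ - u + α i) / 2) * Gamma (s - (s₀ + u) / 2) =
      Gamma ((1 - u) / 2) * Gamma (s - 1 / 2 + α i / 2 - u / 2) := by
    rcases hs₀ with h | h
    · rw [h]; congr 2 <;> ring
    · rw [h, mul_comm]; congr 2 <;> ring
  rw [hC, dualIntegrand, hE.prod, hE.prod]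
  congr 1
  rw [show (s₁ - (s₀ - u)) / 2 + 1 / 2 - s = s₁ / 2 - s₀ / 2 + 1 / 2 - s + u / 2 by ring,
    show (s₀ - u + α j) / 2 = (s₀ + α j) / 2 - u / 2 by ring,
    show (s₀ - u + α k) / 2 = (s₀ + α k) / 2 - u / 2 by ring]
  rw [mul_div_assoc']
  refine Eq.trans ?_ (mul_div_mul_left _ _ hne)
  congr 1
  linear_combination (Gamma (u / 2) * Gamma (s₁ / 2 - s₀ / 2 + 1 / 2 - s + u / 2) *
    Gamma ((s₀ + α j) / 2 - u / 2) * Gamma ((s₀ + α k) / 2 - u / 2)) * hpair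

/-- Bounds for the real part of the parameter `s₀`. -/
theorem IsEnumeration.re_bounds (hE : IsEnumeration α i j k) {s₀ s : ℂ}
    (hs₀ : s₀ = 1 - α i ∨ s₀ = 2 * s - 1) (hs : s ∈ strip (1 / 2 + eps) 4) :
    (1 / 100 + 1 / 1000 < s₀.re ∧ s₀.re < 7) ∧ 1 / 2 + 1 / 100 < s.re ∧ s.re < 4 := by
  have h1 : 1 / 2 + 1 / 100 < s.re := hs.1
  have h2 := hs.2
  have h3 := abs_lt.mp (hE.small i)
  rcases hs₀ with h | h
  · refine ⟨?_, h1, h2⟩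
    rw [h]; simp; constructor <;> linarith
  · refine ⟨?_, h1, h2⟩
    rw [h]; simp; constructor <;> linarith

theorem vint_const_mul (c : ℝ) (a : ℂ) (f : ℂ → ℂ) : vint c (fun z => a * f z) = a * vint c f := by
  simp only [vint]
  rw [integral_const_mul]
  ring

theorem vint_congr {c : ℝ} {f g : ℂ → ℂ} (h : ∀ z : ℂ, z.re = c → f z = g z) : vint c f = vint c g := by
  simp only [vint]
  congr 2
  ext v
  exact h _ (by simp)

theorem dualTransform_eq (hη : 40 < η) (hE : IsEnumeration α i j k) {s₀ s a₁ : ℂ}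
    (h : s₀ = 1 - α i ∧ a₁ = -α i / 2 ∨ s₀ = 2 * s - 1 ∧ a₁ = 1 / 2 - s + α i / 2)
    (hs : s ∈ strip (1 / 2 + eps) 4) :
    dualTransform η α H s₀ s = 2 * (Real.sqrt Real.pi : ℂ) *
      (Gamma (s - 1 / 2 + α i / 2) * Gamma ((s₀ + α k) / 2) * Gamma ((s₀ + α j) / 2)) *
      mellinBarnes η H a₁ (1 / 2 - s + α k / 2) (1 / 2 - s + α j / 2) s := by
  have hs₀ : s₀ = 1 - α i ∨ s₀ = 2 * s - 1 := h.imp And.left And.left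
  obtain ⟨⟨b1, b2⟩, b3, b4⟩ := hE.re_bounds hs₀ hs
  have ci := abs_lt.mp (hE.small i)
  have cj := abs_lt.mp (hE.small j)
  have ck := abs_lt.mp (hE.small k)
  have hk : α k = -α i - α j := by linear_combination hE.sum
  rw [dualTransform, mellinBarnes, mul_assoc (2 * _), mul_comm 2 (_ : ℂ), mul_assoc (Real.sqrt Real.pi : ℂ)]
  congr 1
  rw [← vint_const_mul, ← vint_const_mul]
  refine vint_congr fun s₁ hs₁ => ?_
  rw [vint_congr fun u hu => dualIntegrand_eq (H := H) hE hs₀ s₁ (u := u) (by rw [hu, eps]; norm_num),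
    vint_const_mul, vint_barnes_half (by rw [eps]; norm_num)
      (by simp [hs₁, eps]; linarith) (by simp [eps]; linarith)
      (by simp [eps]; linarith) (by simp [eps]; linarith)]
  set A := s₁ / 2 - s₀ / 2 + 1 / 2 - s with hA
  have n1 : Gamma ((s₁ - α j) / 2) ≠ 0 := Gamma_ne_zero_of_re_pos (by simp [hs₁]; linarith)
  have n2 : Gamma ((s₁ - α k) / 2) ≠ 0 := Gamma_ne_zero_of_re_pos (by simp [hs₁]; linarith)
  have n3 : Gamma ((s₁ - α i) / 2) ≠ 0 := Gamma_ne_zero_of_re_pos (by simp [hs₁]; linarith)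
  -- Two of the three Barnes denominators are Γ((s₁ − αₖ)/2) and Γ((s₁ − αⱼ)/2), which cancel
  -- factors of the outer integrand.
  rw [show A + (s - 1 / 2 + α i / 2) + (s₀ + α j) / 2 = (s₁ - α k) / 2 by rw [hA, hk]; ring,
    show A + (s - 1 / 2 + α i / 2) + (s₀ + α k) / 2 = (s₁ - α j) / 2 by rw [hA, hk]; ring,
    show A + (s₀ + α k) / 2 = 1 / 2 - s + α k / 2 + s₁ / 2 by rw [hA]; ring,
    show A + (s₀ + α j) / 2 = 1 / 2 - s + α j / 2 + s₁ / 2 by rw [hA]; ring]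
  rw [gammaQuot]
  set G₂ := Gamma (1 / 2 - s + α k / 2 + s₁ / 2)
  set G₃ := Gamma (1 / 2 - s + α j / 2 + s₁ / 2)
  set m := mellin (flat H) (s - s₁ - 1 / 2) * (Real.pi : ℂ) ^ (-s₁)
  rcases h with ⟨h1, h2⟩ | ⟨h1, h2⟩
  -- For s₀ = 1 − αᵢ the numerator Γ(A + B₁) cancels Γ((1 + s₁)/2 − s₀), and the third Barnes
  -- denominator becomes that of `gammaQuot`.
  · have n4 : Gamma ((1 + s₁) / 2 - s₀) ≠ 0 :=
      Gamma_ne_zero_of_re_pos (by simp [hs₁]; linarith)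
    rw [show A + (s - 1 / 2 + α i / 2) = (1 + s₁) / 2 - s₀ by rw [hA, h1]; ring,
      show 1 / 2 - s + α k / 2 + s₁ / 2 + (s₀ + α j) / 2 =
        s + a₁ + (1 / 2 - s + α k / 2) + (1 / 2 - s + α j / 2) + s₁ / 2 by rw [h2, h1, hk]; ring,
      show a₁ + s₁ / 2 = (s₁ - α i) / 2 by rw [h2]; ring]
    generalize Gamma ((1 + s₁) / 2 - s₀) = X at n4 ⊢
    field_simp
  -- For s₀ = 2s − 1 the third Barnes denominator cancels Γ((s₁ − αᵢ)/2), and Γ((1 + s₁)/2 − s₀)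
  -- stays as the denominator of `gammaQuot`.
  · rw [show A + (s - 1 / 2 + α i / 2) = a₁ + s₁ / 2 by rw [hA, h1, h2]; ring,
      show 1 / 2 - s + α k / 2 + s₁ / 2 + (s₀ + α j) / 2 = (s₁ - α i) / 2 by rw [h1, hk]; ring,
      show (1 + s₁) / 2 - s₀ =
        s + a₁ + (1 / 2 - s + α k / 2) + (1 / 2 - s + α j / 2) + s₁ / 2 by rw [h2, h1, hk]; ring]
    field_simp

theorem TestClass.dualConverges (hH : TestClass η H) (hη : 40 < η) (hE : IsEnumeration α i j k)
    {s₀ s : ℂ} (hs₀ : s₀ = 1 - α i ∨ s₀ = 2 * s - 1) (hs : s ∈ strip (1 / 2 + eps) 4) :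
    DualConverges η α H s₀ s := by
  obtain ⟨⟨b1, b2⟩, b3, b4⟩ := hE.re_bounds hs₀ hs
  have ci := abs_lt.mp (hE.small i)
  have cj := abs_lt.mp (hE.small j)
  have ck := abs_lt.mp (hE.small k)
  obtain ⟨N, hN1, hN2⟩ := exists_nat_between hη
  obtain ⟨D, hD, hm⟩ := hH.exists_norm_mellin_flat_le hN2 (a := -η) (b := 4 - η) (by linarith) (by linarith)
  set p : ℝ → ℂ := fun v => ((η - 1 / 2 : ℝ) : ℂ) + v * I with hp
  set q : ℝ → ℂ := fun v => (eps : ℂ) + v * I with hq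
  have hpr : ∀ v, (p v).re = η - 1 / 2 := fun v => by simp [hp]
  have hqr : ∀ v, (q v).re = 1 / 100 := fun v => by simp [hq, eps]
  have hpi : ∀ v, (p v).im = v := fun v => by simp [hp]
  have hpc : Continuous p := by fun_prop
  have hqc : Continuous q := by fun_prop
  have hπ : (Real.pi : ℂ) ≠ 0 := by simp [Real.pi_ne_zero]
  set B₁ := s - 1 / 2 + α i / 2 with hB₁
  set B₂ := (s₀ + α k) / 2 with hB₂
  set B₃ := (s₀ + α j) / 2 with hB₃
  set A := -s₀ / 2 + 1 / 2 - s with hA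
  have r1 : 1 / 200 < B₁.re := by simp [hB₁]; linarith
  have r2 : 1 / 200 < B₂.re := by simp [hB₂]; linarith
  have r3 : 1 / 200 < B₃.re := by simp [hB₃]; linarith
  have r3' : B₃.re < 4 := by simp [hB₃]; linarith
  have r4 : -8 < A.re ∧ A.re < 0 := by simp [hA]; constructor <;> linarith
  have hC : ∀ z w : ℂ, (z / 2 - s₀ / 2 + 1 / 2 - s) + B₁ + B₂ + B₃ - w / 2 =
      (z - α j) / 2 + (B₃ - w / 2) := fun z w => by
    rw [hB₁, hB₂, hB₃]; linear_combination (1 / 2 : ℂ) * hE.sum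
  -- The factor mixing s₁ and u is placed in `gammaQuot` as a₂ = A + u/2, whose bound is uniform in
  -- Im u. The remaining mixed quotient is a beta function. Thus the integrand is dominated by (1 +
  -- v²)⁻¹ in s₁ times |Γ(u/2)|.
  have heq : ∀ z : ℝ × ℝ, dualIntegrand α H s₀ s (p z.1) (q z.2) =
      mellin (flat H) (s - p z.1 - 1 / 2) * (Real.pi : ℂ) ^ (-p z.1) *
      gammaQuot (-α i / 2) (A + q z.2 / 2) (-α k / 2) (1 / 2 - s₀) (p z.1) *
      (Gamma (q z.2 / 2) * Gamma (B₁ - q z.2 / 2) * Gamma (B₂ - q z.2 / 2)) *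
      (Gamma ((p z.1 - α j) / 2) * Gamma (B₃ - q z.2 / 2) /
        Gamma ((p z.1 - α j) / 2 + (B₃ - q z.2 / 2))) := fun z => by
    rw [dualIntegrand_eq hE hs₀ _ (by rw [hqr]; norm_num), hC, gammaQuot,
      show p z.1 / 2 - s₀ / 2 + 1 / 2 - s + q z.2 / 2 = A + q z.2 / 2 + p z.1 / 2 by rw [hA]; ring,
      show (p z.1 - α i) / 2 = -α i / 2 + p z.1 / 2 by ring,
      show (p z.1 - α k) / 2 = -α k / 2 + p z.1 / 2 by ring,
      show (1 + p z.1) / 2 - s₀ = 1 / 2 - s₀ + p z.1 / 2 by ring]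
    ring
  set δ := B₃.re - 1 / 200 with hδ
  set M := ‖α i‖ + ‖α k‖ + ‖(1 / 2 - s₀ : ℂ)‖ + η with hM
  have hM0 : 0 ≤ M := by positivity
  obtain ⟨C, hC0, hCb⟩ := exists_norm_gammaQuot_le 8 (δ := 1 / 10) (by norm_num) hM0
  set E := ∫ x in (0 : ℝ)..1, ‖(x : ℂ) ^ ((δ : ℂ) - 1) * (1 - (x : ℂ)) ^ ((δ : ℂ) - 1)‖ with hE'
  have hi : Integrable (fun v : ℝ => ‖Gamma (q v / 2)‖) := by
    have := (integrable_Gamma_line (a := ((1 / 200 : ℝ) : ℂ)) (1 / 2) (by norm_num) (by simp)).norm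
    refine this.congr (Filter.Eventually.of_forall fun v => ?_)
    simp only [hq, eps]
    congr 2
    push_cast
    ring
  have hdom := (integrable_inv_one_add_sq.mul_prod hi).const_mul
    (D * Real.pi ^ (-(η - 1 / 2)) * C * (Real.Gamma (B₁.re - 1 / 200) * Real.Gamma (B₂.re - 1 / 200)) * E)
  rw [DualConverges]
  show Integrable (fun z : ℝ × ℝ => dualIntegrand α H s₀ s (p z.1) (q z.2))
  simp only [heq]
  have hre2 : ∀ v : ℝ, (s - p v - 1 / 2).re = s.re - η := fun v => by
    simp [hpr]; ring
  refine Integrable.mono' hdom (Continuous.aestronglyMeasurable ?_) (Filter.Eventually.of_forall fun z => ?_)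
  · refine Continuous.mul (Continuous.mul (Continuous.mul (Continuous.mul ?_ ?_) ?_) ?_) ?_
    · refine continuous_iff_continuousAt.mpr fun z => ?_
      refine ContinuousAt.comp (f := fun z : ℝ × ℝ => s - p z.1 - 1 / 2) (g := mellin (flat H))
        (hH.differentiableAt_mellin_flat hN2 ?_).continuousAt (by fun_prop)
      rw [hre2]; linarith
    · exact Continuous.const_cpow (by fun_prop) (Or.inl hπ)
    · have h1 : Continuous fun z : ℝ × ℝ => Gamma (-α i / 2 + p z.1 / 2) :=
        continuous_Gamma_comp (by fun_prop) fun z => by simp [hpr]; linarith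
      have h2 : Continuous fun z : ℝ × ℝ => Gamma (A + q z.2 / 2 + p z.1 / 2) :=
        continuous_Gamma_comp (by fun_prop) fun z => by simp [hpr, hqr]; linarith
      have h3 : Continuous fun z : ℝ × ℝ => Gamma (-α k / 2 + p z.1 / 2) :=
        continuous_Gamma_comp (by fun_prop) fun z => by simp [hpr]; linarith
      have h4 : Continuous fun z : ℝ × ℝ => Gamma (1 / 2 - s₀ + p z.1 / 2) :=
        continuous_Gamma_comp (by fun_prop) fun z => by simp [hpr]; linarith
      exact (h1.mul h2).mul (h3.div h4 fun z => Gamma_ne_zero_of_re_pos (by simp [hpr]; linarith))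
    · have h1 : Continuous fun z : ℝ × ℝ => Gamma (q z.2 / 2) :=
        continuous_Gamma_comp (by fun_prop) fun z => by simp [hqr]
      have h2 : Continuous fun z : ℝ × ℝ => Gamma (B₁ - q z.2 / 2) :=
        continuous_Gamma_comp (by fun_prop) fun z => by simp [hqr]; linarith
      have h3 : Continuous fun z : ℝ × ℝ => Gamma (B₂ - q z.2 / 2) :=
        continuous_Gamma_comp (by fun_prop) fun z => by simp [hqr]; linarith
      exact (h1.mul h2).mul h3
    · have h1 : Continuous fun z : ℝ × ℝ => Gamma ((p z.1 - α j) / 2) :=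
        continuous_Gamma_comp (by fun_prop) fun z => by simp [hpr]; linarith
      have h2 : Continuous fun z : ℝ × ℝ => Gamma (B₃ - q z.2 / 2) :=
        continuous_Gamma_comp (by fun_prop) fun z => by simp [hqr]; linarith
      have h3 : Continuous fun z : ℝ × ℝ => Gamma ((p z.1 - α j) / 2 + (B₃ - q z.2 / 2)) :=
        continuous_Gamma_comp (by fun_prop) fun z => by simp [hpr, hqr]; linarith
      exact (h1.mul h2).div h3 fun z => Gamma_ne_zero_of_re_pos (by simp [hpr, hqr]; linarith)
  · have q1 := norm_nonneg (α i)
    have q2 := norm_nonneg (α k)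
    have q3 := norm_nonneg (1 / 2 - s₀)
    have n1 := hm (s - p z.1 - 1 / 2) (by rw [hre2]; linarith) (by rw [hre2]; linarith)
    have n2 := hCb (-α i / 2) (A + q z.2 / 2) (-α k / 2) (1 / 2 - s₀) (p z.1)
      (by rw [norm_div, norm_neg]; norm_num; linarith) (by rw [norm_div, norm_neg]; norm_num; linarith)
      (by linarith) (by simp [hpr]; linarith) (by simp [hpr]; linarith) (by simp [hpr, hqr]; linarith)
      (by simp [hpr, hqr]; linarith) (by simp [hpr]; linarith) (by simp; linarith)
    rw [hpi] at n2
    have n3 : ‖Gamma (B₁ - q z.2 / 2)‖ ≤ Real.Gamma (B₁.re - 1 / 200) := by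
      have e : (B₁ - q z.2 / 2).re = B₁.re - 1 / 200 := by simp [hqr]; norm_num
      rw [← e]
      exact norm_Gamma_le (by rw [e]; linarith)
    have n4 : ‖Gamma (B₂ - q z.2 / 2)‖ ≤ Real.Gamma (B₂.re - 1 / 200) := by
      have e : (B₂ - q z.2 / 2).re = B₂.re - 1 / 200 := by simp [hqr]; norm_num
      rw [← e]
      exact norm_Gamma_le (by rw [e]; linarith)
    have x1 : 0 < ((p z.1 - α j) / 2).re := by simp [hpr]; linarith
    have x2 : δ ≤ ((p z.1 - α j) / 2).re := by simp [hpr]; linarith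
    have x3 : δ ≤ (B₃ - q z.2 / 2).re := by simp [hqr, hδ]; norm_num
    have x4 : 0 < δ := by linarith
    -- Γ(x)Γ(y)/Γ(x + y) is bounded by the absolute beta integral at (δ, δ), whatever the imaginary
    -- parts.
    have n5 := norm_betaIntegral_le x4 x2 x3
    rw [betaIntegral_eq_Gamma_mul_div _ _ x1 (x4.trans_le x3)] at n5
    have hE0 : 0 ≤ E := (norm_nonneg _).trans n5
    have g1 := Real.Gamma_nonneg_of_nonneg (s := B₁.re - 1 / 200) (by linarith)
    have g2 := Real.Gamma_nonneg_of_nonneg (s := B₂.re - 1 / 200) (by linarith)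
    have hpp := Real.pi_pos
    rw [norm_mul, norm_mul, norm_mul, norm_mul, norm_mul (_ * _) (Gamma (B₂ - _)), norm_mul (Gamma _),
      norm_cpow_eq_rpow_re_of_pos Real.pi_pos, neg_re, hpr]
    calc _ ≤ D * Real.pi ^ (-(η - 1 / 2)) * (C * (1 + z.1 ^ 2)⁻¹) *
          (‖Gamma (q z.2 / 2)‖ * Real.Gamma (B₁.re - 1 / 200) * Real.Gamma (B₂.re - 1 / 200)) * E := by
          gcongr
      _ = _ := by ring

end

/-! ### Simple poles and the continuations -/

/-- The other poles p − 1, p − 2, … lie in Re s < 0. -/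
theorem differentiableOn_Gamma_sub {p : ℂ} (hp : p.re < 1) :
    DifferentiableOn ℂ (fun s => Gamma (s - p)) ({s : ℂ | 0 < s.re} \ {p}) := by
  intro s hs
  refine DifferentiableAt.differentiableWithinAt ?_
  have : DifferentiableAt ℂ Gamma (s - p) := by
    refine differentiableAt_Gamma _ fun m hm => ?_
    rcases m.eq_zero_or_pos with h0 | h0
    · rw [h0] at hm
      exact hs.2 (by simpa [sub_eq_zero] using hm)
    · have h1 := congrArg re hm
      have h2 : 0 < s.re := hs.1
      have h3 : (1 : ℝ) ≤ m := by exact_mod_cast h0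
      simp at h1
      linarith
  exact this.comp s (f := fun s => s - p) (by fun_prop)

theorem analyticAt_Gamma_sub {p s : ℂ} (hp : p.re < 1) (hs : 0 < s.re) (hsp : s ≠ p) :
    AnalyticAt ℂ (fun s => Gamma (s - p)) s :=
  (differentiableOn_Gamma_sub hp).analyticAt
    (((isOpen_lt continuous_const continuous_re).sdiff isClosed_singleton).mem_nhds ⟨hs, hsp⟩)

/-- `Γ(s - p) g(s)` has at most a simple pole at `p` when `g` is analytic there. -/
theorem meromorphicAt_Gamma_sub_mul {p : ℂ} {g : ℂ → ℂ} (hg : AnalyticAt ℂ g p) :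
    MeromorphicAt (fun s => Gamma (s - p) * g s) p ∧
      (-1 : WithTop ℤ) ≤ meromorphicOrderAt (fun s => Gamma (s - p) * g s) p := by
  have hΓ : AnalyticAt ℂ (fun s => Gamma (s - p + 1)) p := by
    refine DifferentiableOn.analyticAt (s := {s : ℂ | p.re - 1 < s.re}) (fun s hs => ?_)
      ((isOpen_lt continuous_const continuous_re).mem_nhds (by simp))
    have hs' : p.re - 1 < s.re := hs
    refine DifferentiableAt.differentiableWithinAt ?_
    have : DifferentiableAt ℂ Gamma (s - p + 1) := by
      refine differentiableAt_Gamma _ fun m hm => ?_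
      have h1 := congrArg re hm
      have h3 : (0 : ℝ) ≤ m := by positivity
      simp at h1
      linarith
    exact this.comp s (f := fun s => s - p + 1) (by fun_prop)
  have hG : AnalyticAt ℂ (fun s => Gamma (s - p + 1) * g s) p := hΓ.mul hg
  have hl : MeromorphicAt (fun s : ℂ => s - p) p := by fun_prop
  have heq : (fun s => Gamma (s - p) * g s) =ᶠ[nhdsWithin p {p}ᶜ]
      ((fun s : ℂ => s - p)⁻¹ * fun s => Gamma (s - p + 1) * g s) := by
    filter_upwards [self_mem_nhdsWithin] with s hs
    have h : s - p ≠ 0 := sub_ne_zero.mpr hs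
    rw [Pi.mul_apply, Pi.inv_apply, Gamma_add_one _ h]
    field_simp
  refine ⟨(hl.inv.mul hG.meromorphicAt).congr heq.symm, ?_⟩
  rw [meromorphicOrderAt_congr heq, meromorphicOrderAt_mul hl.inv hG.meromorphicAt,
    meromorphicOrderAt_inv]
  have h1 : meromorphicOrderAt (fun s : ℂ => s - p) p = 1 := meromorphicOrderAt_id_sub_const
  rw [h1]
  exact le_add_of_nonneg_right hG.meromorphicOrderAt_nonneg

section

variable {η : ℝ} {H : ℂ → ℂ} {α : Fin 3 → ℂ} {i j k : Fin 3}

/-- The conditions −2 Re aᵢ < σ leave room for a line κ < σ on which the formula for h̃ holds and to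
which the contour can be moved from η − 1/2 without crossing poles. -/
theorem TestClass.mellinBarnes_eq (hH : TestClass η H) (hη : 40 < η) {s a₁ a₂ a₃ : ℂ}
    (hs0 : 0 < s.re) (hs1 : s.re < 1) (h₁ : -2 * a₁.re < s.re) (h₂ : -2 * a₂.re < s.re)
    (h₃ : -2 * a₃.re < s.re) :
    mellinBarnes η H a₁ a₂ a₃ s = 1 / 2 * (Real.pi : ℂ) ^ (-s) *
      (vint 0 (fun μ => H μ / ((‖Gamma μ‖ ^ 2 : ℝ) : ℂ) *
        (gammaPM (2 * a₁ + s) μ * gammaPM (2 * a₂ + s) μ * gammaPM (2 * a₃ + s) μ)) /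
        (Gamma (s + a₂ + a₃) * Gamma (s + a₁ + a₃) * Gamma (s + a₁ + a₂))) := by
  obtain ⟨N, hN1, hN2⟩ := exists_nat_between hη
  obtain ⟨κ, hκm, hκ⟩ := exists_between (max_lt h₁ (max_lt h₂ h₃))
  simp only [max_lt_iff] at hκm
  obtain ⟨k1, k2, k3⟩ := hκm
  rw [mellinBarnes, hH.vint_mellin_flat_shift hN2 (κ := κ) (by linarith) (by linarith) (by linarith) hκ
    (by linarith) (by linarith), hH.vint_mellin_flat_mul_gammaQuot (by linarith) (by linarith)
    (by linarith) (by linarith) hκ, vint_zero_div_norm_Gamma_sq]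

theorem sqrt_pi_mul_cpow (s : ℂ) :
    (Real.sqrt Real.pi : ℂ) * (Real.pi : ℂ) ^ (-s) = (Real.pi : ℂ) ^ (1 / 2 - s) := by
  have hpi : (Real.pi : ℂ) ≠ 0 := by simp [Real.pi_ne_zero]
  rw [sub_eq_add_neg, cpow_add _ _ hpi, Real.sqrt_eq_rpow, ofReal_cpow Real.pi_pos.le]
  simp

theorem isOpen_strip (a b : ℝ) : IsOpen (strip a b) :=
  (isOpen_lt continuous_const continuous_re).inter (isOpen_lt continuous_re continuous_const)

/-- The continuation of the dual transform at `s₀ = 1 - αᵢ`. -/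
noncomputable def dualTwo (η : ℝ) (H : ℂ → ℂ) (α : Fin 3 → ℂ) (i j k : Fin 3) (s : ℂ) : ℂ :=
  Gamma (s - (1 - α i) / 2) * (2 * (Real.sqrt Real.pi : ℂ) *
    (Gamma ((1 - α i + α k) / 2) * Gamma ((1 - α i + α j) / 2)) *
    mellinBarnes η H (-α i / 2) (1 / 2 - s + α k / 2) (1 / 2 - s + α j / 2) s)

/-- The continuation of the dual transform at `s₀ = 2s - 1`. -/
noncomputable def dualThree (η : ℝ) (H : ℂ → ℂ) (α : Fin 3 → ℂ) (i j k : Fin 3) (s : ℂ) : ℂ :=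
  (∏ l, Gamma (s - (1 - α l) / 2)) * (2 * (Real.sqrt Real.pi : ℂ) *
    mellinBarnes η H (1 / 2 - s + α i / 2) (1 / 2 - s + α k / 2) (1 / 2 - s + α j / 2) s)

theorem TestClass.isContinuation_dualTwo (hH : TestClass η H) (hη : 40 < η)
    (hE : IsEnumeration α i j k) :
    IsContinuation (fun s => dualTransform η α H (1 - α i) s) (dualTwo η H α i j k)
      (strip (1 / 2 + eps) 4) (strip (max 0 (α i).re) 4) {(1 - α i) / 2} := by
  have ci := abs_lt.mp (hE.small i)
  have cj := abs_lt.mp (hE.small j)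
  have ck := abs_lt.mp (hE.small k)
  have hd : DifferentiableOn ℂ (fun s => 2 * (Real.sqrt Real.pi : ℂ) *
      (Gamma ((1 - α i + α k) / 2) * Gamma ((1 - α i + α j) / 2)) *
      mellinBarnes η H (-α i / 2) (1 / 2 - s + α k / 2) (1 / 2 - s + α j / 2) s) (strip 0 4) := by
    refine DifferentiableOn.const_mul (hH.differentiableOn_mellinBarnes hη (a₁ := fun _ => -α i / 2)
      (a₂ := fun s => 1 / 2 - s + α k / 2) (a₃ := fun s => 1 / 2 - s + α j / 2)
      (by fun_prop) (by fun_prop) (by fun_prop) ?_ ?_ ?_ ?_) _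
    all_goals
      rintro s ⟨h1, h2⟩
      simp
      linarith
  have hsub : strip (max 0 (α i).re) 4 ⊆ strip 0 4 := fun s hs => ⟨(le_max_left _ _).trans_lt hs.1, hs.2⟩
  have hp : ((1 - α i) / 2).re < 1 ∧ 0 < ((1 - α i) / 2).re := by simp; constructor <;> linarith
  refine ⟨fun s hs => ⟨?_, hs.2⟩, fun s hs => ?_, ?_, ?_⟩
  · have : 1 / 2 + eps < s.re := hs.1
    rw [eps] at this
    exact max_lt (by linarith) (by linarith)
  · rw [dualTransform_eq hη hE (Or.inl ⟨rfl, rfl⟩) hs, dualTwo,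
      show s - (1 - α i) / 2 = s - 1 / 2 + α i / 2 by ring]
    ring
  · exact ((differentiableOn_Gamma_sub hp.1).mono (sdiff_subset_sdiff_left fun s hs => (hsub hs).1)).mul
      (hd.mono (sdiff_subset.trans hsub))
  · rintro p rfl
    exact meromorphicAt_Gamma_sub_mul (hd.analyticAt ((isOpen_strip 0 4).mem_nhds ⟨hp.2, by linarith⟩))

theorem TestClass.isContinuation_dualThree (hH : TestClass η H) (hη : 40 < η)
    (hE : IsEnumeration α i j k) (hdist : Function.Injective α) :
    IsContinuation (fun s => dualTransform η α H (2 * s - 1) s) (dualThree η H α i j k)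
      (strip (1 / 2 + eps) 4) (strip 0 4) {p : ℂ | ∃ i : Fin 3, p = (1 - α i) / 2} := by
  have hc := fun l => abs_lt.mp (hE.small l)
  have ci := hc i
  have cj := hc j
  have ck := hc k
  have hd : DifferentiableOn ℂ (fun s => 2 * (Real.sqrt Real.pi : ℂ) *
      mellinBarnes η H (1 / 2 - s + α i / 2) (1 / 2 - s + α k / 2) (1 / 2 - s + α j / 2) s)
      (strip 0 4) := by
    refine DifferentiableOn.const_mul (hH.differentiableOn_mellinBarnes hη
      (a₁ := fun s => 1 / 2 - s + α i / 2)
      (a₂ := fun s => 1 / 2 - s + α k / 2) (a₃ := fun s => 1 / 2 - s + α j / 2)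
      (by fun_prop) (by fun_prop) (by fun_prop) ?_ ?_ ?_ ?_) _
    all_goals
      rintro s ⟨h1, h2⟩
      simp
      linarith
  have hp : ∀ l, ((1 - α l) / 2).re < 1 ∧ 0 < ((1 - α l) / 2).re := fun l => by
    have := hc l
    simp; constructor <;> linarith
  refine ⟨fun s hs => ⟨?_, hs.2⟩, fun s hs => ?_, ?_, ?_⟩
  · have : 1 / 2 + eps < s.re := hs.1
    rw [eps] at this
    linarith
  · rw [dualTransform_eq hη hE (Or.inr ⟨rfl, rfl⟩) hs, dualThree, hE.prod,
      show s - (1 - α i) / 2 = s - 1 / 2 + α i / 2 by ring,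
      show s - (1 - α j) / 2 = (2 * s - 1 + α j) / 2 by ring,
      show s - (1 - α k) / 2 = (2 * s - 1 + α k) / 2 by ring]
    ring
  · refine DifferentiableOn.mul (DifferentiableOn.fun_finsetProd fun l _ => ?_) (hd.mono sdiff_subset)
    exact (differentiableOn_Gamma_sub (hp l).1).mono fun s hs => ⟨hs.1.1, fun h => hs.2 ⟨l, h⟩⟩
  · rintro p ⟨l, rfl⟩
    have heq : dualThree η H α i j k = fun s => Gamma (s - (1 - α l) / 2) *
        ((∏ m ∈ Finset.univ.erase l, Gamma (s - (1 - α m) / 2)) * (2 * (Real.sqrt Real.pi : ℂ) *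
        mellinBarnes η H (1 / 2 - s + α i / 2) (1 / 2 - s + α k / 2) (1 / 2 - s + α j / 2) s)) := by
      funext s
      rw [dualThree, ← Finset.mul_prod_erase _ _ (Finset.mem_univ l), mul_assoc]
    rw [heq]
    refine meromorphicAt_Gamma_sub_mul (AnalyticAt.mul (Finset.analyticAt_fun_prod _ fun m hm => ?_)
      (hd.analyticAt ((isOpen_strip 0 4).mem_nhds ⟨(hp l).2, by linarith [(hp l).1]⟩)))
    -- Distinctness of the αₗ is what makes the poles simple: at (1 − αₗ)/2 the other two Gamma
    -- factors are analytic.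
    refine analyticAt_Gamma_sub (hp m).1 (hp l).2 fun h => (Finset.ne_of_mem_erase hm) (hdist ?_)
    linear_combination 2 * h

theorem TestClass.dualTwo_eq (hH : TestClass η H) (hη : 40 < η) (hE : IsEnumeration α i j k) {s : ℂ}
    (hs0 : 0 < s.re) (hs1 : s.re < 1) (hi : (α i).re < s.re)
    (hl : ∀ l, l ≠ i → s.re < 1 + (α l).re) :
    VerticalIntegrable (twoSwap α i H s) 0 ∧
      dualTwo η H α i j k s = (Real.pi : ℂ) ^ (1 / 2 - s) *
        (Gamma (s - 1 / 2 + α i / 2) / Gamma (1 - s - α i / 2)) * vint 0 (twoSwap α i H s) := by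
  have ci := abs_lt.mp (hE.small i)
  have cj := abs_lt.mp (hE.small j)
  have ck := abs_lt.mp (hE.small k)
  have lj := hl j hE.ne_j
  have lk := hl k hE.ne_k
  have hk : α k = -α i - α j := by linear_combination hE.sum
  have htwo : twoSwap α i H s = fun μ => H μ / ((‖Gamma μ‖ ^ 2 : ℝ) : ℂ) *
      (gammaPM (s - α i) μ * gammaPM (1 - s + α k) μ * gammaPM (1 - s + α j) μ) := by
    funext μ
    rw [twoSwap, hE.prod_erase]
    ring
  constructor
  · rw [htwo]
    exact hH.verticalIntegrable_mul_gammaPM (by linarith) (by simp; linarith) (by simp; linarith)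
      (by simp; linarith)
  · rw [htwo, dualTwo, hH.mellinBarnes_eq hη hs0 hs1 (by simp; linarith) (by simp; linarith)
      (by simp; linarith), ← sqrt_pi_mul_cpow,
      show 2 * (-α i / 2) + s = s - α i by ring,
      show 2 * (1 / 2 - s + α k / 2) + s = 1 - s + α k by ring,
      show 2 * (1 / 2 - s + α j / 2) + s = 1 - s + α j by ring,
      show s - (1 - α i) / 2 = s - 1 / 2 + α i / 2 by ring,
      -- The values Γ(s + a₁ + a₂) and Γ(s + a₁ + a₃) are free of s and cancel the constant Gamma
      -- factors in `dualTwo`; Γ(s + a₂ + a₃) becomes Γ(1 − s − αᵢ/2).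
      show s + (1 / 2 - s + α k / 2) + (1 / 2 - s + α j / 2) = 1 - s - α i / 2 by rw [hk]; ring,
      show s + -α i / 2 + (1 / 2 - s + α k / 2) = (1 - α i + α k) / 2 by ring,
      show s + -α i / 2 + (1 / 2 - s + α j / 2) = (1 - α i + α j) / 2 by ring]
    have n1 : Gamma ((1 - α i + α k) / 2) ≠ 0 := Gamma_ne_zero_of_re_pos (by simp; linarith)
    have n2 : Gamma ((1 - α i + α j) / 2) ≠ 0 := Gamma_ne_zero_of_re_pos (by simp; linarith)
    generalize Gamma ((1 - α i + α k) / 2) = X at n1 ⊢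
    generalize Gamma ((1 - α i + α j) / 2) = Y at n2 ⊢
    generalize vint 0 _ = V
    generalize Gamma (1 - s - α i / 2) = Z
    generalize Gamma (s - 1 / 2 + α i / 2) = W
    field_simp

theorem TestClass.dualThree_eq (hH : TestClass η H) (hη : 40 < η) (hE : IsEnumeration α i j k) {s : ℂ}
    (hs0 : 0 < s.re) (hs1 : s.re < 1) (hl : ∀ l, s.re < 1 + (α l).re) :
    VerticalIntegrable (threeSwap α H s) 0 ∧
      dualThree η H α i j k s = (Real.pi : ℂ) ^ (1 / 2 - s) *
        (∏ i, Gamma (s - 1 / 2 + α i / 2) / Gamma (1 - s - α i / 2)) * vint 0 (threeSwap α H s) := by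
  have li := hl i
  have lj := hl j
  have lk := hl k
  have hk : α k = -α i - α j := by linear_combination hE.sum
  have hthree : threeSwap α H s = fun μ => H μ / ((‖Gamma μ‖ ^ 2 : ℝ) : ℂ) *
      (gammaPM (1 - s + α i) μ * gammaPM (1 - s + α k) μ * gammaPM (1 - s + α j) μ) := by
    funext μ
    rw [threeSwap, hE.prod]
    ring
  constructor
  · rw [hthree]
    exact hH.verticalIntegrable_mul_gammaPM (by linarith) (by simp; linarith) (by simp; linarith)
      (by simp; linarith)
  · rw [hthree, dualThree, hE.prod, hE.prod, hH.mellinBarnes_eq hη hs0 hs1 (by simp; linarith)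
      (by simp; linarith) (by simp; linarith), ← sqrt_pi_mul_cpow,
      show 2 * (1 / 2 - s + α i / 2) + s = 1 - s + α i by ring,
      show 2 * (1 / 2 - s + α k / 2) + s = 1 - s + α k by ring,
      show 2 * (1 / 2 - s + α j / 2) + s = 1 - s + α j by ring,
      show s - (1 - α i) / 2 = s - 1 / 2 + α i / 2 by ring,
      show s - (1 - α j) / 2 = s - 1 / 2 + α j / 2 by ring,
      show s - (1 - α k) / 2 = s - 1 / 2 + α k / 2 by ring,
      show s + (1 / 2 - s + α k / 2) + (1 / 2 - s + α j / 2) = 1 - s - α i / 2 by rw [hk]; ring,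
      show s + (1 / 2 - s + α i / 2) + (1 / 2 - s + α k / 2) = 1 - s - α j / 2 by rw [hk]; ring,
      show s + (1 / 2 - s + α i / 2) + (1 / 2 - s + α j / 2) = 1 - s - α k / 2 by rw [hk]; ring]
    simp only [div_eq_mul_inv, mul_inv]
    ring

end

end MellinBarnesSwap

/-! ### Assembly of the three identities -/

theorem theorem2 (η : ℝ) (hη : 40 < η) (H : ℂ → ℂ) (hH : MellinBarnesSwap.TestClass η H)
    (α : Fin 3 → ℂ) (hsum : α 0 + α 1 + α 2 = 0) (hdist : Function.Injective α)
    (hα₀ : |(α 0).re| < MellinBarnesSwap.eps / 1000)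
    (hα₁ : |(α 1).re| < MellinBarnesSwap.eps / 1000) :
    -- the 1-swap identity
    (∀ w : MellinBarnesSwap.Weyl, (w = .w2 ∨ w = .w4 ∨ w = .wl) →
      ∀ s : ℂ, 0 < s.re → s.re < 1 →
        -(w.act α 0).re < s.re → -(w.act α 1).re < s.re → s.re < 1 - (w.act α 2).re →
        IntegrableOn (fun p : ℝ × ℝ =>
            MellinBarnesSwap.swapIntegrand (w.act α) (MellinBarnesSwap.flat H) s p.1 p.2)
          (Ioi 0 ×ˢ Ioi 0) ∧
        VerticalIntegrable (MellinBarnesSwap.oneSwap (w.act α) H s) 0 ∧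
        MellinBarnesSwap.swapJ α (MellinBarnesSwap.flat H) s w =
          (Real.pi : ℂ) ^ (-(s - w.act α 2 / 2)) / 8
            * (Gamma ((1 + w.act α 1 - w.act α 2) / 2))⁻¹
            * (Gamma ((1 + w.act α 0 - w.act α 2) / 2))⁻¹
            * MellinBarnesSwap.vint 0 (MellinBarnesSwap.oneSwap (w.act α) H s)) ∧
    -- the 2-swap identities
    (∀ i : Fin 3,
      (∀ s ∈ MellinBarnesSwap.strip (1 / 2 + MellinBarnesSwap.eps) 4,
        MellinBarnesSwap.DualConverges η α H (1 - α i) s) ∧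
      ∃ F : ℂ → ℂ,
        MellinBarnesSwap.IsContinuation
          (fun s => MellinBarnesSwap.dualTransform η α H (1 - α i) s) F
          (MellinBarnesSwap.strip (1 / 2 + MellinBarnesSwap.eps) 4)
          (MellinBarnesSwap.strip (max 0 (α i).re) 4)
          {(1 - α i) / 2} ∧
        ∀ s : ℂ, 0 < s.re → s.re < 1 → (α i).re < s.re →
          (∀ j : Fin 3, j ≠ i → s.re < 1 + (α j).re) → s ≠ (1 - α i) / 2 →
          VerticalIntegrable (MellinBarnesSwap.twoSwap α i H s) 0 ∧
          F s = (Real.pi : ℂ) ^ (1 / 2 - s)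
            * (Gamma (s - 1 / 2 + α i / 2) / Gamma (1 - s - α i / 2))
            * MellinBarnesSwap.vint 0 (MellinBarnesSwap.twoSwap α i H s)) ∧
    -- the 3-swap identity
    ((∀ s ∈ MellinBarnesSwap.strip (1 / 2 + MellinBarnesSwap.eps) 4,
        MellinBarnesSwap.DualConverges η α H (2 * s - 1) s) ∧
      ∃ F : ℂ → ℂ,
        MellinBarnesSwap.IsContinuation
          (fun s => MellinBarnesSwap.dualTransform η α H (2 * s - 1) s) F
          (MellinBarnesSwap.strip (1 / 2 + MellinBarnesSwap.eps) 4)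
          (MellinBarnesSwap.strip 0 4)
          {p : ℂ | ∃ i : Fin 3, p = (1 - α i) / 2} ∧
        ∀ s : ℂ, 0 < s.re → s.re < 1 → (∀ i : Fin 3, s.re < 1 + (α i).re) →
          (∀ i : Fin 3, s ≠ (1 - α i) / 2) →
          VerticalIntegrable (MellinBarnesSwap.threeSwap α H s) 0 ∧
          F s = (Real.pi : ℂ) ^ (1 / 2 - s)
            * (∏ i, Gamma (s - 1 / 2 + α i / 2) / Gamma (1 - s - α i / 2))
            * MellinBarnesSwap.vint 0 (MellinBarnesSwap.threeSwap α H s)) := by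
  have he : MellinBarnesSwap.eps / 1000 = 1 / 100000 := by rw [MellinBarnesSwap.eps]; norm_num
  rw [he] at hα₀ hα₁
  -- The third parameter is −α₀ − α₁, so its real part is below 2/100000 in absolute value; 1/10000
  -- is a common bound.
  have hα : ∀ l, |(α l).re| < 1 / 10000 := by
    have h := congrArg re hsum
    simp only [add_re, zero_re] at h
    rw [abs_lt] at hα₀ hα₁
    intro l
    rw [abs_lt]
    fin_cases l
    · exact ⟨by simp; linarith, by simp; linarith⟩
    · exact ⟨by simp; linarith, by simp; linarith⟩
    · exact ⟨by simp; linarith, by simp; linarith⟩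
  refine ⟨fun w hw s _ _ h0 h1 h2 => ?_, fun i => ?_, ?_⟩
  · have hβ : w.act α 0 + w.act α 1 + w.act α 2 = 0 := by
      rcases hw with rfl | rfl | rfl
      · simpa [MellinBarnesSwap.Weyl.act, add_comm] using hsum
      · simp [MellinBarnesSwap.Weyl.act]; linear_combination hsum
      · simp [MellinBarnesSwap.Weyl.act]; linear_combination hsum
    obtain ⟨hi, hJ⟩ := hH.swap_identity (by linarith) hβ h0 h1 h2
    refine ⟨hi, ?_, hJ⟩
    exact hH.verticalIntegrable_mul_gammaPM (by linarith) (by simp; linarith) (by simp; linarith)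
      (by simp; linarith)
  · obtain ⟨j, k, hE⟩ := MellinBarnesSwap.exists_isEnumeration hsum hα i
    exact ⟨fun s hs => hH.dualConverges hη hE (Or.inl rfl) hs, _, hH.isContinuation_dualTwo hη hE,
      fun s hs0 hs1 hi hl _ => hH.dualTwo_eq hη hE hs0 hs1 hi hl⟩
  -- Any index may play the role of i here, since the value at s₀ = 2s − 1 is symmetric in the three
  -- parameters.
  · obtain ⟨j, k, hE⟩ := MellinBarnesSwap.exists_isEnumeration hsum hα 0
    exact ⟨fun s hs => hH.dualConverges hη hE (Or.inr rfl) hs, _,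
      hH.isContinuation_dualThree hη hE hdist,
      fun s hs0 hs1 hl _ => hH.dualThree_eq hη hE hs0 hs1 hl⟩
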